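/- Let $M$ be a smooth ($C^\infty$) manifold (Hausdorff, second countable) of dimension $n$, and let $\mathbb TM=TM\oplus T^*M$ carry the inner product $\langle X+\alpha,Y+\beta\rangle=\frac12(\alpha(Y)+\beta(X))$ and the Dorfman bracket $[\![X+\alpha,Y+\beta]\!]=[X,Y]+L_X\beta-\iota_Y d\alpha$. A section $\mathbf x=X+\alpha$ acts on differential forms $\Omega_M$ by $\eta\mapsto\iota_X\eta+\alpha\wedge\eta$. A *generalized polynomial structure* of degree $N\ge 1$ with minimal polynomial $P$ is a smooth endomorphism $\varphi$ of $\mathbb TM$, skew-symmetric for $\langle\cdot,\cdot\rangle$, such that the monic polynomial $P\in\mathbb R[x]$ of degree $N$ is the minimal polynomial of $\varphi_p$ for every $p\in M$. Let $\varphi_s$ and $\varphi_n$ be the semisimple and nilpotent parts of $\varphi$ (fibrewise Jordan–Chevalley decomposition). The *lift* $\widetilde\varphi$ of $\varphi$ is the unique even $\mathbb R$-linear operator on $\Omega_M$ which commutes with multiplication by smooth functions and satisfies $[\widetilde\varphi,\mathbf x]=\varphi(\mathbf x)$ for all sections $\mathbf x$ of $\mathbb TM$ and $\widetilde\varphi(1)\in\Omega^2_M$.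 The structure $\varphi$ with minimal polynomial $P$ is *minimal* if, for $\delta_\varphi=P(\mathrm{ad}_{\widetilde\varphi})(d)$ with $d$ the de Rham differential, the derived bracket $[[\mathbf x,\delta_\varphi],\mathbf y]$ (graded commutators) vanishes for all sections $\mathbf x,\mathbf y$ of $\mathbb TM$. For an endomorphism $\varphi$ of $\mathbb TM$ put $$\mathcal T_\varphi(\mathbf x,\mathbf y)=\varphi^2[\![\mathbf x,\mathbf y]\!]+[\![\varphi\mathbf x,\varphi\mathbf y]\!]-\varphi\big([\![\varphi\mathbf x,\mathbf y]\!]+[\![\mathbf x,\varphi\mathbf y]\!]\big),\qquad \mathcal S_\varphi(\mathbf x,\mathbf y)=\mathcal T_\varphi(\varphi\mathbf x,\mathbf y)+\mathcal T_\varphi(\mathbf x,\varphi\mathbf y).$$ Call $\varphi$ a *generalized Nijenhuis operator* if $\mathcal T_\varphi=0$, and a *weak generalized Nijenhuis operator* if $\mathcal S_\varphi=0$. The *bivariate Courant–Nijenhuis torsion* of commuting endomorphisms $\varphi',\varphi''$ is $\mathcal T_{\varphi'+\varphi''}-\mathcal T_{\varphi'}-\mathcal T_{\varphi''}$. **(A)**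 Let $\varphi$ be a generalized polynomial structure of degree $4$ with exactly three distinct (complex) eigenvalues. Then $\varphi$ is minimal if and only if all of the following hold: 1. $\varphi_s$ is a weak generalized Nijenhuis operator; 2. $\varphi_n$ is a generalized Nijenhuis operator; 3. the bivariate Courant–Nijenhuis torsion of $\varphi_s$ and $\varphi_n$ vanishes. **(B)** Here a *generalized F-structure* is a generalized polynomial structure $\mathcal J$ with minimal polynomial $x^3+x$. With $L_\lambda\subseteq\mathbb TM\otimes\mathbb C$ the $\lambda$-eigenbundle of $\mathcal J$, it is *strongly integrable* if $[\![L_{\pm i},L_{\pm i}]\!]\subseteq L_{\pm i}$ and $[\![L_0,L_{\pm i}]\!]\subseteq L_0\oplus L_{\pm i}$ (same sign throughout each inclusion). A *weak generalized tangent structure* is a generalized polynomial structure with minimal polynomial $x^2$ that is a generalized Nijenhuis operator. Then $\varphi\mapsto(\varphi_s,\varphi_n)$ is a bijection from the set of minimal generalized polynomial structures with minimal polynomial $x^2(x^2+1)$ onto the set of pairs $(\mathcal J_1,\mathcal J_2)$ consisting of a strongly integrable generalized F-structure $\mathcal J_1$ and a weak generalized tangent structure $\mathcal J_2$ such that $\mathcal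 J_1\circ\mathcal J_2=0=\mathcal J_2\circ\mathcal J_1$ and the bivariate Courant–Nijenhuis torsion of $\mathcal J_1$ and $\mathcal J_2$ vanishes. -/

import Mathlib

open scoped Manifold ContDiff TensorProduct Bundle

noncomputable section
namespace GenPoly

section fiber
variable {V : Type*} [AddCommGroup V] [Module ℝ V] [TopologicalSpace V]

/-- Interior product `(ι_X η)(v₁,…,v_k) = η(X,v₁,…,v_k)`. -/
def interior {k : ℕ} (X : V) (η : V [⋀^Fin (k + 1)]→L[ℝ] ℝ) : V [⋀^Fin k]→L[ℝ] ℝ :=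
  { η.toAlternatingMap.curryLeft X with
    cont := η.cont.comp (continuous_const.matrixVecCons continuous_id) }

/-- Exterior product with a covector,
`(α ∧ η)(v₀,…,v_k) = ∑ᵢ (-1)ⁱ α(vᵢ) η(v₀,…,v̂ᵢ,…,v_k)`. -/
def wedge {k : ℕ} (α : V →L[ℝ] ℝ) (η : V [⋀^Fin k]→L[ℝ] ℝ) : V [⋀^Fin (k + 1)]→L[ℝ] ℝ :=
  { AlternatingMap.alternatizeUncurryFin (α.toLinearMap.smulRight η.toAlternatingMap) with
    cont := by
      change Continuous fun v : Fin (k + 1) → V =>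
        AlternatingMap.alternatizeUncurryFin (α.toLinearMap.smulRight η.toAlternatingMap) v
      simp only [AlternatingMap.alternatizeUncurryFin_apply]
      refine continuous_finsetSum _ fun i _ => ?_
      change Continuous fun v : Fin (k + 1) → V => (-1 : ℤ) ^ (i : ℕ) • (α (v i) * η (i.removeNth v))
      have h : Continuous fun v : Fin (k + 1) → V => α (v i) * η (i.removeNth v) :=
        (α.continuous.comp (continuous_apply i)).mul
          (η.cont.comp (continuous_pi fun j => continuous_apply _))
      exact h.const_smul ((-1 : ℤ) ^ (i : ℕ)) }

@[simp] theorem interior_apply {k : ℕ} (X : V) (η : V [⋀^Fin (k + 1)]→L[ℝ] ℝ) (v : Fin k → V) :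
    interior X η v = η (Matrix.vecCons X v) := rfl

theorem wedge_apply {k : ℕ} (α : V →L[ℝ] ℝ) (η : V [⋀^Fin k]→L[ℝ] ℝ) (v : Fin (k + 1) → V) :
    wedge α η v = ∑ i : Fin (k + 1), (-1) ^ (i : ℕ) • (α (v i) * η (i.removeNth v)) := by
  change AlternatingMap.alternatizeUncurryFin (α.toLinearMap.smulRight η.toAlternatingMap) v = _
  simp only [AlternatingMap.alternatizeUncurryFin_apply]
  rfl
theorem wedge_add {k : ℕ} (α : V →L[ℝ] ℝ) (η θ : V [⋀^Fin k]→L[ℝ] ℝ) :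
    wedge α (η + θ) = wedge α η + wedge α θ := by
  ext v
  simp [wedge_apply, mul_add, Finset.sum_add_distrib]

theorem wedge_smul {k : ℕ} (α : V →L[ℝ] ℝ) (c : ℝ) (η : V [⋀^Fin k]→L[ℝ] ℝ) :
    wedge α (c • η) = c • wedge α η := by
  ext v
  simp [wedge_apply, Finset.mul_sum, mul_left_comm]

end fiber


theorem interior_comp {W : Type*} [AddCommGroup W] [Module ℝ W] [TopologicalSpace W]
    {V : Type*} [AddCommGroup V] [Module ℝ V] [TopologicalSpace V] {k : ℕ} (X : W)
    (η : V [⋀^Fin (k + 1)]→L[ℝ] ℝ) (f : W →L[ℝ] V) :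
    (interior (f X) η).compContinuousLinearMap f =
      interior X (η.compContinuousLinearMap f) := by
  ext v
  refine congrArg η (funext fun i => ?_)
  cases i using Fin.cases <;> simp

theorem wedge_comp {W : Type*} [AddCommGroup W] [Module ℝ W] [TopologicalSpace W]
    {V : Type*} [AddCommGroup V] [Module ℝ V] [TopologicalSpace V] {k : ℕ} (α : V →L[ℝ] ℝ)
    (η : V [⋀^Fin k]→L[ℝ] ℝ) (f : W →L[ℝ] V) :
    (wedge α η).compContinuousLinearMap f =
      wedge (α.comp f) (η.compContinuousLinearMap f) := by
  ext v
  simp only [ContinuousAlternatingMap.compContinuousLinearMap_apply, wedge_apply]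
  rfl

section manifold

/-- The model space `ℝⁿ`. -/
abbrev Model (n : ℕ) : Type := EuclideanSpace ℝ (Fin n)

variable {n : ℕ} {M : Type*} [TopologicalSpace M] [ChartedSpace (Model n) M]
  [IsManifold (𝓡 n) ∞ M]

/-- The inverse of the differential at `q` of the preferred chart around `p`. -/
def frame (p q : M) : Model n →L[ℝ] TangentSpace (𝓡 n) q :=
  (trivializationAt (Model n) (TangentSpace (𝓡 n)) p).symmL ℝ q

/-- The differential at `q` of the preferred chart around `p`. -/
def coframe (p q : M) : TangentSpace (𝓡 n) q →L[ℝ] Model n :=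
  (trivializationAt (Model n) (TangentSpace (𝓡 n)) p).continuousLinearMapAt ℝ q

theorem frame_coframe {p q : M} (h : q ∈ (chartAt (Model n) p).source)
    (v : TangentSpace (𝓡 n) q) : frame p q (coframe p q v) = v :=
  Bundle.Trivialization.symmL_continuousLinearMapAt _ (by simpa using h) v

theorem coframe_frame {p q : M} (h : q ∈ (chartAt (Model n) p).source) (v : Model n) :
    coframe p q (frame p q v) = v :=
  Bundle.Trivialization.continuousLinearMapAt_symmL _ (by simpa using h) v

variable (n M) in
/-- Not necessarily smooth fields of alternating `k`-forms on the tangent spaces. -/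
abbrev FormField (k : ℕ) : Type _ := ∀ p : M, (TangentSpace (𝓡 n) p) [⋀^Fin k]→L[ℝ] ℝ

/-- The expression of a field of `k`-forms in the preferred chart around `p`. -/
def FormField.inChart {k : ℕ} (η : FormField n M k) (p : M) (y : Model n) :
    (Model n) [⋀^Fin k]→L[ℝ] ℝ :=
  (η ((extChartAt (𝓡 n) p).symm y)).compContinuousLinearMap
    (frame p ((extChartAt (𝓡 n) p).symm y))

variable (n M) in
/-- Smooth differential `k`-forms: their expression in every preferred chart is smooth. -/
def smoothForms (k : ℕ) : Submodule ℝ (FormField n M k) where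
  carrier := {η | ∀ p, ContDiffOn ℝ ∞ (η.inChart p) (extChartAt (𝓡 n) p).target}
  add_mem' h₁ h₂ p := (h₁ p).add (h₂ p)
  zero_mem' _ := contDiffOn_const (c := 0)
  smul_mem' c _ h p := (h p).const_smul c

/-- The exterior derivative, computed at `p` in the preferred chart around `p`. -/
def FormField.extDer {k : ℕ} (η : FormField n M k) : FormField n M (k + 1) := fun p =>
  (extDeriv (η.inChart p) (extChartAt (𝓡 n) p p)).compContinuousLinearMap (coframe p p)

/-- The transition map between two preferred charts. -/
def trans (p q : M) : Model n → Model n := extChartAt (𝓡 n) q ∘ (extChartAt (𝓡 n) p).symm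

theorem coframe_comp_frame {p q r : M} (hp : r ∈ (chartAt (Model n) p).source)
    (hq : r ∈ (chartAt (Model n) q).source) :
    (coframe q r).comp (frame p r) = fderiv ℝ (trans p q) (extChartAt (𝓡 n) p r) := by
  have h1 : (coframe q r).comp (frame p r) = tangentCoordChange (𝓡 n) p q r := by
    unfold coframe frame
    rw [TangentBundle.continuousLinearMapAt_trivializationAt_eq_core hq,
      TangentBundle.symmL_trivializationAt_eq_core hp]
    ext1 v
    refine tangentCoordChange_comp (I := 𝓡 n) (w := p) (x := r) (y := q) (z := r) ?_
    simp [hp, hq]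
  rw [h1, tangentCoordChange_def]
  simp [trans, fderivWithin_univ]

theorem contDiffAt_trans {p q r : M} (hp : r ∈ (chartAt (Model n) p).source)
    (hq : r ∈ (chartAt (Model n) q).source) :
    ContDiffAt ℝ ∞ (trans p q) (extChartAt (𝓡 n) p r) := by
  have h : extChartAt (𝓡 n) p r ∈
      ((extChartAt (𝓡 n) p).symm ≫ extChartAt (𝓡 n) q).source := by
    simp [PartialEquiv.trans_source, hp, hq]
  have := contDiffWithinAt_ext_coord_change (I := 𝓡 n) (n := ∞) q p h
  simpa [trans, contDiffWithinAt_univ] using this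

theorem FormField.inChart_eq_pullback {k : ℕ} (η : FormField n M k) {p q : M} {y : Model n}
    (hy : y ∈ (extChartAt (𝓡 n) p).target)
    (hq : (extChartAt (𝓡 n) p).symm y ∈ (chartAt (Model n) q).source) :
    η.inChart p y =
      (η.inChart q (trans p q y)).compContinuousLinearMap (fderiv ℝ (trans p q) y) := by
  have hp : (extChartAt (𝓡 n) p).symm y ∈ (chartAt (Model n) p).source := by
    simpa using (extChartAt (𝓡 n) p).map_target hy
  have h := coframe_comp_frame hp hq
  rw [(extChartAt (𝓡 n) p).right_inv hy] at h
  have e : (extChartAt (𝓡 n) q).symm (trans p q y) = (extChartAt (𝓡 n) p).symm y :=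
    (extChartAt (𝓡 n) q).left_inv (by simpa using hq)
  unfold FormField.inChart
  rw [e, ← h]
  refine ContinuousAlternatingMap.ext fun v => congrArg (η _) (funext fun i => ?_)
  exact (frame_coframe hq _).symm

theorem FormField.inChart_extDer {k : ℕ} {η : FormField n M k} (hη : η ∈ smoothForms n M k)
    {p : M} {y : Model n} (hy : y ∈ (extChartAt (𝓡 n) p).target) :
    η.extDer.inChart p y = extDeriv (η.inChart p) y := by
  set q := (extChartAt (𝓡 n) p).symm y with hqdef
  have hp : q ∈ (chartAt (Model n) p).source := by
    rw [← extChartAt_source (𝓡 n) p]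
    exact (extChartAt (𝓡 n) p).map_target hy
  have hqq : q ∈ (chartAt (Model n) q).source := mem_chart_source _ q
  have hyq : extChartAt (𝓡 n) p q = y := (extChartAt (𝓡 n) p).right_inv hy
  have hty : trans p q y = extChartAt (𝓡 n) q q := rfl
  have hev : η.inChart p =ᶠ[nhds y] fun z =>
      (η.inChart q (trans p q z)).compContinuousLinearMap (fderiv ℝ (trans p q) z) := by
    have h1 : (extChartAt (𝓡 n) p).target ∈ nhds y := extChartAt_target_mem_nhds' hy
    have h2 : (extChartAt (𝓡 n) p).symm ⁻¹' (chartAt (Model n) q).source ∈ nhds y :=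
      (continuousAt_extChartAt_symm'' hy).preimage_mem_nhds
        ((chartAt (Model n) q).open_source.mem_nhds hqq)
    filter_upwards [h1, h2] with z hz1 hz2
    exact η.inChart_eq_pullback hz1 hz2
  rw [hev.extDeriv_eq]
  have hd : DifferentiableAt ℝ (η.inChart q) (trans p q y) := by
    rw [hty]
    exact ((hη q).contDiffAt (extChartAt_target_mem_nhds q)).differentiableAt (by simp)
  have ht : ContDiffAt ℝ ∞ (trans p q) y := hyq ▸ contDiffAt_trans hp hqq
  rw [extDeriv_pullback hd ht (by simpa using WithTop.coe_le_coe.2 (le_top : (2 : ℕ∞) ≤ ⊤)), hty]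
  have h := coframe_comp_frame hp hqq
  rw [hyq] at h
  rw [← h]
  rfl

theorem FormField.extDer_mem {k : ℕ} {η : FormField n M k} (hη : η ∈ smoothForms n M k) :
    η.extDer ∈ smoothForms n M (k + 1) := by
  intro p
  have h : ContDiffOn ℝ ∞ (fun y => extDeriv (η.inChart p) y) (extChartAt (𝓡 n) p).target := by
    have := (hη p).fderiv_of_isOpen (m := ∞) (isOpen_extChartAt_target p) (by simp)
    exact (ContinuousAlternatingMap.alternatizeUncurryFinCLM ℝ (Model n) ℝ).contDiff.comp_contDiffOn this
  exact h.congr fun y hy => FormField.inChart_extDer hη hy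

variable (n M) in
/-- The exterior derivative on smooth `k`-forms. -/
def extDerₗ (k : ℕ) : smoothForms n M k →ₗ[ℝ] smoothForms n M (k + 1) where
  toFun η := ⟨η.1.extDer, FormField.extDer_mem η.2⟩
  map_add' η θ := by
    refine Subtype.ext (funext fun p => ?_)
    have h (ζ : smoothForms n M k) : DifferentiableAt ℝ (ζ.1.inChart p) (extChartAt (𝓡 n) p p) :=
      ((ζ.2 p).contDiffAt (extChartAt_target_mem_nhds p)).differentiableAt (by simp)
    change (extDeriv (η.1.inChart p + θ.1.inChart p) _).compContinuousLinearMap _ = _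
    rw [extDeriv_add (h η) (h θ)]
    rfl
  map_smul' c η := by
    refine Subtype.ext (funext fun p => ?_)
    change (extDeriv (c • η.1.inChart p) _).compContinuousLinearMap _ = _
    rw [extDeriv_smul]
    rfl


/-- Multiplication of `k`-forms by a smooth function. -/
def FormField.smulFun {k : ℕ} (f : M → ℝ) (η : FormField n M k) : FormField n M k :=
  fun p => f p • η p

theorem contDiffOn_comp_chart {f : M → ℝ} (hf : ContMDiff (𝓡 n) 𝓘(ℝ, ℝ) ∞ f) (p : M) :
    ContDiffOn ℝ ∞ (f ∘ (extChartAt (𝓡 n) p).symm) (extChartAt (𝓡 n) p).target :=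
  (hf.comp_contMDiffOn (contMDiffOn_extChartAt_symm p)).contDiffOn

theorem FormField.smulFun_mem {k : ℕ} {f : M → ℝ} (hf : ContMDiff (𝓡 n) 𝓘(ℝ, ℝ) ∞ f)
    {η : FormField n M k} (hη : η ∈ smoothForms n M k) : η.smulFun f ∈ smoothForms n M k :=
  fun p => (contDiffOn_comp_chart hf p).smul (hη p)

/-- The fibre of the generalized tangent bundle `TM ⊕ T*M`. -/
abbrev GT (n : ℕ) {M : Type*} [TopologicalSpace M] [ChartedSpace (Model n) M] (p : M) : Type :=
  TangentSpace (𝓡 n) p × (TangentSpace (𝓡 n) p →L[ℝ] ℝ)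

variable (n M) in
/-- Smooth sections `X + α` of `TM ⊕ T*M`. -/
def genSections : Submodule ℝ (∀ p : M, GT n p) where
  carrier := {x |
    ContMDiff (𝓡 n) (𝓡 n).tangent ∞ (fun p => (⟨p, (x p).1⟩ : TangentBundle (𝓡 n) M)) ∧
    ∀ p, ContDiffOn ℝ ∞ (fun y => (x ((extChartAt (𝓡 n) p).symm y)).2.comp
      (frame p ((extChartAt (𝓡 n) p).symm y))) (extChartAt (𝓡 n) p).target}
  add_mem' h₁ h₂ := ⟨h₁.1.add_section h₂.1, fun p => (h₁.2 p).add (h₂.2 p)⟩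
  zero_mem' := ⟨Bundle.contMDiff_zeroSection ℝ _, fun _ => contDiffOn_const (c := 0)⟩
  smul_mem' c _ h := ⟨h.1.const_smul_section, fun p => (h.2 p).const_smul c⟩

theorem genSections_vector_inChart {x : ∀ p : M, GT n p} (hx : x ∈ genSections n M) (p : M) :
    ContDiffOn ℝ ∞ (fun y => coframe p ((extChartAt (𝓡 n) p).symm y)
      (x ((extChartAt (𝓡 n) p).symm y)).1) (extChartAt (𝓡 n) p).target := by
  have h := (Bundle.Trivialization.contMDiffOn_section_baseSet_iff (n := ∞) (IB := 𝓡 n)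
    (trivializationAt (Model n) (TangentSpace (𝓡 n)) p) (s := fun q => (x q).1)).1 hx.1.contMDiffOn
  have h2 : ContMDiffOn (𝓡 n) 𝓘(ℝ, Model n) ∞ (fun q : M => coframe p q (x q).1)
      (chartAt (Model n) p).source := by
    refine h.congr fun q hq => ?_
    unfold coframe
    rw [Bundle.Trivialization.continuousLinearMapAt_apply,
      Bundle.Trivialization.coe_linearMapAt_of_mem _ (by simpa using hq)]
  have h3 := h2.comp (contMDiffOn_extChartAt_symm (n := ∞) p) (fun y hy => by
    rw [← extChartAt_source (𝓡 n) p]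
    exact (extChartAt (𝓡 n) p).map_target hy)
  exact h3.contDiffOn

/-- The interior product of a field of forms with the vector part of a section. -/
def FormField.contract {k : ℕ} (x : ∀ p : M, GT n p) (η : FormField n M (k + 1)) :
    FormField n M k := fun p => interior (x p).1 (η p)

/-- The exterior product of the covector part of a section with a field of forms. -/
def FormField.extMul {k : ℕ} (x : ∀ p : M, GT n p) (η : FormField n M k) :
    FormField n M (k + 1) := fun p => wedge (x p).2 (η p)

theorem FormField.contract_mem {k : ℕ} {x : ∀ p : M, GT n p} (hx : x ∈ genSections n M)
    {η : FormField n M (k + 1)} (hη : η ∈ smoothForms n M (k + 1)) :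
    η.contract x ∈ smoothForms n M k := by
  intro p
  have h1 := ((ContinuousAlternatingMap.curryLeftLI (𝕜 := ℝ) (E := Model n) (F := ℝ)
    (n := k)).toContinuousLinearMap.contDiff.comp_contDiffOn (hη p)).clm_apply
    (genSections_vector_inChart hx p)
  refine h1.congr fun y hy => ?_
  have hp : (extChartAt (𝓡 n) p).symm y ∈ (chartAt (Model n) p).source := by
    rw [← extChartAt_source (𝓡 n) p]
    exact (extChartAt (𝓡 n) p).map_target hy
  unfold FormField.inChart FormField.contract
  conv_lhs => rw [← frame_coframe hp (x _).1, interior_comp]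
  rfl

theorem FormField.extMul_mem {k : ℕ} {x : ∀ p : M, GT n p} (hx : x ∈ genSections n M)
    {η : FormField n M k} (hη : η ∈ smoothForms n M k) :
    η.extMul x ∈ smoothForms n M (k + 1) := by
  intro p
  have h1 := (hx.2 p).smulRight (hη p)
  have h2 := (ContinuousAlternatingMap.alternatizeUncurryFinCLM ℝ (Model n)
    ℝ).contDiff.comp_contDiffOn h1
  refine h2.congr fun y hy => ?_
  unfold FormField.inChart FormField.extMul
  rw [wedge_comp]
  ext v
  rw [wedge_apply]
  simp only [Function.comp_apply, ContinuousAlternatingMap.alternatizeUncurryFinCLM_apply,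
    ContinuousAlternatingMap.alternatizeUncurryFin_apply]
  rfl

variable (n M) in
/-- The space `Ω(M)` of smooth differential forms of all degrees. -/
def Forms : Type _ := ∀ k : ℕ, smoothForms n M k

instance : AddCommGroup (Forms n M) := inferInstanceAs (AddCommGroup (∀ k, smoothForms n M k))

instance : Module ℝ (Forms n M) := inferInstanceAs (Module ℝ (∀ k, smoothForms n M k))

variable (n M) in
/-- The `ℝ`-linear endomorphisms of `Ω(M)`. -/
abbrev FormOp : Type _ := Module.End ℝ (Forms n M)

variable (n M) in
/-- The de Rham differential. -/
def deRham : FormOp n M where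
  toFun η := fun k => match k with
    | 0 => 0
    | k + 1 => extDerₗ n M k (η k)
  map_add' η θ := by
    funext k
    cases k with
    | zero => exact (add_zero 0).symm
    | succ k => exact map_add (extDerₗ n M k) _ _
  map_smul' c η := by
    funext k
    cases k with
    | zero => exact (smul_zero c).symm
    | succ k => exact map_smul (extDerₗ n M k) _ _

/-- Multiplication by a smooth function, as an operator on forms. -/
def funOp (f : C^∞⟮𝓡 n, M; ℝ⟯) : FormOp n M where
  toFun η := fun k => ⟨(η k).1.smulFun f, FormField.smulFun_mem f.contMDiff (η k).2⟩
  map_add' η θ := by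
    funext k
    exact Subtype.ext (funext fun p => smul_add (f p) _ _)
  map_smul' c η := by
    funext k
    exact Subtype.ext (funext fun p => smul_comm (f p) c _)

/-- A section `X + α` acting on forms by `η ↦ ι_X η + α ∧ η`. -/
def cliff (x : genSections n M) : FormOp n M where
  toFun η := fun k => match k with
    | 0 => ⟨(η 1).1.contract x.1, FormField.contract_mem x.2 (η 1).2⟩
    | k + 1 => ⟨(η (k + 2)).1.contract x.1 + (η k).1.extMul x.1,
        add_mem (FormField.contract_mem x.2 (η (k + 2)).2) (FormField.extMul_mem x.2 (η k).2)⟩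
  map_add' η θ := by
    funext k
    refine Subtype.ext (funext fun p => ?_)
    cases k with
    | zero => rfl
    | succ k =>
      exact (congrArg (interior (x.1 p).1 _ + ·) (wedge_add _ _ _)).trans
        (add_add_add_comm (interior (x.1 p).1 ((η (k + 2)).1 p))
          (interior (x.1 p).1 ((θ (k + 2)).1 p)) (wedge (x.1 p).2 ((η k).1 p))
          (wedge (x.1 p).2 ((θ k).1 p)))
  map_smul' c η := by
    funext k
    refine Subtype.ext (funext fun p => ?_)
    cases k with
    | zero => rfl
    | succ k =>
      exact (congrArg (interior (x.1 p).1 _ + ·) (wedge_smul _ _ _)).trans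
        (smul_add c (interior (x.1 p).1 ((η (k + 2)).1 p)) _).symm


/-- The constant function `1`, as a differential form. -/
def oneForms : Forms n M := fun k => match k with
  | 0 => ⟨fun _ => ContinuousAlternatingMap.constOfIsEmpty ℝ _ (Fin 0) 1,
      fun _ => contDiffOn_const (c := ContinuousAlternatingMap.constOfIsEmpty ℝ _ (Fin 0) 1)⟩
  | _ + 1 => 0

/-- The tautological inner product `⟨X + α, Y + β⟩ = (α(Y) + β(X)) / 2`. -/
def pairing {p : M} (a b : GT n p) : ℝ := (a.2 b.1 + b.2 a.1) / 2

variable (n M) in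
/-- Fibrewise linear endomorphisms of `TM ⊕ T*M`. -/
abbrev EndoField : Type _ := ∀ p : M, Module.End ℝ (GT n p)

/-- The action of a fibrewise endomorphism on sections. -/
def EndoField.act (φ : EndoField n M) (x : ∀ p : M, GT n p) : ∀ p : M, GT n p :=
  fun p => φ p (x p)

/-- Skew-symmetric endomorphisms: smooth (they preserve smooth sections) and skew for the
tautological inner product. -/
structure IsSkewEndo (φ : EndoField n M) : Prop where
  smooth : ∀ x ∈ genSections n M, φ.act x ∈ genSections n M
  skew : ∀ (p : M) (a b : GT n p), pairing (φ p a) b + pairing a (φ p b) = 0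

/-- Generalized polynomial structures with minimal polynomial `P`. -/
structure IsGPS (φ : EndoField n M) (P : Polynomial ℝ) : Prop where
  skewEndo : IsSkewEndo φ
  monic : P.Monic
  degree_pos : 0 < P.natDegree
  minpoly_eq : ∀ p : M, minpoly ℝ (φ p) = P

/-- The lift of `φ` to an even operator on forms. -/
structure IsLift (φ : EndoField n M) (ψ : FormOp n M) : Prop where
  even_even : ∀ η : Forms n M, (∀ k, Odd k → η k = 0) → ∀ k, Odd k → ψ η k = 0
  even_odd : ∀ η : Forms n M, (∀ k, Even k → η k = 0) → ∀ k, Even k → ψ η k = 0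
  comm_fun : ∀ f : C^∞⟮𝓡 n, M; ℝ⟯, ψ * funOp f - funOp f * ψ = 0
  comm_section : ∀ x y : genSections n M, y.1 = φ.act x.1 → ψ * cliff x - cliff x * ψ = cliff y
  map_one : ∀ k, k ≠ 2 → ψ oneForms k = 0

/-- `ad_ψ = [ψ, ·]` for an even operator `ψ`. -/
def adOp (ψ : FormOp n M) : Module.End ℝ (FormOp n M) :=
  LinearMap.mulLeft ℝ ψ - LinearMap.mulRight ℝ ψ

/-- The minimal operator `P(ad_ψ)(d)`. -/
def minimalOp (P : Polynomial ℝ) (ψ : FormOp n M) : FormOp n M :=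
  Polynomial.aeval (adOp ψ) P (deRham n M)

/-- The derived bracket `[[a, δ], b]` (graded commutators) of odd operators `a`, `b` with respect
to an odd operator `δ`. -/
def derivedBracket (δ a b : FormOp n M) : FormOp n M :=
  (a * δ + δ * a) * b - b * (a * δ + δ * a)

/-- Minimality: the minimal torsion, i.e. the derived bracket with respect to the minimal operator
`P(ad_ψ)(d)`, vanishes; here `P` is the minimal polynomial of `φ` and `ψ` is its lift. -/
def IsMinimal (φ : EndoField n M) : Prop :=
  ∃ (P : Polynomial ℝ) (ψ : FormOp n M), IsGPS φ P ∧ IsLift φ ψ ∧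
    ∀ x y : genSections n M, derivedBracket (minimalOp P ψ) (cliff x) (cliff y) = 0

/-- The covector part of a section of `TM ⊕ T*M`, as a field of `1`-forms. -/
def covector (x : ∀ p : M, GT n p) : FormField n M 1 :=
  fun p => ContinuousAlternatingMap.ofSubsingleton ℝ _ ℝ 0 (x p).2

/-- The Dorfman bracket `[X + α, Y + β] = [X, Y] + L_X β - ι_Y dα`, where
`L_X β = ι_X dβ + d(ι_X β)`; it is the derived bracket with respect to `d`. -/
def dorfman (x y : ∀ p : M, GT n p) : ∀ p : M, GT n p := fun p =>
  (VectorField.mlieBracket (𝓡 n) (fun q => (x q).1) (fun q => (y q).1) p,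
    (ContinuousAlternatingMap.ofSubsingleton ℝ (TangentSpace (𝓡 n) p) ℝ (0 : Fin 1)).symm
      ((covector y).extDer.contract x p + ((covector y).contract x).extDer p
        - (covector x).extDer.contract y p))

/-- The Courant-Nijenhuis torsion. -/
def torsion (φ : EndoField n M) (x y : ∀ p : M, GT n p) : ∀ p : M, GT n p :=
  φ.act (φ.act (dorfman x y)) + dorfman (φ.act x) (φ.act y)
    - φ.act (dorfman (φ.act x) y + dorfman x (φ.act y))

/-- The shifted Courant-Nijenhuis torsion. -/
def shiftedTorsion (φ : EndoField n M) (x y : ∀ p : M, GT n p) : ∀ p : M, GT n p :=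
  torsion φ (φ.act x) y + torsion φ x (φ.act y)

/-- The bivariate Courant-Nijenhuis torsion. -/
def bivariateTorsion (φ₁ φ₂ : EndoField n M) (x y : ∀ p : M, GT n p) : ∀ p : M, GT n p :=
  torsion (φ₁ + φ₂) x y - torsion φ₁ x y - torsion φ₂ x y

/-- Generalized Nijenhuis operators. -/
def IsGenNijenhuis (φ : EndoField n M) : Prop :=
  ∀ x ∈ genSections n M, ∀ y ∈ genSections n M, torsion φ x y = 0

/-- Weak generalized Nijenhuis operators. -/
def IsWeakGenNijenhuis (φ : EndoField n M) : Prop :=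
  ∀ x ∈ genSections n M, ∀ y ∈ genSections n M, shiftedTorsion φ x y = 0

/-- Vanishing of the bivariate Courant-Nijenhuis torsion. -/
def BivariateTorsionVanishes (φ₁ φ₂ : EndoField n M) : Prop :=
  ∀ x ∈ genSections n M, ∀ y ∈ genSections n M, bivariateTorsion φ₁ φ₂ x y = 0

instance (p : M) : FiniteDimensional ℝ (TangentSpace (𝓡 n) p) :=
  inferInstanceAs (FiniteDimensional ℝ (Model n))

instance (p : M) : FiniteDimensional ℝ (TangentSpace (𝓡 n) p →L[ℝ] ℝ) :=
  inferInstanceAs (FiniteDimensional ℝ (Model n →L[ℝ] ℝ))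

/-- The nilpotent part of the fibrewise Jordan-Chevalley decomposition. -/
def nilpotentPart (φ : EndoField n M) : EndoField n M :=
  fun p => (Module.End.exists_isNilpotent_isSemisimple (f := φ p)).choose

/-- The semisimple part of the fibrewise Jordan-Chevalley decomposition. -/
def semisimplePart (φ : EndoField n M) : EndoField n M := 
  fun p => (Module.End.exists_isNilpotent_isSemisimple (f := φ p)).choose_spec.2.choose

theorem isSemisimple_semisimplePart (φ : EndoField n M) (p : M) :
    (semisimplePart φ p).IsSemisimple :=
  (Module.End.exists_isNilpotent_isSemisimple (f := φ p)).choose_spec.2.choose_spec.2.2.1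

theorem isNilpotent_nilpotentPart (φ : EndoField n M) (p : M) :
    IsNilpotent (nilpotentPart φ p) :=
  (Module.End.exists_isNilpotent_isSemisimple (f := φ p)).choose_spec.2.choose_spec.2.1

theorem eq_nilpotentPart_add_semisimplePart (φ : EndoField n M) :
    φ = nilpotentPart φ + semisimplePart φ :=
  funext fun p =>
    (Module.End.exists_isNilpotent_isSemisimple (f := φ p)).choose_spec.2.choose_spec.2.2.2

theorem commute_nilpotentPart_semisimplePart (φ : EndoField n M) (p : M) :
    Commute (nilpotentPart φ p) (semisimplePart φ p) :=
  Algebra.commute_of_mem_adjoin_singleton_of_commute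
    (Module.End.exists_isNilpotent_isSemisimple (f := φ p)).choose_spec.2.choose_spec.1
    (Algebra.commute_of_mem_adjoin_self
      (Module.End.exists_isNilpotent_isSemisimple (f := φ p)).choose_spec.1).symm

/-- At every point, `φ` has exactly three distinct (complex) eigenvalues. -/
def HasThreeEigenvalues (φ : EndoField n M) : Prop :=
  ∀ p : M, {μ : ℂ | Module.End.HasEigenvalue
    ((φ p).baseChange ℂ : Module.End ℂ (ℂ ⊗[ℝ] GT n p)) μ}.ncard = 3

/-- The complex section `x + i y` of the complexification of `TM ⊕ T*M`. -/
def cplx (x y : ∀ p : M, GT n p) (p : M) : ℂ ⊗[ℝ] GT n p :=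
  (1 : ℂ) ⊗ₜ[ℝ] x p + Complex.I ⊗ₜ[ℝ] y p

/-- The generalized eigenbundle of `φ` for the complex number `μ`. -/
def eigenbundle (φ : EndoField n M) (μ : ℂ) (p : M) : Submodule ℂ (ℂ ⊗[ℝ] GT n p) :=
  Module.End.maxGenEigenspace ((φ p).baseChange ℂ : Module.End ℂ (ℂ ⊗[ℝ] GT n p)) μ

/-- `[L, L'] ⊆ K`: the complex-bilinear extension of the Dorfman bracket maps smooth sections of
`L` and `L'` to sections of `K`. -/
def DorfmanMapsInto (L L' K : ∀ p : M, Submodule ℂ (ℂ ⊗[ℝ] GT n p)) : Prop :=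
  ∀ x₁ ∈ genSections n M, ∀ x₂ ∈ genSections n M, ∀ y₁ ∈ genSections n M, ∀ y₂ ∈ genSections n M,
    (∀ p, cplx x₁ x₂ p ∈ L p) → (∀ p, cplx y₁ y₂ p ∈ L' p) →
      ∀ p, cplx (dorfman x₁ y₁ - dorfman x₂ y₂) (dorfman x₁ y₂ + dorfman x₂ y₁) p ∈ K p

open Polynomial in
/-- Generalized F-structures: generalized polynomial structures with minimal polynomial
`x³ + x`. -/
def IsGenFStructure (φ : EndoField n M) : Prop := IsGPS φ (X ^ 3 + X)

/-- Strong integrability of a generalized F-structure with eigenbundles `L_i`, `L_{-i}`, `L_0`: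
`[L_{±i}, L_{±i}] ⊆ L_{±i}` and `[L_0, L_{±i}] ⊆ L_0 ⊕ L_{±i}`. -/
def IsStronglyIntegrable (φ : EndoField n M) : Prop :=
  ∀ σ : ℂ, σ = Complex.I ∨ σ = -Complex.I →
    DorfmanMapsInto (eigenbundle φ σ) (eigenbundle φ σ) (eigenbundle φ σ) ∧
    DorfmanMapsInto (eigenbundle φ 0) (eigenbundle φ σ)
      (fun p => eigenbundle φ 0 p ⊔ eigenbundle φ σ p)

open Polynomial in
/-- Weak generalized tangent structures: generalized Nijenhuis operators that are generalized
polynomial structures with minimal polynomial `x²`. -/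
def IsWeakGenTangent (φ : EndoField n M) : Prop := IsGPS φ (X ^ 2) ∧ IsGenNijenhuis φ

end manifold
end GenPoly
end

/-!
The derived bracket of the de Rham differential is the Dorfman bracket (`derivedBracket_deRham`):
in a chart `d = ∑ᵢ cl(dxⁱ) ∂ᵢ`, and the anticommutation relations of the Clifford action reduce the
claim to an identity in a single fibre. A skew endomorphism `φ` has a lift (`isLift_lift`), half of
the quadratic Clifford element `∑ₐ φ(uₐ) wₐ` for dual frames `u`, `w`, up to a function. As the
commutator with a lift is a derivation of derived brackets, and sections act faithfully on forms
(`cliff_injective`), minimality of `φ` with minimal polynomial `P` says that `P(A - C - E)` kills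
the Dorfman bracket, where `A`, `C`, `E` are the operators on bilinear operations given by composing
`φ` with the output and with the two arguments (`isMinimal_iff`).

If `P` is a quartic with three distinct complex roots, skew-symmetry makes `P` even, whence
`P = x⁴ - a x²` with `a ≠ 0` (`eq_quartic_of_threeEigenvalues`). Then `φ_s = φ³ / a` and
`φ_n = φ - φ³ / a`, so the six operators attached to `φ_s` and `φ_n` generate a commutative algebra
with relations `s³ = a s`, `n² = 0`, `s n = 0`. In it `(C + E)(A - C)(A - E)` for `φ_s` encodes the
shifted torsion, `(A - C)(A - E)` for `φ_n` the torsion, and the polarization of the latter the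
bivariate torsion. The ideal generated by these three elements is the one generated by
`P(A - C - E)`, as explicit polynomial identities show (`quartic_smul_eq_zero_iff`).

For `x²(x² + 1)`, where `a = -1`, it remains to see that strong integrability of a generalized
F-structure is the weak generalized Nijenhuis condition (`isStronglyIntegrable_iff`). Conditions on
complex eigensections translate into conditions on the real kernel and image of `J`, which are
again obtained from `(C + E)(A - C)(A - E)` by multiplication with projectors. The only condition
not visible in strong integrability, with the arguments exchanged, follows since the Dorfman bracket
of orthogonal sections is skew and the kernel and image of `J` are orthogonal. Uniqueness of the
Jordan-Chevalley decomposition gives the bijection.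
-/

set_option linter.unusedSectionVars false

noncomputable section
namespace GenPoly

universe u

/-! ### The Clifford action on a single exterior algebra -/

section fiberClifford
variable {V : Type*} [AddCommGroup V] [Module ℝ V] [TopologicalSpace V]

theorem interior_interior {k : ℕ} (X : V) (η : V [⋀^Fin (k + 2)]→L[ℝ] ℝ) :
    interior X (interior X η) = 0 := by
  ext v
  refine η.map_eq_zero_of_eq _ (i := 0) (j := 1) ?_ (by simp)
  simp

theorem interior_wedge_zero (X : V) (α : V →L[ℝ] ℝ) (η : V [⋀^Fin 0]→L[ℝ] ℝ) :
    interior X (wedge α η) = α X • η := by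
  ext v
  simp [wedge_apply]

theorem interior_wedge {k : ℕ} (X : V) (α : V →L[ℝ] ℝ) (η : V [⋀^Fin (k + 1)]→L[ℝ] ℝ) :
    interior X (wedge α η) + wedge α (interior X η) = α X • η := by
  ext v
  simp only [ContinuousAlternatingMap.add_apply, interior_apply, wedge_apply]
  rw [Fin.sum_univ_succ, add_assoc, ← Finset.sum_add_distrib, Finset.sum_eq_zero]
  · simp
  · intro i _
    have h : i.succ.removeNth (Matrix.vecCons X v : Fin (k + 2) → V) =
        Matrix.vecCons X (i.removeNth v) := by
      funext j
      cases j using Fin.cases <;> simp [Fin.removeNth]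
    rw [h]
    simp [pow_succ]

theorem wedge_wedge {k : ℕ} (α : V →L[ℝ] ℝ) (η : V [⋀^Fin k]→L[ℝ] ℝ) :
    wedge α (wedge α η) = 0 := by
  have h := AlternatingMap.alternatizeUncurryFin_alternatizeUncurryFinLM_comp_of_symmetric
    (R := ℝ) (M := V) (N := ℝ) (n := k)
    (f := α.toLinearMap.smulRight (α.toLinearMap.smulRight η.toAlternatingMap))
    (fun x y => by
      change α x • α y • η.toAlternatingMap = α y • α x • η.toAlternatingMap
      rw [smul_comm])
  have e : AlternatingMap.alternatizeUncurryFinLM ∘ₗ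
      α.toLinearMap.smulRight (α.toLinearMap.smulRight η.toAlternatingMap) =
      α.toLinearMap.smulRight (wedge α η).toAlternatingMap :=
    LinearMap.ext fun x => map_smul AlternatingMap.alternatizeUncurryFinLM (α x) _
  rw [e] at h
  ext v
  exact congrArg (fun f => f v) h

theorem wedge_add_left {k : ℕ} (α β : V →L[ℝ] ℝ) (η : V [⋀^Fin k]→L[ℝ] ℝ) :
    wedge (α + β) η = wedge α η + wedge β η := by
  ext v
  simp [wedge_apply, add_mul, Finset.sum_add_distrib]

theorem wedge_smul_left {k : ℕ} (c : ℝ) (α : V →L[ℝ] ℝ) (η : V [⋀^Fin k]→L[ℝ] ℝ) :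
    wedge (c • α) η = c • wedge α η := by
  ext v
  simp [wedge_apply, Finset.mul_sum, mul_left_comm, mul_assoc]

theorem interior_add_left {k : ℕ} (X Y : V) (η : V [⋀^Fin (k + 1)]→L[ℝ] ℝ) :
    interior (X + Y) η = interior X η + interior Y η :=
  ContinuousAlternatingMap.ext fun v =>
    congrArg (fun f : AlternatingMap ℝ V ℝ (Fin k) => f v)
      (map_add η.toAlternatingMap.curryLeft X Y)

theorem interior_smul_left {k : ℕ} (c : ℝ) (X : V) (η : V [⋀^Fin (k + 1)]→L[ℝ] ℝ) :
    interior (c • X) η = c • interior X η :=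
  ContinuousAlternatingMap.ext fun v =>
    congrArg (fun f : AlternatingMap ℝ V ℝ (Fin k) => f v)
      (map_smul η.toAlternatingMap.curryLeft c X)

theorem interior_add {k : ℕ} (X : V) (η θ : V [⋀^Fin (k + 1)]→L[ℝ] ℝ) :
    interior X (η + θ) = interior X η + interior X θ := rfl

theorem interior_smul {k : ℕ} (c : ℝ) (X : V) (η : V [⋀^Fin (k + 1)]→L[ℝ] ℝ) :
    interior X (c • η) = c • interior X η := rfl

variable (V) in
/-- Alternating forms of all degrees on a single vector space: the fibre of the bundle whose
sections are differential forms. -/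
def Ext : Type _ := ∀ k : ℕ, V [⋀^Fin k]→L[ℝ] ℝ

instance : AddCommGroup (Ext V) := inferInstanceAs (AddCommGroup (∀ k : ℕ, V [⋀^Fin k]→L[ℝ] ℝ))

instance : Module ℝ (Ext V) := inferInstanceAs (Module ℝ (∀ k : ℕ, V [⋀^Fin k]→L[ℝ] ℝ))

/-- The Clifford action of `X + α` on the exterior algebra of a fibre, `η ↦ ι_X η + α ∧ η`,
linear in `X + α`. -/
def cl : V × (V →L[ℝ] ℝ) →ₗ[ℝ] Module.End ℝ (Ext V) where
  toFun a :=
    { toFun := fun η k => match k with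
        | 0 => interior a.1 (η 1)
        | k + 1 => interior a.1 (η (k + 2)) + wedge a.2 (η k)
      map_add' := fun η θ => by
        funext k
        cases k with
        | zero => rfl
        | succ k =>
          change interior a.1 (η (k + 2) + θ (k + 2)) + wedge a.2 (η k + θ k) = _ + _ + (_ + _)
          rw [wedge_add, interior_add]
          abel
      map_smul' := fun c η => by
        funext k
        cases k with
        | zero => rfl
        | succ k =>
          change interior a.1 (c • η (k + 2)) + wedge a.2 (c • η k) = c • (_ + _)
          rw [wedge_smul, interior_smul, smul_add] }
  map_add' a b := by
    refine LinearMap.ext fun η => funext fun k => ?_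
    cases k with
    | zero => exact interior_add_left _ _ _
    | succ k =>
      change interior (a.1 + b.1) (η (k + 2)) + wedge (a.2 + b.2) (η k) = _ + _ + (_ + _)
      rw [wedge_add_left, interior_add_left]
      abel
  map_smul' c a := by
    refine LinearMap.ext fun η => funext fun k => ?_
    cases k with
    | zero => exact interior_smul_left _ _ _
    | succ k =>
      change interior (c • a.1) (η (k + 2)) + wedge (c • a.2) (η k) = c • (_ + _)
      rw [wedge_smul_left, interior_smul_left, smul_add]

theorem cl_apply_zero (a : V × (V →L[ℝ] ℝ)) (η : Ext V) : cl a η 0 = interior a.1 (η 1) := rfl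

theorem cl_apply_succ (a : V × (V →L[ℝ] ℝ)) (η : Ext V) (k : ℕ) :
    cl a η (k + 1) = interior a.1 (η (k + 2)) + wedge a.2 (η k) := rfl

theorem cl_mul_self (a : V × (V →L[ℝ] ℝ)) : cl a * cl a = a.2 a.1 • 1 := by
  refine LinearMap.ext fun η => funext fun k => ?_
  match k with
  | 0 =>
    change interior a.1 (interior a.1 (η 2) + wedge a.2 (η 0)) = a.2 a.1 • η 0
    rw [interior_add, interior_interior, interior_wedge_zero, zero_add]
  | 1 =>
    change interior a.1 (interior a.1 (η 3) + wedge a.2 (η 1)) + wedge a.2 (interior a.1 (η 1)) =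
      a.2 a.1 • η 1
    rw [interior_add, interior_interior, ← interior_wedge]
    exact congrArg (· + _) (zero_add _)
  | k + 2 =>
    change interior a.1 (interior a.1 (η (k + 4)) + wedge a.2 (η (k + 2))) +
      wedge a.2 (interior a.1 (η (k + 2)) + wedge a.2 (η k)) = a.2 a.1 • η (k + 2)
    rw [interior_add, interior_interior, zero_add, wedge_add, wedge_wedge, add_zero,
      interior_wedge]

/-- Twice the tautological inner product of `X + α` and `Y + β`. -/
def pair : V × (V →L[ℝ] ℝ) →ₗ[ℝ] V × (V →L[ℝ] ℝ) →ₗ[ℝ] ℝ :=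
  LinearMap.mk₂ ℝ (fun a b => a.2 b.1 + b.2 a.1)
    (fun a b c => by simp; ring) (fun a b c => by simp; ring) (fun a b c => by simp; ring)
    (fun a b c => by simp; ring)

theorem pair_apply (a b : V × (V →L[ℝ] ℝ)) : pair a b = a.2 b.1 + b.2 a.1 := rfl

theorem pair_comm (a b : V × (V →L[ℝ] ℝ)) : pair a b = pair b a := add_comm _ _

/-- The Clifford relation, by polarization of `cl_mul_self`. -/
theorem cl_anticomm (a b : V × (V →L[ℝ] ℝ)) : cl a * cl b + cl b * cl a = pair a b • 1 := by
  have h := cl_mul_self (a + b)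
  have ha := cl_mul_self a
  have hb := cl_mul_self b
  rw [map_add] at h
  have e : (a + b).2 (a + b).1 = a.2 a.1 + b.2 b.1 + pair a b := by
    simp [pair_apply]; ring
  rw [e, add_smul, add_smul, ← ha, ← hb] at h
  have h2 : (cl a + cl b) * (cl a + cl b) =
      cl a * cl a + cl b * cl b + (cl a * cl b + cl b * cl a) := by noncomm_ring
  rw [h2] at h
  exact add_left_cancel h

end fiberClifford

/-! ### The de Rham differential in coordinates -/

section flat
variable {E : Type*} [NormedAddCommGroup E] [NormedSpace ℝ E]

theorem fderiv_bilinear {A B C : Type*} [NormedAddCommGroup A] [NormedSpace ℝ A]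
    [NormedAddCommGroup B] [NormedSpace ℝ B] [NormedAddCommGroup C] [NormedSpace ℝ C]
    {b : A × B → C} (hb : IsBoundedBilinearMap ℝ b) {f : E → A} {g : E → B} {y : E}
    (hf : DifferentiableAt ℝ f y) (hg : DifferentiableAt ℝ g y) (v : E) :
    fderiv ℝ (fun z => b (f z, g z)) y v = b (fderiv ℝ f y v, g y) + b (f y, fderiv ℝ g y v) := by
  have h : HasFDerivAt (fun z => b (f z, g z)) _ y :=
    (hb.hasFDerivAt (f y, g y)).comp y (hf.hasFDerivAt.prodMk hg.hasFDerivAt)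
  rw [h.fderiv, add_comm]
  rfl

theorem isBoundedBilinearMap_interior {k : ℕ} :
    IsBoundedBilinearMap ℝ fun p : E × E [⋀^Fin (k + 1)]→L[ℝ] ℝ => interior p.1 p.2 where
  add_left _ _ _ := interior_add_left _ _ _
  smul_left _ _ _ := interior_smul_left _ _ _
  add_right _ _ _ := rfl
  smul_right _ _ _ := rfl
  bound := by
    refine ⟨1, one_pos, fun X η => ?_⟩
    have h := (ContinuousAlternatingMap.curryLeft η).le_opNorm X
    rw [ContinuousAlternatingMap.norm_curryLeft] at h
    rw [one_mul, mul_comm]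
    exact h

theorem wedge_eq_alternatizeUncurryFinCLM {k : ℕ} (α : E →L[ℝ] ℝ) (w : E [⋀^Fin k]→L[ℝ] ℝ) :
    wedge α w =
      ContinuousAlternatingMap.alternatizeUncurryFinCLM ℝ E ℝ (α.smulRight w) := by
  ext v
  rw [wedge_apply]
  simp only [ContinuousAlternatingMap.alternatizeUncurryFinCLM_apply,
    ContinuousAlternatingMap.alternatizeUncurryFin_apply]
  rfl

theorem isBoundedBilinearMap_wedge {k : ℕ} :
    IsBoundedBilinearMap ℝ fun p : (E →L[ℝ] ℝ) × E [⋀^Fin k]→L[ℝ] ℝ => wedge p.1 p.2 where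
  add_left _ _ _ := wedge_add_left _ _ _
  smul_left _ _ _ := wedge_smul_left _ _ _
  add_right _ _ _ := wedge_add _ _ _
  smul_right _ _ _ := wedge_smul _ _ _
  bound := by
    refine ⟨k + 1, by positivity, fun α η => ?_⟩
    rw [mul_assoc, ← ContinuousLinearMap.norm_smulRight_apply]
    change ‖wedge α η‖ ≤ _
    rw [wedge_eq_alternatizeUncurryFinCLM]
    exact ContinuousAlternatingMap.norm_alternatizeUncurryFin_le _

/-- In coordinates, `d = ∑ᵢ eⁱ ∧ ∂ᵢ`. -/
theorem extDeriv_eq_sum_wedge {n k : ℕ} (w : Model n → Model n [⋀^Fin k]→L[ℝ] ℝ) (y : Model n) :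
    extDeriv w y = ∑ i : Fin n, wedge (EuclideanSpace.proj i)
      (fderiv ℝ w y (EuclideanSpace.single i 1)) := by
  simp only [wedge_eq_alternatizeUncurryFinCLM, ← map_sum]
  change ContinuousAlternatingMap.alternatizeUncurryFinCLM ℝ _ ℝ (fderiv ℝ w y) = _
  congr 1
  ext1 v
  have hv : v = ∑ i : Fin n, v i • (EuclideanSpace.single i (1 : ℝ) : Model n) := by
    ext j
    simp [Finset.sum_apply, Pi.single_apply]
  conv_lhs => rw [hv, map_sum]
  simp

end flat

section fiber
variable {V : Type*} [AddCommGroup V] [Module ℝ V] [TopologicalSpace V]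

/-- The contribution of a single coordinate direction, with coordinate covector `θ`, to the derived
bracket of `d = ∑ᵢ cl(dxⁱ) ∂ᵢ`; here `s`, `t`, `D` are the partial derivatives of `x`, `y`, `ζ`. -/
theorem cl_bracket_identity (x y s t : V × (V →L[ℝ] ℝ)) (θ : V →L[ℝ] ℝ) (ζ D : Ext V) :
    θ x.1 • (cl t ζ + cl y D) + cl (0, θ) (cl s (cl y ζ)) -
        cl y (θ x.1 • D + cl (0, θ) (cl s ζ)) =
      cl (θ x.1 • t + pair s y • (0, θ) - θ y.1 • s) ζ := by
  have h1 : cl s (cl y ζ) = pair s y • ζ - cl y (cl s ζ) :=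
    eq_sub_of_add_eq (LinearMap.congr_fun (cl_anticomm s y) ζ)
  have h2 : cl y (cl (0, θ) (cl s ζ)) = θ y.1 • cl s ζ - cl (0, θ) (cl y (cl s ζ)) := by
    have := LinearMap.congr_fun (cl_anticomm ((0, θ) : V × (V →L[ℝ] ℝ)) y) (cl s ζ)
    rw [pair_apply, map_zero, add_zero, add_comm] at this
    exact eq_sub_of_add_eq this
  rw [map_sub cl, map_add cl, map_smul cl, map_smul cl, map_smul cl, LinearMap.sub_apply,
    LinearMap.add_apply, LinearMap.smul_apply, LinearMap.smul_apply, LinearMap.smul_apply, h1,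
    map_add (cl y), h2, map_sub, map_smul, map_smul, smul_add]
  abel

end fiber

section manifold
variable {n : ℕ} {M : Type*} [TopologicalSpace M] [ChartedSpace (Model n) M]
  [IsManifold (𝓡 n) ∞ M]

/-- The value at `p` of a differential form of mixed degree. -/
def fib (p : M) : Forms n M →ₗ[ℝ] Ext (TangentSpace (𝓡 n) p) where
  toFun η k := (η k).1 p
  map_add' _ _ := rfl
  map_smul' _ _ := rfl

theorem forms_ext {η θ : Forms n M} (h : ∀ p, fib p η = fib p θ) : η = θ :=
  funext fun k => Subtype.ext (funext fun p => congrFun (h p) k)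

theorem fib_cliff (x : genSections n M) (η : Forms n M) (p : M) :
    fib p (cliff x η) = cl (x.1 p) (fib p η) := by
  funext k
  cases k <;> rfl

/-- The coordinate covector `dxⁱ` at `p` of the preferred chart around `p`. -/
def dcoord (p : M) (i : Fin n) : TangentSpace (𝓡 n) p →L[ℝ] ℝ :=
  (EuclideanSpace.proj i : Model n →L[ℝ] ℝ).comp (coframe p p)

/-- The `i`-th partial derivative at `p` of a differential form, in the preferred chart
around `p`. -/
def pderivForm (p : M) (i : Fin n) (η : Forms n M) : Ext (TangentSpace (𝓡 n) p) := fun k =>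
  (fderiv ℝ ((η k).1.inChart p) (extChartAt (𝓡 n) p p)
    (EuclideanSpace.single i 1)).compContinuousLinearMap (coframe p p)

/-- The vector part of a section, in the preferred chart around `p`. -/
def vecInChart (x : ∀ p : M, GT n p) (p : M) (y : Model n) : Model n :=
  coframe p ((extChartAt (𝓡 n) p).symm y) (x ((extChartAt (𝓡 n) p).symm y)).1

/-- The covector part of a section, in the preferred chart around `p`. -/
def covInChart (x : ∀ p : M, GT n p) (p : M) (y : Model n) : Model n →L[ℝ] ℝ :=
  (x ((extChartAt (𝓡 n) p).symm y)).2.comp (frame p ((extChartAt (𝓡 n) p).symm y))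

/-- The derivative at `p` of a section along `v`, in the preferred chart around `p`. -/
def pderivSection (p : M) (v : Model n) (x : ∀ p : M, GT n p) : GT n p :=
  (frame p p (fderiv ℝ (vecInChart x p) (extChartAt (𝓡 n) p p) v),
    (fderiv ℝ (covInChart x p) (extChartAt (𝓡 n) p p) v).comp (coframe p p))

theorem differentiableAt_vecInChart {x : ∀ p : M, GT n p} (hx : x ∈ genSections n M) (p : M) :
    DifferentiableAt ℝ (vecInChart x p) (extChartAt (𝓡 n) p p) :=
  ((genSections_vector_inChart hx p).contDiffAt
    (extChartAt_target_mem_nhds p)).differentiableAt (by simp)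

theorem differentiableAt_covInChart {x : ∀ p : M, GT n p} (hx : x ∈ genSections n M) (p : M) :
    DifferentiableAt ℝ (covInChart x p) (extChartAt (𝓡 n) p p) :=
  ((hx.2 p).contDiffAt (extChartAt_target_mem_nhds p)).differentiableAt (by simp)

theorem differentiableAt_inChart {k : ℕ} {η : FormField n M k} (hη : η ∈ smoothForms n M k)
    (p : M) : DifferentiableAt ℝ (η.inChart p) (extChartAt (𝓡 n) p p) :=
  ((hη p).contDiffAt (extChartAt_target_mem_nhds p)).differentiableAt (by simp)

theorem frame_coframe_self (p : M) (v : TangentSpace (𝓡 n) p) :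
    frame p p (coframe p p v) = v := frame_coframe (mem_chart_source _ p) v

theorem coframe_frame_self (p : M) (v : Model n) : coframe p p (frame p p v) = v :=
  coframe_frame (mem_chart_source _ p) v

theorem comp_frame_comp_coframe {k : ℕ} (p : M) (η : TangentSpace (𝓡 n) p [⋀^Fin k]→L[ℝ] ℝ) :
    (η.compContinuousLinearMap (frame p p)).compContinuousLinearMap (coframe p p) = η := by
  ext v
  exact congrArg η (funext fun i => frame_coframe_self p (v i))

theorem extChartAt_symm_self (p : M) :
    (extChartAt (𝓡 n) p).symm (extChartAt (𝓡 n) p p) = p := extChartAt_to_inv p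

theorem inChart_self {k : ℕ} (η : FormField n M k) (p : M) :
    (η.inChart p (extChartAt (𝓡 n) p p)).compContinuousLinearMap (coframe p p) = η p := by
  have h : ∀ q, q = p → ((η q).compContinuousLinearMap (frame p q)).compContinuousLinearMap
      (coframe p q) = η q := by
    rintro q rfl
    exact comp_frame_comp_coframe _ _
  have h1 : ∀ q : M, q = p → ∀ f : Model n [⋀^Fin k]→L[ℝ] ℝ,
      f = (η q).compContinuousLinearMap (frame p q) →
      f.compContinuousLinearMap (coframe p p) = η p := by
    rintro q rfl f rfl
    exact comp_frame_comp_coframe _ _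
  exact h1 _ (extChartAt_symm_self p) _ rfl

theorem frame_vecInChart_self (x : ∀ p : M, GT n p) (p : M) :
    frame p p (vecInChart x p (extChartAt (𝓡 n) p p)) = (x p).1 := by
  have h : ∀ q : M, q = p → ∀ v : Model n, v = coframe p q (x q).1 → frame p p v = (x p).1 := by
    rintro q rfl v rfl
    exact frame_coframe_self _ _
  exact h _ (extChartAt_symm_self p) _ rfl

theorem vecInChart_self (x : ∀ p : M, GT n p) (p : M) :
    vecInChart x p (extChartAt (𝓡 n) p p) = coframe p p (x p).1 := by
  rw [← frame_vecInChart_self, coframe_frame_self]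

theorem covInChart_self_comp (x : ∀ p : M, GT n p) (p : M) :
    (covInChart x p (extChartAt (𝓡 n) p p)).comp (coframe p p) = (x p).2 := by
  have h : ∀ q : M, q = p → ∀ f : Model n →L[ℝ] ℝ, f = (x q).2.comp (frame p q) →
      f.comp (coframe p p) = (x p).2 := by
    rintro q rfl f rfl
    ext v
    exact congrArg (x q).2 (frame_coframe_self _ _)
  exact h _ (extChartAt_symm_self p) _ rfl

/-- At each point `d = ∑ᵢ cl(dxⁱ) ∂ᵢ`. -/
theorem fib_deRham (η : Forms n M) (p : M) :
    fib p (deRham n M η) = ∑ i : Fin n, cl (0, dcoord p i) (pderivForm p i η) := by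
  funext k
  have hs : ∀ (s : Fin n → Ext (TangentSpace (𝓡 n) p)) (k : ℕ), (∑ i, s i) k = ∑ i, s i k :=
    fun s k => Finset.sum_apply k _ s
  rw [hs]
  cases k with
  | zero =>
    refine Eq.symm (Finset.sum_eq_zero fun i _ => ?_)
    have := interior_smul_left (0 : ℝ) (0 : TangentSpace (𝓡 n) p) (pderivForm p i η 1)
    rwa [zero_smul, zero_smul] at this
  | succ k =>
    change (extDeriv ((η k).1.inChart p) (extChartAt (𝓡 n) p p)).compContinuousLinearMap
      (coframe p p) = _
    rw [extDeriv_eq_sum_wedge]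
    change (ContinuousAlternatingMap.compContinuousLinearMapₗ (coframe p p)) (∑ i, _) = _
    rw [map_sum]
    refine Finset.sum_congr rfl fun i _ => ?_
    change (wedge _ _).compContinuousLinearMap (coframe p p) = _
    rw [wedge_comp, cl_apply_succ]
    have := interior_smul_left (0 : ℝ) (0 : TangentSpace (𝓡 n) p) (pderivForm p i η (k + 2))
    rw [zero_smul, zero_smul] at this
    exact ((congrArg (· + _) this).trans (zero_add _)).symm

theorem inChart_contract {k : ℕ} (x : ∀ p : M, GT n p) (η : FormField n M (k + 1)) {p : M}
    {y : Model n} (hy : y ∈ (extChartAt (𝓡 n) p).target) :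
    (η.contract x).inChart p y = interior (vecInChart x p y) (η.inChart p y) := by
  have hp : (extChartAt (𝓡 n) p).symm y ∈ (chartAt (Model n) p).source := by
    rw [← extChartAt_source (𝓡 n) p]
    exact (extChartAt (𝓡 n) p).map_target hy
  unfold FormField.inChart FormField.contract vecInChart
  conv_lhs => rw [← frame_coframe hp (x _).1, interior_comp]

theorem inChart_extMul {k : ℕ} (x : ∀ p : M, GT n p) (η : FormField n M k) (p : M)
    (y : Model n) :
    (η.extMul x).inChart p y = wedge (covInChart x p y) (η.inChart p y) :=
  wedge_comp _ _ _

theorem add_compContinuousLinearMap {k : ℕ} {U W : Type*} [AddCommGroup U] [Module ℝ U]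
    [TopologicalSpace U] [AddCommGroup W] [Module ℝ W] [TopologicalSpace W]
    (η θ : W [⋀^Fin k]→L[ℝ] ℝ) (f : U →L[ℝ] W) :
    (η + θ).compContinuousLinearMap f =
      η.compContinuousLinearMap f + θ.compContinuousLinearMap f := rfl

theorem fderiv_inChart_contract {k : ℕ} {x : ∀ p : M, GT n p} (hx : x ∈ genSections n M)
    {η : FormField n M (k + 1)} (hη : η ∈ smoothForms n M (k + 1)) (p : M) (v : Model n) :
    (fderiv ℝ ((η.contract x).inChart p) (extChartAt (𝓡 n) p p) v).compContinuousLinearMap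
        (coframe p p) =
      interior (pderivSection p v x).1 (η p) + interior (x p).1
        ((fderiv ℝ (η.inChart p) (extChartAt (𝓡 n) p p) v).compContinuousLinearMap
          (coframe p p)) := by
  have h : (η.contract x).inChart p =ᶠ[nhds (extChartAt (𝓡 n) p p)]
      fun y => interior (vecInChart x p y) (η.inChart p y) := by
    filter_upwards [extChartAt_target_mem_nhds (I := 𝓡 n) p] with y hy
    exact inChart_contract x η hy
  rw [h.fderiv_eq, fderiv_bilinear isBoundedBilinearMap_interior (differentiableAt_vecInChart hx p)
    (differentiableAt_inChart hη p), vecInChart_self]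
  rw [← coframe_frame_self p (fderiv ℝ (vecInChart x p) _ v)]
  rw [add_compContinuousLinearMap, interior_comp, interior_comp, inChart_self]
  rfl

theorem fderiv_inChart_extMul {k : ℕ} {x : ∀ p : M, GT n p} (hx : x ∈ genSections n M)
    {η : FormField n M k} (hη : η ∈ smoothForms n M k) (p : M) (v : Model n) :
    (fderiv ℝ ((η.extMul x).inChart p) (extChartAt (𝓡 n) p p) v).compContinuousLinearMap
        (coframe p p) =
      wedge (pderivSection p v x).2 (η p) + wedge (x p).2
        ((fderiv ℝ (η.inChart p) (extChartAt (𝓡 n) p p) v).compContinuousLinearMap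
          (coframe p p)) := by
  have h : (η.extMul x).inChart p = fun y => wedge (covInChart x p y) (η.inChart p y) :=
    funext fun y => inChart_extMul x η p y
  rw [h, fderiv_bilinear isBoundedBilinearMap_wedge (differentiableAt_covInChart hx p)
    (differentiableAt_inChart hη p)]
  rw [add_compContinuousLinearMap, wedge_comp, wedge_comp, inChart_self, covInChart_self_comp]
  rfl

/-- The Leibniz rule for partial derivatives and the Clifford action. -/
theorem pderivForm_cliff (x : genSections n M) (η : Forms n M) (p : M) (i : Fin n) :
    pderivForm p i (cliff x η) =
      cl (pderivSection p (EuclideanSpace.single i 1) x.1) (fib p η) +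
        cl (x.1 p) (pderivForm p i η) := by
  funext k
  cases k with
  | zero => exact fderiv_inChart_contract x.2 (η 1).2 p _
  | succ k =>
    have h1 := fderiv_inChart_contract x.2 (η (k + 2)).2 p (EuclideanSpace.single i 1)
    have h2 := fderiv_inChart_extMul x.2 (η k).2 p (EuclideanSpace.single i 1)
    have d1 := differentiableAt_inChart (FormField.contract_mem x.2 (η (k + 2)).2) p
    have d2 := differentiableAt_inChart (FormField.extMul_mem x.2 (η k).2) p
    change (fderiv ℝ (((η (k + 2)).1.contract x.1).inChart p + ((η k).1.extMul x.1).inChart p) _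
      _).compContinuousLinearMap (coframe p p) = _
    rw [fderiv_add d1 d2]
    exact (congrArg₂ (· + ·) h1 h2).trans (add_add_add_comm _ _ _ _)

/-- The flat expression `∑ᵢ Xⁱ ∂ᵢy + ⟨⟨∂ᵢx, y⟩⟩ dxⁱ - Yⁱ ∂ᵢx` of the Dorfman bracket of
`x = X + α` and `y = Y + β` in the preferred chart around `p`. -/
def flatDorfman (x y : ∀ p : M, GT n p) (p : M) : GT n p :=
  ∑ i : Fin n, (dcoord p i (x p).1 • pderivSection p (EuclideanSpace.single i 1) y
    + pair (pderivSection p (EuclideanSpace.single i 1) x) (y p) • (0, dcoord p i)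
    - dcoord p i (y p).1 • pderivSection p (EuclideanSpace.single i 1) x)

theorem fib_cliff_deRham_anticomm (x : genSections n M) (η : Forms n M) (p : M) :
    fib p ((cliff x * deRham n M + deRham n M * cliff x) η) =
      ∑ i : Fin n, (dcoord p i (x.1 p).1 • pderivForm p i η +
        cl (0, dcoord p i)
          (cl (pderivSection p (EuclideanSpace.single i 1) x.1) (fib p η))) := by
  rw [LinearMap.add_apply, map_add, Module.End.mul_apply, Module.End.mul_apply, fib_cliff,
    fib_deRham, fib_deRham, map_sum, ← Finset.sum_add_distrib]
  refine Finset.sum_congr rfl fun i _ => ?_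
  rw [pderivForm_cliff, map_add]
  have h := LinearMap.congr_fun (cl_anticomm (x.1 p) (0, dcoord p i)) (pderivForm p i η)
  have e : pair (x.1 p) (0, dcoord p i) = dcoord p i (x.1 p).1 := by
    rw [pair_apply, map_zero, zero_add]
  rw [e] at h
  change cl (x.1 p) (cl (0, dcoord p i) (pderivForm p i η)) +
    cl (0, dcoord p i) (cl (x.1 p) (pderivForm p i η)) = _ at h
  rw [add_left_comm, h, add_comm]
  rfl

/-- The derived bracket of the de Rham differential acts fibrewise, by Clifford multiplication. -/
theorem fib_derivedBracket_deRham (x y : genSections n M) (η : Forms n M) (p : M) :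
    fib p (derivedBracket (deRham n M) (cliff x) (cliff y) η) =
      cl (flatDorfman x.1 y.1 p) (fib p η) := by
  unfold derivedBracket
  rw [LinearMap.sub_apply, map_sub, Module.End.mul_apply, Module.End.mul_apply,
    fib_cliff_deRham_anticomm, fib_cliff, fib_cliff, fib_cliff_deRham_anticomm, map_sum,
    ← Finset.sum_sub_distrib, flatDorfman, map_sum, LinearMap.sum_apply]
  refine Finset.sum_congr rfl fun i _ => ?_
  rw [pderivForm_cliff]
  exact cl_bracket_identity _ _ _ _ _ _ _

/-! ### The Dorfman bracket in a chart -/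

theorem mlieBracket_eq_flat {x y : ∀ p : M, GT n p} (p : M) :
    VectorField.mlieBracket (𝓡 n) (fun q => (x q).1) (fun q => (y q).1) p =
      frame p p (fderiv ℝ (vecInChart y p) (extChartAt (𝓡 n) p p) (coframe p p (x p).1)
        - fderiv ℝ (vecInChart x p) (extChartAt (𝓡 n) p p) (coframe p p (y p).1)) := by
  have key : ∀ z : ∀ p : M, GT n p, (VectorField.mpullbackWithin 𝓘(ℝ, Model n) (𝓡 n)
      (extChartAt (𝓡 n) p).symm (fun q => (z q).1) (Set.range (𝓡 n)) : Model n → Model n)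
      =ᶠ[nhds (extChartAt (𝓡 n) p p)] vecInChart z p := by
    intro z
    filter_upwards [extChartAt_target_mem_nhds (I := 𝓡 n) p] with w hw
    have hp : (extChartAt (𝓡 n) p).symm w ∈ (chartAt (Model n) p).source := by
      rw [← extChartAt_source (𝓡 n) p]
      exact (extChartAt (𝓡 n) p).map_target hw
    have h := TangentBundle.symmL_trivializationAt (𝕜 := ℝ) (I := 𝓡 n) hp
    rw [(extChartAt (𝓡 n) p).right_inv hw] at h
    rw [VectorField.mpullbackWithin_apply]
    change (mfderivWithin _ _ _ _ _).inverse _ = _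
    rw [← h]
    have h3 : (frame p ((extChartAt (𝓡 n) p).symm w)).inverse =
        coframe p ((extChartAt (𝓡 n) p).symm w) :=
      ContinuousLinearMap.inverse_eq (ContinuousLinearMap.ext fun v => frame_coframe hp v)
        (ContinuousLinearMap.ext fun v => coframe_frame hp v)
    exact congrArg (fun f => f (z ((extChartAt (𝓡 n) p).symm w)).1) h3
  have hs : (extChartAt (𝓡 n) p).symm ⁻¹' Set.univ ∩ Set.range (𝓡 n) = Set.univ := by simp
  have h1 : ∀ v : Model n,
      (mfderiv (𝓡 n) 𝓘(ℝ, Model n) (extChartAt (𝓡 n) p) p).inverse v = frame p p v := by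
    intro v
    rw [← TangentBundle.continuousLinearMapAt_trivializationAt (mem_chart_source _ p)]
    have h3 : (coframe p p).inverse = frame (n := n) p p :=
      ContinuousLinearMap.inverse_eq (ContinuousLinearMap.ext fun v => coframe_frame_self p v)
        (ContinuousLinearMap.ext fun v => frame_coframe_self p v)
    exact congrArg (fun f => f v) h3
  refine (h1 _).trans (congrArg (frame p p) ?_)
  rw [hs]
  refine (congrFun (VectorField.lieBracketWithin_univ (𝕜 := ℝ)) _).trans ?_
  refine ((key x).lieBracket_vectorField_eq (key y)).trans ?_
  rw [VectorField.lieBracket, vecInChart_self, vecInChart_self]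

theorem sum_dcoord_smul {W : Type*} [AddCommGroup W] [Module ℝ W] (p : M)
    (f : Model n →ₗ[ℝ] W) (v : TangentSpace (𝓡 n) p) :
    ∑ i : Fin n, dcoord p i v • f (EuclideanSpace.single i 1) = f (coframe p p v) := by
  have hv : coframe p p v =
      ∑ i : Fin n, dcoord p i v • (EuclideanSpace.single i (1 : ℝ) : Model n) := by
    ext j
    simp [dcoord, Pi.single_apply]
  rw [hv, map_sum]
  simp only [map_smul]

theorem cliff_oneForms_one (x : genSections n M) :
    (cliff x oneForms 1).1 = covector x.1 := by
  funext p
  ext v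
  change interior (x.1 p).1 (0 : _ [⋀^Fin 2]→L[ℝ] ℝ) v + wedge (x.1 p).2 _ v = _
  rw [wedge_apply]
  simp [covector, oneForms]

theorem deRham_oneForms : deRham n M oneForms = 0 := by
  funext k
  match k with
  | 0 => rfl
  | 1 =>
    refine Subtype.ext (funext fun p => ?_)
    have h : extDeriv ((oneForms (n := n) (M := M) 0).1.inChart p) (extChartAt (𝓡 n) p p) = 0 := by
      have e : (oneForms (n := n) (M := M) 0).1.inChart p =
        fun _ => ContinuousAlternatingMap.constOfIsEmpty ℝ _ (Fin 0) 1 := rfl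
      rw [e, extDeriv, fderiv_fun_const]
      exact map_zero (ContinuousAlternatingMap.alternatizeUncurryFinCLM ℝ (Model n) ℝ)
    change (extDeriv _ _).compContinuousLinearMap _ = _
    rw [h]
    rfl
  | k + 2 => exact map_zero (extDerₗ n M (k + 1))

/-- The covector part of the Dorfman bracket is the degree-one part of the derived bracket of `d`
applied to the constant function `1`. -/
theorem derivedBracket_deRham_oneForms (x y : genSections n M) :
    (derivedBracket (deRham n M) (cliff x) (cliff y) oneForms 1).1 =
      (covector y.1).extDer.contract x.1 + ((covector y.1).contract x.1).extDer
        - (covector x.1).extDer.contract y.1 := by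
  have h1 : derivedBracket (deRham n M) (cliff x) (cliff y) oneForms =
      cliff x (deRham n M (cliff y oneForms)) + deRham n M (cliff x (cliff y oneForms))
        - cliff y (deRham n M (cliff x oneForms)) := by
    simp only [derivedBracket, LinearMap.sub_apply, Module.End.mul_apply, LinearMap.add_apply,
      deRham_oneForms, map_zero, zero_add]
  have hz : ∀ z : genSections n M,
      FormField.extMul z.1 (0 : FormField n M 0) = 0 := by
    intro z
    funext p
    have := wedge_smul (z.1 p).2 0 (0 : TangentSpace (𝓡 n) p [⋀^Fin 0]→L[ℝ] ℝ)
    rwa [zero_smul, zero_smul] at this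
  rw [h1, ← cliff_oneForms_one x, ← cliff_oneForms_one y]
  change FormField.contract x.1 (cliff y oneForms 1).1.extDer + FormField.extMul x.1 0
    + FormField.extDer (FormField.contract x.1 (cliff y oneForms 1).1)
    - (FormField.contract y.1 (cliff x oneForms 1).1.extDer + FormField.extMul y.1 0) = _
  rw [hz, hz, add_zero, add_zero]

/-- The vector parts agree by the coordinate expression of the Lie bracket. The covector parts are
both the degree-one part of the derived bracket of `d` evaluated at the constant function `1`. -/
theorem dorfman_eq_flatDorfman (x y : genSections n M) (p : M) :
    dorfman x.1 y.1 p = flatDorfman x.1 y.1 p := by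
  refine Prod.ext ?_ ?_
  · change VectorField.mlieBracket (𝓡 n) (fun q => (x.1 q).1) (fun q => (y.1 q).1) p = _
    rw [mlieBracket_eq_flat, flatDorfman, Prod.fst_sum, map_sub]
    have h : ∀ (a b : ∀ p : M, GT n p), ∑ i : Fin n, dcoord p i (a p).1 •
        (pderivSection p (EuclideanSpace.single i 1) b).1 =
        frame p p (fderiv ℝ (vecInChart b p) (extChartAt (𝓡 n) p p) (coframe p p (a p).1)) :=
      fun a b => sum_dcoord_smul p
        ((frame p p).toLinearMap ∘ₗ (fderiv ℝ (vecInChart b p) (extChartAt (𝓡 n) p p)).toLinearMap)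
        (a p).1
    rw [← h, ← h, ← Finset.sum_sub_distrib]
    refine Finset.sum_congr rfl fun i _ => ?_
    simp
  · have h := congrFun (derivedBracket_deRham_oneForms x y) p
    have h2 := congrFun (fib_derivedBracket_deRham x y oneForms p) 1
    change (derivedBracket (deRham n M) (cliff x) (cliff y) oneForms 1).1 p = _ at h2
    rw [h] at h2
    change (ContinuousAlternatingMap.ofSubsingleton ℝ (TangentSpace (𝓡 n) p) ℝ (0 : Fin 1)).symm
      (((covector y.1).extDer.contract x.1 + ((covector y.1).contract x.1).extDer
        - (covector x.1).extDer.contract y.1) p) = _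
    rw [h2, Equiv.symm_apply_eq]
    ext v
    change interior _ (0 : _ [⋀^Fin 2]→L[ℝ] ℝ) v + wedge (flatDorfman x.1 y.1 p).2 _ v = _
    rw [wedge_apply]
    have h3 : ∀ u, fib p (oneForms (n := n) (M := M)) 0 u = 1 := fun _ => rfl
    simp [h3]

theorem covector_mem {x : ∀ p : M, GT n p} (hx : x ∈ genSections n M) :
    covector x ∈ smoothForms n M 1 := by
  rw [← cliff_oneForms_one ⟨x, hx⟩]
  exact (cliff ⟨x, hx⟩ oneForms 1).2

/-- The identification of `1`-forms with covector fields preserves smoothness. -/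
theorem covector_part_mem {w : FormField n M 1} (hw : w ∈ smoothForms n M 1) (p : M) :
    ContDiffOn ℝ ∞ (fun y => ((ContinuousAlternatingMap.ofSubsingleton ℝ
      (TangentSpace (𝓡 n) ((extChartAt (𝓡 n) p).symm y)) ℝ (0 : Fin 1)).symm
        (w ((extChartAt (𝓡 n) p).symm y))).comp
      (frame p ((extChartAt (𝓡 n) p).symm y))) (extChartAt (𝓡 n) p).target :=
  ((ContinuousAlternatingMap.ofSubsingletonLIE (𝕜 := ℝ) (E := Model n) (F := ℝ)
    (0 : Fin 1)).symm.toContinuousLinearEquiv.contDiff.comp_contDiffOn (hw p)).congr fun y _ => by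
      rfl

theorem dorfman_mem (x y : genSections n M) : dorfman x.1 y.1 ∈ genSections n M := by
  refine ⟨?_, fun p => covector_part_mem (w := (covector y.1).extDer.contract x.1 +
    ((covector y.1).contract x.1).extDer - (covector x.1).extDer.contract y.1) ?_ p⟩
  · intro p
    have : IsManifold (𝓡 n) (minSmoothness ℝ 2) M :=
      IsManifold.of_le (n := ∞) (by
        rw [minSmoothness_of_isRCLikeNormedField]
        exact WithTop.coe_le_coe.2 (le_top : (2 : ℕ∞) ≤ ⊤))
    have : IsManifold (𝓡 n) (((⊤ : ℕ∞) : WithTop ℕ∞) + 1) M := inferInstanceAs (IsManifold _ ∞ M)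
    exact ContMDiffAt.mlieBracket_vectorField (m := ⊤) (n := ⊤) (x.2.1 p) (y.2.1 p) (by
      rw [minSmoothness_of_isRCLikeNormedField]
      exact le_rfl)
  · exact sub_mem (add_mem (FormField.contract_mem x.2 (FormField.extDer_mem (covector_mem y.2)))
      (FormField.extDer_mem (FormField.contract_mem x.2 (covector_mem y.2))))
      (FormField.contract_mem y.2 (FormField.extDer_mem (covector_mem x.2)))

/-- The Dorfman bracket is the derived bracket with respect to the de Rham differential. -/
theorem derivedBracket_deRham (x y : genSections n M) :
    derivedBracket (deRham n M) (cliff x) (cliff y) = cliff ⟨dorfman x.1 y.1, dorfman_mem x y⟩ :=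
  LinearMap.ext fun η => forms_ext fun p => by
    rw [fib_derivedBracket_deRham, fib_cliff]
    exact congrArg (fun a => cl a (fib p η)) (dorfman_eq_flatDorfman x y p).symm

end manifold

/-! ### The lift of a skew endomorphism -/

section fiberSpin
variable {V : Type*} [AddCommGroup V] [Module ℝ V] [TopologicalSpace V]
  {ι κ : Type*} [Fintype ι] [Fintype κ]

/-- Families `u`, `w` in `V ⊕ V*` that are dual for twice the tautological inner product:
`x = ∑ₐ 2⟨wₐ, x⟩ uₐ` for all `x`. -/
def IsDualFrame (u w : ι → V × (V →L[ℝ] ℝ)) : Prop :=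
  ∀ x, ∑ a, pair (w a) x • u a = x

theorem IsDualFrame.eq_zero {u w : ι → V × (V →L[ℝ] ℝ)} (h : IsDualFrame u w)
    {x : V × (V →L[ℝ] ℝ)} (hx : ∀ a, pair (w a) x = 0) : x = 0 := by
  rw [← h x]
  exact Finset.sum_eq_zero fun a _ => by rw [hx, zero_smul]

theorem IsDualFrame.symm {u w : ι → V × (V →L[ℝ] ℝ)} (h : IsDualFrame u w) :
    IsDualFrame w u := by
  intro x
  refine sub_eq_zero.1 (h.eq_zero fun a => ?_)
  have h1 := congrArg (pair x) (h (w a))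
  rw [map_sum] at h1
  rw [map_sub, map_sum, pair_comm (w a) x, ← h1, sub_eq_zero]
  refine Finset.sum_congr rfl fun b _ => ?_
  rw [map_smul, map_smul, smul_eq_mul, smul_eq_mul, pair_comm (u b) x, pair_comm (w a) (w b),
    mul_comm]

/-- The quadratic Clifford element `∑ₐ φ(uₐ) wₐ`. -/
def cliffordQuadratic (φ : Module.End ℝ (V × (V →L[ℝ] ℝ))) (u w : ι → V × (V →L[ℝ] ℝ)) :
    Module.End ℝ (Ext V) := ∑ a, cl (φ (u a)) * cl (w a)

/-- Independence of the pair of dual frames: near every point the lift can be computed in a smooth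
local frame, and the local expressions agree. -/
theorem cliffordQuadratic_eq (φ : Module.End ℝ (V × (V →L[ℝ] ℝ)))
    {u w : ι → V × (V →L[ℝ] ℝ)} (h : IsDualFrame u w) {u' w' : κ → V × (V →L[ℝ] ℝ)}
    (h' : IsDualFrame u' w') : cliffordQuadratic φ u w = cliffordQuadratic φ u' w' := by
  have h1 : ∀ a, cl (φ (u a)) * cl (w a) =
      ∑ b, cl (φ (pair (w a) (u' b) • u a)) * cl (w' b) := by
    intro a
    conv_lhs => rw [← h'.symm (w a), map_sum, Finset.mul_sum]
    refine Finset.sum_congr rfl fun b _ => ?_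
    rw [map_smul, map_smul, map_smul, pair_comm, mul_smul_comm, smul_mul_assoc]
  unfold cliffordQuadratic
  rw [Finset.sum_congr rfl fun a _ => h1 a, Finset.sum_comm]
  refine Finset.sum_congr rfl fun b _ => ?_
  rw [← Finset.sum_mul, ← map_sum, ← map_sum, h (u' b)]

/-- For skew `φ` the commutator of the quadratic element `∑ₐ φ(uₐ) wₐ` with `x` is `2 φ(x)`. -/
theorem cliffordQuadratic_commutator {φ : Module.End ℝ (V × (V →L[ℝ] ℝ))}
    (hφ : ∀ x y, pair (φ x) y + pair x (φ y) = 0) {u w : ι → V × (V →L[ℝ] ℝ)}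
    (h : IsDualFrame u w) (x : V × (V →L[ℝ] ℝ)) :
    cliffordQuadratic φ u w * cl x - cl x * cliffordQuadratic φ u w = (2 : ℝ) • cl (φ x) := by
  have h1 : ∀ a, cl (φ (u a)) * cl (w a) * cl x - cl x * (cl (φ (u a)) * cl (w a)) =
      cl (φ (pair (w a) x • u a)) + cl (pair (u a) (φ x) • w a) := by
    intro a
    have e1 : cl (w a) * cl x = pair (w a) x • 1 - cl x * cl (w a) :=
      eq_sub_of_add_eq (cl_anticomm _ _)
    have e2 : cl x * cl (φ (u a)) = pair x (φ (u a)) • 1 - cl (φ (u a)) * cl x :=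
      eq_sub_of_add_eq (cl_anticomm _ _)
    have e3 : pair (u a) (φ x) = - pair x (φ (u a)) := by
      rw [pair_comm x]
      linarith [hφ (u a) x]
    rw [mul_assoc, e1, ← mul_assoc (cl x), e2, e3, map_smul, map_smul, map_smul, mul_sub, sub_mul,
      mul_smul_comm, smul_mul_assoc, mul_one, one_mul, neg_smul]
    noncomm_ring
  unfold cliffordQuadratic
  rw [Finset.sum_mul, Finset.mul_sum, ← Finset.sum_sub_distrib,
    Finset.sum_congr rfl fun a _ => h1 a, Finset.sum_add_distrib, ← map_sum, ← map_sum, ← map_sum,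
    h x, h.symm (φ x), two_smul]

variable (V) in
/-- The constant `1`, as a form on a fibre. -/
def one : Ext V := fun k => match k with
  | 0 => ContinuousAlternatingMap.constOfIsEmpty ℝ _ (Fin 0) 1
  | _ + 1 => 0

/-- The lift of a skew endomorphism of `V ⊕ V*` to the exterior algebra: half of the quadratic
Clifford element, corrected by the scalar that makes the degree-zero part of its value at `1`
vanish. -/
def spin (φ : Module.End ℝ (V × (V →L[ℝ] ℝ))) (u w : ι → V × (V →L[ℝ] ℝ)) :
    Module.End ℝ (Ext V) :=
  (1 / 2 : ℝ) • (cliffordQuadratic φ u w - (cliffordQuadratic φ u w (one V) 0 ![]) • 1)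

theorem spin_eq (φ : Module.End ℝ (V × (V →L[ℝ] ℝ)))
    {u w : ι → V × (V →L[ℝ] ℝ)} (h : IsDualFrame u w) {u' w' : κ → V × (V →L[ℝ] ℝ)}
    (h' : IsDualFrame u' w') : spin φ u w = spin φ u' w' := by
  unfold spin
  rw [cliffordQuadratic_eq φ h h']

theorem spin_commutator {φ : Module.End ℝ (V × (V →L[ℝ] ℝ))}
    (hφ : ∀ x y, pair (φ x) y + pair x (φ y) = 0) {u w : ι → V × (V →L[ℝ] ℝ)}
    (h : IsDualFrame u w) (x : V × (V →L[ℝ] ℝ)) :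
    spin φ u w * cl x - cl x * spin φ u w = cl (φ x) := by
  unfold spin
  rw [smul_mul_assoc, mul_smul_comm, ← smul_sub, sub_mul, mul_sub, smul_mul_assoc, mul_smul_comm,
    one_mul, mul_one, sub_sub_sub_cancel_right, cliffordQuadratic_commutator hφ h, smul_smul]
  norm_num

theorem cl_apply_eq_zero (a : V × (V →L[ℝ] ℝ)) {ζ : Ext V} {k : ℕ}
    (h : ∀ j, j + 1 = k ∨ j = k + 1 → ζ j = 0) : cl a ζ k = 0 := by
  cases k with
  | zero =>
    rw [cl_apply_zero, h 1 (Or.inr rfl)]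
    rfl
  | succ k =>
    rw [cl_apply_succ, h (k + 2) (Or.inr rfl), h k (Or.inl rfl)]
    have : wedge a.2 (0 : V [⋀^Fin k]→L[ℝ] ℝ) = 0 := by
      have := wedge_smul a.2 0 (0 : V [⋀^Fin k]→L[ℝ] ℝ)
      rwa [zero_smul, zero_smul] at this
    rw [this]
    exact add_zero (interior a.1 (0 : V [⋀^Fin (k + 2)]→L[ℝ] ℝ))

theorem Ext.sum_apply (s : ι → Ext V) (k : ℕ) : (∑ a, s a) k = ∑ a, s a k :=
  Finset.sum_apply k _ s

theorem cliffordQuadratic_apply_eq_zero (φ : Module.End ℝ (V × (V →L[ℝ] ℝ)))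
    (u w : ι → V × (V →L[ℝ] ℝ)) {ζ : Ext V} {k : ℕ}
    (h : ∀ j, j = k ∨ j + 2 = k ∨ j = k + 2 → ζ j = 0) : cliffordQuadratic φ u w ζ k = 0 := by
  unfold cliffordQuadratic
  rw [LinearMap.sum_apply, Ext.sum_apply]
  refine Finset.sum_eq_zero fun a _ => cl_apply_eq_zero _ fun j hj => cl_apply_eq_zero _
    fun i hi => h i ?_
  omega

theorem spin_apply_eq_zero (φ : Module.End ℝ (V × (V →L[ℝ] ℝ)))
    (u w : ι → V × (V →L[ℝ] ℝ)) {ζ : Ext V} {k : ℕ}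
    (h : ∀ j, j = k ∨ j + 2 = k ∨ j = k + 2 → ζ j = 0) : spin φ u w ζ k = 0 := by
  change (1 / 2 : ℝ) • (cliffordQuadratic φ u w ζ k -
    (cliffordQuadratic φ u w (one V) 0 ![]) • ζ k) = 0
  rw [cliffordQuadratic_apply_eq_zero φ u w h, h k (Or.inl rfl), smul_zero, sub_zero, smul_zero]

theorem spin_one (φ : Module.End ℝ (V × (V →L[ℝ] ℝ))) (u w : ι → V × (V →L[ℝ] ℝ)) {k : ℕ}
    (hk : k ≠ 2) : spin φ u w (one V) k = 0 := by
  cases k with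
  | zero =>
    change (1 / 2 : ℝ) • (cliffordQuadratic φ u w (one V) 0 -
      (cliffordQuadratic φ u w (one V) 0 ![]) • one V 0) = 0
    ext v
    rw [Subsingleton.elim v ![]]
    change (1 / 2 : ℝ) * (cliffordQuadratic φ u w (one V) 0 ![] -
      (cliffordQuadratic φ u w (one V) 0 ![]) * 1) = 0
    ring
  | succ k =>
    refine spin_apply_eq_zero φ u w fun j hj => ?_
    match j with
    | 0 => omega
    | j + 1 => rfl

end fiberSpin

section manifold
variable {n : ℕ} {M : Type*} [TopologicalSpace M] [ChartedSpace (Model n) M]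
  [IsManifold (𝓡 n) ∞ M]

/-- Smoothness of a field of forms is a local property. -/
theorem smoothForms_of_eventuallyEq {k : ℕ} {η : FormField n M k}
    (h : ∀ c, ∃ θ ∈ smoothForms n M k, ∀ᶠ q in nhds c, η q = θ q) : η ∈ smoothForms n M k := by
  intro p y hy
  obtain ⟨θ, hθ, he⟩ := h ((extChartAt (𝓡 n) p).symm y)
  refine ContDiffAt.contDiffWithinAt ?_
  refine ((hθ p).contDiffAt ((isOpen_extChartAt_target p).mem_nhds hy)).congr_of_eventuallyEq ?_
  filter_upwards [(continuousAt_extChartAt_symm'' hy).eventually he] with z hz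
  unfold FormField.inChart
  rw [hz]

theorem smul_zeroForm_mem {k : ℕ} {g : FormField n M 0} (hg : g ∈ smoothForms n M 0)
    {η : FormField n M k} (hη : η ∈ smoothForms n M k) :
    (fun p => g p ![] • η p : FormField n M k) ∈ smoothForms n M k := by
  intro p
  have h1 := (ContinuousAlternatingMap.constOfIsEmptyLIE ℝ (Model n) ℝ
    (Fin 0)).symm.toContinuousLinearEquiv.contDiff.comp_contDiffOn (hg p)
  refine (h1.smul (hη p)).congr fun y _ => ?_
  exact congrArg (fun a : ℝ => a • η.inChart p y) (congrArg (g _) (Subsingleton.elim _ _))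

variable [T2Space M]

/-- The `i`-th coordinate vector field of the chart around `c`, cut off by a bump function. -/
def vectorFrame {c : M} (ρ : SmoothBumpFunction (𝓡 n) c) (i : Fin n) : ∀ p : M, GT n p :=
  fun q => (ρ q • frame c q (EuclideanSpace.single i 1), 0)

/-- The `i`-th coordinate covector field of the chart around `c`, cut off by a bump function. -/
def covectorFrame {c : M} (ρ : SmoothBumpFunction (𝓡 n) c) (i : Fin n) : ∀ p : M, GT n p :=
  fun q => (0, ρ q • (EuclideanSpace.proj i : Model n →L[ℝ] ℝ).comp (coframe c q))

theorem vectorFrame_mem {c : M} (ρ : SmoothBumpFunction (𝓡 n) c) (i : Fin n) :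
    vectorFrame ρ i ∈ genSections n M := by
  refine ⟨?_, fun p => contDiffOn_const (c := 0)⟩
  have h1 : ContMDiffOn (𝓡 n) ((𝓡 n).prod 𝓘(ℝ, Model n)) ∞ (fun q =>
      (⟨q, frame c q (EuclideanSpace.single i 1)⟩ : TangentBundle (𝓡 n) M))
      (chartAt (Model n) c).source := by
    refine (Bundle.Trivialization.contMDiffOn_section_baseSet_iff (n := ∞) (IB := 𝓡 n)
      (trivializationAt (Model n) (TangentSpace (𝓡 n)) c)).2 ?_
    refine (contMDiffOn_const (c := EuclideanSpace.single i 1)).congr fun q hq => ?_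
    have := coframe_frame (p := c) (q := q) (by simpa using hq) (EuclideanSpace.single i 1)
    unfold coframe at this
    rwa [Bundle.Trivialization.continuousLinearMapAt_apply,
      Bundle.Trivialization.coe_linearMapAt_of_mem _ hq] at this
  exact ContMDiffOn.smul_section_of_tsupport (ψ := ρ) ρ.contMDiff.contMDiffOn
    (chartAt (Model n) c).open_source ρ.tsupport_subset_chartAt_source h1

theorem covectorFrame_mem {c : M} (ρ : SmoothBumpFunction (𝓡 n) c) (i : Fin n) :
    covectorFrame ρ i ∈ genSections n M := by
  refine ⟨Bundle.contMDiff_zeroSection ℝ _, fun p y hy => ContDiffAt.contDiffWithinAt ?_⟩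
  have hcont := continuousAt_extChartAt_symm'' (I := 𝓡 n) hy
  by_cases hq : (extChartAt (𝓡 n) p).symm y ∈ (chartAt (Model n) c).source
  · have hp : (extChartAt (𝓡 n) p).symm y ∈ (chartAt (Model n) p).source := by
      simpa using (extChartAt (𝓡 n) p).map_target hy
    have ht : ContDiffAt ℝ ∞ (trans p c) y := by
      have := contDiffAt_trans hp hq
      rwa [(extChartAt (𝓡 n) p).right_inv hy] at this
    have hρ : ContDiffAt ℝ ∞ (ρ ∘ (extChartAt (𝓡 n) p).symm) y :=
      (contDiffOn_comp_chart ρ.contMDiff p).contDiffAt ((isOpen_extChartAt_target p).mem_nhds hy)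
    have h2 : ContDiffAt ℝ ∞ (fun z => (ρ ∘ (extChartAt (𝓡 n) p).symm) z •
        (EuclideanSpace.proj i : Model n →L[ℝ] ℝ).comp (fderiv ℝ (trans p c) z)) y :=
      hρ.smul (contDiffAt_const.clm_comp (ht.fderiv_right (m := ∞) (by simp)))
    refine h2.congr_of_eventuallyEq ?_
    filter_upwards [(isOpen_extChartAt_target p).mem_nhds hy,
      hcont.preimage_mem_nhds ((chartAt (Model n) c).open_source.mem_nhds hq)] with z hz hzc
    have hzp : (extChartAt (𝓡 n) p).symm z ∈ (chartAt (Model n) p).source := by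
      simpa using (extChartAt (𝓡 n) p).map_target hz
    have := coframe_comp_frame hzp hzc
    rw [(extChartAt (𝓡 n) p).right_inv hz] at this
    rw [← this]
    rfl
  · have hq' : (extChartAt (𝓡 n) p).symm y ∉ tsupport ρ := fun h =>
      hq (ρ.tsupport_subset_chartAt_source h)
    refine (contDiffAt_const (c := 0)).congr_of_eventuallyEq ?_
    filter_upwards [hcont.eventually (notMem_tsupport_iff_eventuallyEq.1 hq')] with z hz
    change ((ρ _ • (EuclideanSpace.proj i : Model n →L[ℝ] ℝ).comp _).comp _) = _
    rw [hz]
    ext v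
    exact zero_mul _

/-- The frame of `TM ⊕ T*M` made of cut off coordinate vector and covector fields. -/
def bumpFrame {c : M} (ρ : SmoothBumpFunction (𝓡 n) c) : Fin n ⊕ Fin n → genSections n M :=
  Sum.elim (fun i => ⟨vectorFrame ρ i, vectorFrame_mem ρ i⟩)
    (fun i => ⟨covectorFrame ρ i, covectorFrame_mem ρ i⟩)

theorem isDualFrame_coord {c q : M} (hq : q ∈ (chartAt (Model n) c).source) :
    IsDualFrame (ι := Fin n ⊕ Fin n)
      (Sum.elim (fun i => (frame c q (EuclideanSpace.single i 1), 0))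
        (fun i => (0, (EuclideanSpace.proj i : Model n →L[ℝ] ℝ).comp (coframe c q))))
      (Sum.elim (fun i => (0, (EuclideanSpace.proj i : Model n →L[ℝ] ℝ).comp (coframe c q)))
        (fun i => (frame c q (EuclideanSpace.single i 1), 0))) := by
  have hv : ∀ v : Model n,
      ∑ i : Fin n, v i • (EuclideanSpace.single i (1 : ℝ) : Model n) = v := by
    intro v
    ext j
    simp [Pi.single_apply]
  intro x
  rw [Fintype.sum_sum_type]
  refine Prod.ext ?_ ?_
  · simp only [Prod.fst_add, Prod.fst_sum]
    have h := congrArg (frame c q) (hv (coframe c q x.1))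
    rw [frame_coframe hq, map_sum] at h
    conv_rhs => rw [← h]
    simp [pair_apply]
  · simp only [Prod.snd_add, Prod.snd_sum]
    ext v
    have h := congrArg (fun w => x.2 (frame c q w)) (hv (coframe c q v))
    simp only [frame_coframe hq, map_sum, map_smul] at h
    rw [← h]
    simp [pair_apply, mul_comm]

theorem isDualFrame_bumpFrame {c q : M} {ρ : SmoothBumpFunction (𝓡 n) c} (hρ : ρ q = 1) :
    IsDualFrame (fun a => (bumpFrame ρ a).1 q) (fun a => (bumpFrame ρ a.swap).1 q) := by
  have hq : q ∈ (chartAt (Model n) c).source :=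
    ρ.support_subset_source (by rw [Function.mem_support, hρ]; exact one_ne_zero)
  convert isDualFrame_coord hq using 1
  · funext a
    rcases a with i | i <;> simp [bumpFrame, vectorFrame, covectorFrame, hρ]
  · funext a
    rcases a with i | i <;> simp [bumpFrame, vectorFrame, covectorFrame, hρ]

/-- Near every point there are global smooth sections forming a pair of dual frames. -/
theorem exists_frame (c : M) : ∃ u w : Fin n ⊕ Fin n → genSections n M,
    ∀ᶠ q in nhds c, IsDualFrame (fun a => (u a).1 q) (fun a => (w a).1 q) := by
  obtain ⟨ρ⟩ : Nonempty (SmoothBumpFunction (𝓡 n) c) := inferInstance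
  refine ⟨bumpFrame ρ, fun a => bumpFrame ρ a.swap, ?_⟩
  filter_upwards [ρ.eventuallyEq_one] with q hq
  exact isDualFrame_bumpFrame hq

theorem fib_oneForms (p : M) : fib p (oneForms (n := n) (M := M)) = one _ := by
  funext k
  cases k <;> rfl

theorem oneForms_ne (p : M) : fib p (oneForms (n := n) (M := M)) ≠ 0 := fun h => by
  have := congrArg (fun ζ : Ext (TangentSpace (𝓡 n) p) => ζ 0 ![]) h
  exact one_ne_zero (α := ℝ) this

theorem cliff_anticomm (x y : genSections n M) (η : Forms n M) (p : M) :
    fib p ((cliff x * cliff y + cliff y * cliff x) η) = pair (x.1 p) (y.1 p) • fib p η := by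
  rw [LinearMap.add_apply, map_add, Module.End.mul_apply, Module.End.mul_apply, fib_cliff,
    fib_cliff, fib_cliff, fib_cliff]
  exact LinearMap.congr_fun (cl_anticomm (x.1 p) (y.1 p)) (fib p η)

/-- A section is determined by its action on forms: its inner products with a frame are recovered
from anticommutators acting on the constant function `1`. -/
theorem cliff_injective : Function.Injective (cliff (n := n) (M := M)) := by
  intro x y h
  refine Subtype.ext (funext fun p => ?_)
  obtain ⟨u, w, hf⟩ := exists_frame (n := n) p
  have h1 : ∀ z : genSections n M, pair (z.1 p) (x.1 p) = pair (z.1 p) (y.1 p) := by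
    intro z
    have hx := cliff_anticomm z x oneForms p
    rw [h, cliff_anticomm] at hx
    exact (smul_left_injective ℝ (oneForms_ne p) hx).symm
  refine sub_eq_zero.1 (hf.self_of_nhds.eq_zero fun a => ?_)
  rw [map_sub, h1, sub_self]

/-- The lift of `φ` at the point `p`, computed in the coordinate frame of the chart around `p`. -/
def spinAt (φ : EndoField n M) (p : M) : Module.End ℝ (Ext (TangentSpace (𝓡 n) p)) :=
  spin (ι := Fin n ⊕ Fin n) (φ p)
    (Sum.elim (fun i => (frame p p (EuclideanSpace.single i 1), 0)) (fun i => (0, dcoord p i)))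
    (Sum.elim (fun i => (0, dcoord p i)) (fun i => (frame p p (EuclideanSpace.single i 1), 0)))

theorem spinAt_eq {ι : Type*} [Fintype ι] (φ : EndoField n M) {p : M} {u w : ι → GT n p}
    (h : IsDualFrame u w) : spinAt φ p = spin (φ p) u w :=
  spin_eq (φ p) (isDualFrame_coord (mem_chart_source _ p)) h

theorem spinAt_mem {φ : EndoField n M} (hφ : IsSkewEndo φ) (η : Forms n M) (k : ℕ) :
    (fun p => spinAt φ p (fib p η) k : FormField n M k) ∈ smoothForms n M k := by
  refine smoothForms_of_eventuallyEq fun c => ?_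
  obtain ⟨u, w, hf⟩ := exists_frame (n := n) c
  let Q : FormOp n M := ∑ a, cliff ⟨φ.act (u a).1, hφ.smooth _ (u a).2⟩ * cliff (w a)
  have hQ : ∀ (θ : Forms n M) (q : M), fib q (Q θ) =
      cliffordQuadratic (φ q) (fun a => (u a).1 q) (fun a => (w a).1 q) (fib q θ) := by
    intro θ q
    rw [LinearMap.sum_apply, map_sum, cliffordQuadratic, LinearMap.sum_apply]
    refine Finset.sum_congr rfl fun a _ => ?_
    rw [Module.End.mul_apply, fib_cliff, fib_cliff]
    rfl
  refine ⟨(1 / 2 : ℝ) • ((Q η k).1 - fun p => (Q oneForms 0).1 p ![] • (η k).1 p),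
    Submodule.smul_mem _ _ (sub_mem (Q η k).2 (smul_zeroForm_mem (Q oneForms 0).2 (η k).2)), ?_⟩
  filter_upwards [hf] with q hq
  rw [spinAt_eq φ hq]
  have h2 := hQ oneForms q
  rw [fib_oneForms] at h2
  change (1 / 2 : ℝ) • (cliffordQuadratic (φ q) _ _ (fib q η) k -
      (cliffordQuadratic (φ q) (fun a => (u a).1 q) (fun a => (w a).1 q)
        (one (TangentSpace (𝓡 n) q)) 0 ![] : ℝ) • fib q η k) =
    (1 / 2 : ℝ) • (fib q (Q η) k - ((fib q (Q oneForms)) 0 ![] : ℝ) • fib q η k)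
  rw [hQ η q, h2]

/-- The lift of a smooth skew endomorphism, as an operator on differential forms. -/
def lift {φ : EndoField n M} (hφ : IsSkewEndo φ) : FormOp n M where
  toFun η k := ⟨fun p => spinAt φ p (fib p η) k, spinAt_mem hφ η k⟩
  map_add' η θ := funext fun k => Subtype.ext (funext fun p =>
    congrFun ((congrArg (spinAt φ p) (map_add (fib p) η θ)).trans (map_add _ _ _)) k)
  map_smul' c η := funext fun k => Subtype.ext (funext fun p =>
    congrFun ((congrArg (spinAt φ p) (map_smul (fib p) c η)).trans (map_smul _ _ _)) k)

theorem fib_lift {φ : EndoField n M} (hφ : IsSkewEndo φ) (η : Forms n M) (p : M) :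
    fib p (lift hφ η) = spinAt φ p (fib p η) := rfl

theorem lift_apply_eq_zero {φ : EndoField n M} (hφ : IsSkewEndo φ) {η : Forms n M} {k : ℕ}
    (h : ∀ j, j = k ∨ j + 2 = k ∨ j = k + 2 → η j = 0) : lift hφ η k = 0 :=
  Subtype.ext (funext fun p => spin_apply_eq_zero (φ p) _ _ fun j hj =>
    congrArg (fun w : smoothForms n M j => w.1 p) (h j hj))

theorem pair_skew {φ : EndoField n M} (hφ : IsSkewEndo φ) (p : M) (a b : GT n p) :
    pair (φ p a) b + pair a (φ p b) = 0 := by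
  have h := hφ.skew p a b
  unfold pairing at h
  rw [pair_apply, pair_apply]
  linarith

theorem isLift_lift {φ : EndoField n M} (hφ : IsSkewEndo φ) : IsLift φ (lift hφ) where
  even_even η h k hk := lift_apply_eq_zero hφ fun j hj => h j (by
    rw [Nat.odd_iff] at hk ⊢
    omega)
  even_odd η h k hk := lift_apply_eq_zero hφ fun j hj => h j (by
    rw [Nat.even_iff] at hk ⊢
    omega)
  comm_fun f := by
    refine sub_eq_zero.2 (LinearMap.ext fun η => forms_ext fun p => ?_)
    exact map_smul (spinAt φ p) (f p) (fib p η)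
  comm_section x y hy := by
    refine LinearMap.ext fun η => forms_ext fun p => ?_
    rw [LinearMap.sub_apply, map_sub, Module.End.mul_apply, Module.End.mul_apply, fib_lift,
      fib_cliff, fib_cliff, fib_lift, fib_cliff, hy]
    exact LinearMap.congr_fun (spin_commutator (pair_skew hφ p)
      (isDualFrame_coord (mem_chart_source _ p)) (x.1 p)) (fib p η)
  map_one k hk := by
    refine Subtype.ext (funext fun p => ?_)
    change spinAt φ p (fib p oneForms) k = 0
    rw [fib_oneForms]
    exact spin_one _ _ _ hk

end manifold

/-! ### Polynomial identities between commuting operators -/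

section commutingOperators

/-- Commuting elements of an algebra lie in a commutative subalgebra, presented here as a
commutative ring so that polynomial identities between them can be checked there. -/
theorem exists_commRing_lift {R : Type u} {ι : Type*} [Ring R] [Algebra ℝ R] (v : ι → R)
    (h : ∀ i j, v i * v j = v j * v i) :
    ∃ (K : Type u) (_ : CommRing K) (_ : Algebra ℝ K) (F : K →ₐ[ℝ] R) (u : ι → K),
      Function.Injective F ∧ ∀ i, F (u i) = v i := by
  have hc : ∀ a ∈ Set.range v, ∀ b ∈ Set.range v, a * b = b * a := by
    rintro _ ⟨i, rfl⟩ _ ⟨j, rfl⟩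
    exact h i j
  have := Algebra.isMulCommutative_adjoin ℝ hc
  exact ⟨Algebra.adjoin ℝ (Set.range v),
    { (inferInstance : Ring (Algebra.adjoin ℝ (Set.range v))) with
      mul_comm := this.is_comm.comm },
    inferInstanceAs (Algebra ℝ (Algebra.adjoin ℝ (Set.range v))),
    (Algebra.adjoin ℝ (Set.range v)).val,
    fun i => ⟨v i, Algebra.subset_adjoin ⟨i, rfl⟩⟩, Subtype.val_injective, fun _ => rfl⟩

variable {K : Type*} [CommRing K] {a s₀ s₁ s₂ n₀ n₁ n₂ : K}

/-- Reduction of `P(s + n)`, for `P = x⁴ - a x²`, modulo the relations `s³ = a s`, `n² = 0`, `s n = 0`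
in each of the three groups of variables. -/
theorem quartic_normalForm (hs₀ : s₀ ^ 3 = a * s₀) (hs₁ : s₁ ^ 3 = a * s₁) (hs₂ : s₂ ^ 3 = a * s₂)
    (hn₀ : n₀ ^ 2 = 0) (hn₁ : n₁ ^ 2 = 0) (hn₂ : n₂ ^ 2 = 0) (h₀ : s₀ * n₀ = 0)
    (h₁ : s₁ * n₁ = 0) (h₂ : s₂ * n₂ = 0) :
    (s₀ + n₀ - (s₁ + n₁) - (s₂ + n₂)) ^ 4 - a * (s₀ + n₀ - (s₁ + n₁) - (s₂ + n₂)) ^ 2 =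
      6 * s₁ * s₂ * a + 2 * s₁ * n₂ * a + 6 * s₁ ^ 2 * s₂ ^ 2 + 2 * n₁ * s₂ * a - 2 * n₁ * n₂ * a -
        6 * s₀ * s₂ * a - 2 * s₀ * n₂ * a - 6 * s₀ * s₁ * a - 12 * s₀ * s₁ * s₂ ^ 2 -
        12 * s₀ * s₁ ^ 2 * s₂ - 12 * s₀ * s₁ ^ 2 * n₂ - 2 * s₀ * n₁ * a - 12 * s₀ * n₁ * s₂ ^ 2 +
        6 * s₀ ^ 2 * s₂ ^ 2 + 12 * s₀ ^ 2 * s₁ * s₂ + 12 * s₀ ^ 2 * s₁ * n₂ + 6 * s₀ ^ 2 * s₁ ^ 2 +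
        12 * s₀ ^ 2 * n₁ * s₂ + 12 * s₀ ^ 2 * n₁ * n₂ - 2 * n₀ * s₂ * a + 2 * n₀ * n₂ * a -
        2 * n₀ * s₁ * a - 12 * n₀ * s₁ * s₂ ^ 2 - 12 * n₀ * s₁ ^ 2 * s₂ - 12 * n₀ * s₁ ^ 2 * n₂ +
        2 * n₀ * n₁ * a - 12 * n₀ * n₁ * s₂ ^ 2 := by
  grind

/-- `P(ad)` lies in the ideal generated by the shifted torsion of `s`, the torsion of `n` and the
mixed torsion. The indices `0`, `1`, `2` stand for composition with the output, the first and the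
second argument of a bilinear operation. -/
theorem quartic_eq (hs₀ : s₀ ^ 3 = a * s₀) (hs₁ : s₁ ^ 3 = a * s₁) (hs₂ : s₂ ^ 3 = a * s₂)
    (hn₀ : n₀ ^ 2 = 0) (hn₁ : n₁ ^ 2 = 0) (hn₂ : n₂ ^ 2 = 0) (h₀ : s₀ * n₀ = 0)
    (h₁ : s₁ * n₁ = 0) (h₂ : s₂ * n₂ = 0) :
    (s₀ + n₀ - (s₁ + n₁) - (s₂ + n₂)) ^ 4 - a * (s₀ + n₀ - (s₁ + n₁) - (s₂ + n₂)) ^ 2 =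
      (3 * (s₂ + s₁ - s₀) + 12 * (n₁ + n₂ - n₀)) * ((s₁ + s₂) * (s₀ - s₁) * (s₀ - s₂)) +
      (12 * (s₀ ^ 2 + s₁ ^ 2 + s₂ ^ 2) - 2 * a) * ((n₀ - n₁) * (n₀ - n₂)) +
      2 * a * ((s₀ - s₁) * (n₀ - n₂) + (n₀ - n₁) * (s₀ - s₂)) := by
  grind

set_option maxRecDepth 20000 in
/-- A multiple of the shifted torsion of `s` lies in the ideal generated by `P(ad)`. -/
theorem shifted_eq (hs₀ : s₀ ^ 3 = a * s₀) (hs₁ : s₁ ^ 3 = a * s₁) (hs₂ : s₂ ^ 3 = a * s₂)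
    (hn₀ : n₀ ^ 2 = 0) (hn₁ : n₁ ^ 2 = 0) (hn₂ : n₂ ^ 2 = 0) (h₀ : s₀ * n₀ = 0)
    (h₁ : s₁ * n₁ = 0) (h₂ : s₂ * n₂ = 0) :
    18 * a ^ 2 * ((s₁ + s₂) * (s₀ - s₁) * (s₀ - s₂)) =
      (3 * s₁ * s₂ ^ 2 + 7 * s₁ ^ 2 * n₂ + 7 * n₁ * a - 3 * s₀ * s₂ ^ 2 + 7 * s₀ * s₁ * s₂ +
        7 * s₀ * s₁ * n₂ - 3 * s₀ * s₁ ^ 2 + 14 * s₀ * n₁ * s₂ - 7 * s₀ ^ 2 * n₂ + 7 * n₀ * a) *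
      ((s₀ + n₀ - (s₁ + n₁) - (s₂ + n₂)) ^ 4 - a * (s₀ + n₀ - (s₁ + n₁) - (s₂ + n₂)) ^ 2) := by
  rw [quartic_normalForm hs₀ hs₁ hs₂ hn₀ hn₁ hn₂ h₀ h₁ h₂]
  grind

set_option maxRecDepth 20000 in
/-- A multiple of the torsion of `n` lies in the ideal generated by `P(ad)`. -/
theorem nilpotent_eq (hs₀ : s₀ ^ 3 = a * s₀) (hs₁ : s₁ ^ 3 = a * s₁) (hs₂ : s₂ ^ 3 = a * s₂)
    (hn₀ : n₀ ^ 2 = 0) (hn₁ : n₁ ^ 2 = 0) (hn₂ : n₂ ^ 2 = 0) (h₀ : s₀ * n₀ = 0)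
    (h₁ : s₁ * n₁ = 0) (h₂ : s₂ * n₂ = 0) :
    2 * a ^ 3 * ((n₀ - n₁) * (n₀ - n₂)) =
      (-a ^ 2 + s₂ ^ 2 * a - s₁ * s₂ * a + s₁ * n₂ * a + s₁ ^ 2 * a + n₁ * s₂ * a + s₀ * s₂ * a -
        2 * s₀ * n₂ * a + s₀ * s₁ * a - s₀ * s₁ * s₂ ^ 2 + 3 * s₀ * s₁ ^ 2 * n₂ + s₀ * n₁ * a +
        s₀ ^ 2 * a) *
      ((s₀ + n₀ - (s₁ + n₁) - (s₂ + n₂)) ^ 4 - a * (s₀ + n₀ - (s₁ + n₁) - (s₂ + n₂)) ^ 2) := by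
  rw [quartic_normalForm hs₀ hs₁ hs₂ hn₀ hn₁ hn₂ h₀ h₁ h₂]
  grind

set_option maxRecDepth 20000 in
/-- A multiple of the mixed torsion lies in the ideal generated by `P(ad)`. -/
theorem bivariate_eq (hs₀ : s₀ ^ 3 = a * s₀) (hs₁ : s₁ ^ 3 = a * s₁) (hs₂ : s₂ ^ 3 = a * s₂)
    (hn₀ : n₀ ^ 2 = 0) (hn₁ : n₁ ^ 2 = 0) (hn₂ : n₂ ^ 2 = 0) (h₀ : s₀ * n₀ = 0)
    (h₁ : s₁ * n₁ = 0) (h₂ : s₂ * n₂ = 0) :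
    6 * a ^ 3 * ((s₀ - s₁) * (n₀ - n₂) + (n₀ - n₁) * (s₀ - s₂)) =
      (3 * s₂ ^ 2 * a - 6 * s₁ * s₂ * a - 15 * s₁ * n₂ * a + 3 * s₁ ^ 2 * a - 16 * n₁ * s₂ * a +
        6 * s₀ * s₂ * a + 32 * s₀ * n₂ * a + 6 * s₀ * s₁ * a - 9 * s₀ * s₁ * s₂ ^ 2 -
        48 * s₀ * s₁ ^ 2 * n₂ - 17 * s₀ * n₁ * a + 3 * s₀ ^ 2 * a - n₀ * s₂ * a) *
      ((s₀ + n₀ - (s₁ + n₁) - (s₂ + n₂)) ^ 4 - a * (s₀ + n₀ - (s₁ + n₁) - (s₂ + n₂)) ^ 2) := by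
  rw [quartic_normalForm hs₀ hs₁ hs₂ hn₀ hn₁ hn₂ h₀ h₁ h₂]
  grind

/-- For `a = -1` the shifted torsion lies in the ideal generated by the three integrability
conditions, obtained from the projectors `-s²` onto the image and `1 + s²` onto the kernel of `s`. -/
theorem fstructure_eq (hs₁ : s₁ ^ 3 = -s₁) (hs₂ : s₂ ^ 3 = -s₂) :
    (s₁ + s₂) * (s₀ - s₁) * (s₀ - s₂) =
      (1 + s₀ * s₂) * (s₁ ^ 2 * s₂ ^ 2 * (s₀ * (1 - s₁ * s₂) - (s₁ + s₂))) +
      (-s₂) * ((1 + s₁ ^ 2) * s₂ ^ 2 * (s₀ ^ 2 - s₀ * s₂)) +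
      (-s₁) * ((1 + s₂ ^ 2) * s₁ ^ 2 * (s₀ ^ 2 - s₀ * s₁)) := by
  grind

theorem integrable_eq (hs₀ : s₀ ^ 3 = -s₀) (hs₁ : s₁ ^ 3 = -s₁) (hs₂ : s₂ ^ 3 = -s₂) :
    2 * (s₁ ^ 2 * s₂ ^ 2 * (s₀ * (1 - s₁ * s₂) - (s₁ + s₂))) =
      (-s₂ ^ 2 - s₁ * s₂ - s₀ * s₂) * ((s₁ + s₂) * (s₀ - s₁) * (s₀ - s₂)) := by
  grind

theorem mixed_integrable_eq (hs₁ : s₁ ^ 3 = -s₁) :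
    (1 + s₁ ^ 2) * s₂ ^ 2 * (s₀ ^ 2 - s₀ * s₂) =
      (s₂ + s₁ ^ 2 * s₂) * ((s₁ + s₂) * (s₀ - s₁) * (s₀ - s₂)) := by
  grind

/-- The ideal generated by `P(ad)` contains nonzero multiples of the three torsions and is contained
in the ideal they generate, so both annihilate the same vectors. -/
theorem quartic_smul_eq_zero_iff [Algebra ℝ K] {N : Type*} [AddCommGroup N] [Module ℝ N]
    (F : K →ₐ[ℝ] Module.End ℝ N) (b : N) {r : ℝ} (hr : r ≠ 0) (ha : a = algebraMap ℝ K r)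
    (hs₀ : s₀ ^ 3 = a * s₀) (hs₁ : s₁ ^ 3 = a * s₁) (hs₂ : s₂ ^ 3 = a * s₂)
    (hn₀ : n₀ ^ 2 = 0) (hn₁ : n₁ ^ 2 = 0) (hn₂ : n₂ ^ 2 = 0) (h₀ : s₀ * n₀ = 0)
    (h₁ : s₁ * n₁ = 0) (h₂ : s₂ * n₂ = 0) :
    F ((s₀ + n₀ - (s₁ + n₁) - (s₂ + n₂)) ^ 4 - a * (s₀ + n₀ - (s₁ + n₁) - (s₂ + n₂)) ^ 2) b = 0 ↔
      F ((s₁ + s₂) * (s₀ - s₁) * (s₀ - s₂)) b = 0 ∧ F ((n₀ - n₁) * (n₀ - n₂)) b = 0 ∧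
        F ((s₀ - s₁) * (n₀ - n₂) + (n₀ - n₁) * (s₀ - s₂)) b = 0 := by
  have key : ∀ (c : ℝ) (X D : K), c ≠ 0 → (∃ Y, algebraMap ℝ K c * X = Y * D) →
      F D b = 0 → F X b = 0 := by
    rintro c X D hc ⟨Y, hXY⟩ hD
    have h := congrArg (fun k : K => F k b) hXY
    simp only [map_mul, AlgHom.commutes, Module.End.mul_apply, hD, map_zero,
      Module.algebraMap_end_apply] at h
    exact (smul_eq_zero.1 h).resolve_left hc
  constructor
  · intro h
    refine ⟨key (18 * r ^ 2) _ _ (by positivity) ?_ h,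
      key (2 * r ^ 3) _ _ (mul_ne_zero two_ne_zero (pow_ne_zero 3 hr)) ?_ h,
      key (6 * r ^ 3) _ _ (mul_ne_zero (by norm_num) (pow_ne_zero 3 hr)) ?_ h⟩
    · rw [map_mul, map_pow, map_ofNat, ← ha]
      exact ⟨_, shifted_eq hs₀ hs₁ hs₂ hn₀ hn₁ hn₂ h₀ h₁ h₂⟩
    · rw [map_mul, map_pow, map_ofNat, ← ha]
      exact ⟨_, nilpotent_eq hs₀ hs₁ hs₂ hn₀ hn₁ hn₂ h₀ h₁ h₂⟩
    · rw [map_mul, map_pow, map_ofNat, ← ha]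
      exact ⟨_, bivariate_eq hs₀ hs₁ hs₂ hn₀ hn₁ hn₂ h₀ h₁ h₂⟩
  · rintro ⟨h1, h2, h3⟩
    rw [quartic_eq hs₀ hs₁ hs₂ hn₀ hn₁ hn₂ h₀ h₁ h₂, map_add, map_add, LinearMap.add_apply,
      LinearMap.add_apply, map_mul F, Module.End.mul_apply, h1, map_mul F, Module.End.mul_apply, h2,
      map_mul F, Module.End.mul_apply, h3, map_zero, map_zero, map_zero, add_zero, add_zero]

end commutingOperators

/-! ### Endomorphisms acting on bilinear operations -/

section bilinear

variable {W : Type u} [AddCommGroup W] [Module ℝ W]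

variable (W) in
/-- Bilinear operations on `W`. -/
abbrev Bil : Type _ := W →ₗ[ℝ] W →ₗ[ℝ] W

/-- Postcomposition of bilinear operations with an endomorphism. -/
def post : Module.End ℝ W →ₗ[ℝ] Module.End ℝ (Bil W) where
  toFun f :=
    { toFun := fun b => b.compr₂ f
      map_add' := fun b c => by ext; simp
      map_smul' := fun r b => by ext; simp }
  map_add' f g := by ext; simp
  map_smul' r f := by ext; simp

/-- Precomposition of bilinear operations with an endomorphism in the first argument. -/
def pre₁ : Module.End ℝ W →ₗ[ℝ] Module.End ℝ (Bil W) where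
  toFun f :=
    { toFun := fun b => b ∘ₗ f
      map_add' := fun b c => by ext; simp
      map_smul' := fun r b => by ext; simp }
  map_add' f g := by ext; simp
  map_smul' r f := by ext; simp

/-- Precomposition of bilinear operations with an endomorphism in the second argument. -/
def pre₂ : Module.End ℝ W →ₗ[ℝ] Module.End ℝ (Bil W) where
  toFun f :=
    { toFun := fun b => b.compl₂ f
      map_add' := fun b c => by ext; simp
      map_smul' := fun r b => by ext; simp }
  map_add' f g := by ext; simp
  map_smul' r f := by ext; simp

@[simp] theorem post_apply (f : Module.End ℝ W) (b : Bil W) (x y : W) :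
    post f b x y = f (b x y) := rfl

@[simp] theorem pre₁_apply (f : Module.End ℝ W) (b : Bil W) (x y : W) :
    pre₁ f b x y = b (f x) y := rfl

@[simp] theorem pre₂_apply (f : Module.End ℝ W) (b : Bil W) (x y : W) :
    pre₂ f b x y = b x (f y) := rfl

theorem post_mul (f g : Module.End ℝ W) : post (f * g) = post f * post g := rfl

theorem pre₁_mul (f g : Module.End ℝ W) : pre₁ (f * g) = pre₁ g * pre₁ f := rfl

theorem pre₂_mul (f g : Module.End ℝ W) : pre₂ (f * g) = pre₂ g * pre₂ f := rfl

theorem post_pow_three (f : Module.End ℝ W) : post (f ^ 3) = post f ^ 3 := rfl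

theorem pre₁_pow_three (f : Module.End ℝ W) : pre₁ (f ^ 3) = pre₁ f ^ 3 := rfl

theorem pre₂_pow_three (f : Module.End ℝ W) : pre₂ (f ^ 3) = pre₂ f ^ 3 := rfl

/-- The deviation of `f` from being a Nijenhuis operator for the bilinear operation `b`. -/
def nij (f : Module.End ℝ W) (b : Bil W) : Bil W := ((post f - pre₁ f) * (post f - pre₂ f)) b

theorem nij_apply (f : Module.End ℝ W) (b : Bil W) (x y : W) :
    nij f b x y = f (f (b x y)) + b (f x) (f y) - f (b (f x) y + b x (f y)) := by
  change f (f (b x y) - b x (f y)) - (f (b (f x) y) - b (f x) (f y)) = _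
  rw [map_sub, map_add]
  abel

/-- The six operators `post s`, `pre₁ s`, `pre₂ s`, `post t`, `pre₁ t`, `pre₂ t` commute with each
other when `s` and `t` do. -/
theorem exists_commRing_lift_bilinear {s t : Module.End ℝ W} (h : s * t = t * s) :
    ∃ (K : Type u) (_ : CommRing K) (_ : Algebra ℝ K) (F : K →ₐ[ℝ] Module.End ℝ (Bil W))
      (s₀ s₁ s₂ t₀ t₁ t₂ : K), Function.Injective F ∧ F s₀ = post s ∧ F s₁ = pre₁ s ∧
        F s₂ = pre₂ s ∧ F t₀ = post t ∧ F t₁ = pre₁ t ∧ F t₂ = pre₂ t := by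
  have e (x : W) : s (t x) = t (s x) := LinearMap.congr_fun h x
  obtain ⟨K, _, _, F, u, hF, hu⟩ := exists_commRing_lift
    ![post s, pre₁ s, pre₂ s, post t, pre₁ t, pre₂ t] (by
      intro i j
      refine LinearMap.ext fun b => LinearMap.ext₂ fun x y => ?_
      fin_cases i <;> fin_cases j <;> first | rfl | simp [e])
  exact ⟨K, _, _, F, u 0, u 1, u 2, u 3, u 4, u 5, hF, hu 0, hu 1, hu 2, hu 3, hu 4, hu 5⟩

/-- The mixed deviation as a polarization. -/
theorem mixed_expand {R : Type*} [Ring R] (a b c a' b' c' : R) :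
    (a - b) * (a' - c') + (a' - b') * (a - c) =
      (a + a' - (b + b')) * (a + a' - (c + c')) - (a - b) * (a - c) - (a' - b') * (a' - c') := by
  noncomm_ring

/-- If `s³ = a s`, `t² = 0` and `s t = t s = 0`, then vanishing of
`P(ad)` on a bilinear operation, for `P = x⁴ - a x²` and the sum `s + t`, splits into vanishing
of the shifted Nijenhuis deviation of `s`, of the Nijenhuis deviation of `t`, and of the mixed
deviation. -/
theorem quartic_apply_eq_zero_iff {a : ℝ} (ha : a ≠ 0) {s t : Module.End ℝ W}
    (hs : s ^ 3 = a • s) (ht : t ^ 2 = 0) (hst : s * t = 0) (hts : t * s = 0) (b : Bil W) :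
    (((post (s + t) - pre₁ (s + t) - pre₂ (s + t)) ^ 4 -
        a • (post (s + t) - pre₁ (s + t) - pre₂ (s + t)) ^ 2) b = 0) ↔
      ((pre₁ s + pre₂ s) (nij s b) = 0 ∧ nij t b = 0 ∧ nij (s + t) b - nij s b - nij t b = 0) := by
  obtain ⟨K, _, _, F, s₀, s₁, s₂, t₀, t₁, t₂, hF, es₀, es₁, es₂, et₀, et₁, et₂⟩ :=
    exists_commRing_lift_bilinear (hst.trans hts.symm)
  rw [pow_two] at ht
  have H := quartic_smul_eq_zero_iff (a := algebraMap ℝ K a) (s₀ := s₀) (s₁ := s₁) (s₂ := s₂)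
    (n₀ := t₀) (n₁ := t₁) (n₂ := t₂) F b ha rfl
    (hF (by rw [map_pow, map_mul, AlgHom.commutes, es₀, ← post_pow_three, hs, map_smul,
      Algebra.smul_def]))
    (hF (by rw [map_pow, map_mul, AlgHom.commutes, es₁, ← pre₁_pow_three, hs, map_smul,
      Algebra.smul_def]))
    (hF (by rw [map_pow, map_mul, AlgHom.commutes, es₂, ← pre₂_pow_three, hs, map_smul,
      Algebra.smul_def]))
    (hF (by rw [map_pow, map_zero, et₀, pow_two, ← post_mul, ht, map_zero]))
    (hF (by rw [map_pow, map_zero, et₁, pow_two, ← pre₁_mul, ht, map_zero]))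
    (hF (by rw [map_pow, map_zero, et₂, pow_two, ← pre₂_mul, ht, map_zero]))
    (hF (by rw [map_mul, map_zero, es₀, et₀, ← post_mul, hst, map_zero]))
    (hF (by rw [map_mul, map_zero, es₁, et₁, ← pre₁_mul, hts, map_zero]))
    (hF (by rw [map_mul, map_zero, es₂, et₂, ← pre₂_mul, hts, map_zero]))
  simp only [map_sub, map_add, map_mul, map_pow, AlgHom.commutes, es₀, es₁, es₂, et₀, et₁,
    et₂] at H
  rw [Algebra.smul_def]
  simp only [map_add]
  refine H.trans (and_congr Iff.rfl (and_congr Iff.rfl ?_))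
  have hU : ((post s - pre₁ s) * (post t - pre₂ t) + (post t - pre₁ t) * (post s - pre₂ s)) b =
      nij (s + t) b - nij s b - nij t b := by
    unfold nij
    rw [map_add, map_add, map_add, ← LinearMap.sub_apply, ← LinearMap.sub_apply]
    congr 1
    exact mixed_expand (R := Module.End ℝ (Bil W)) _ _ _ _ _ _
  rw [← hU]

/-- For `J³ = -J` the vanishing of the shifted Nijenhuis deviation is equivalent to conditions on
the image of `J` (where `J² = -1`) and the kernel of `J` (the image of `1 + J²`). -/
theorem shifted_nij_eq_zero_iff {J : Module.End ℝ W} (hJ : J ^ 3 = -J) (b : Bil W) :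
    (pre₁ J + pre₂ J) (nij J b) = 0 ↔
      (∀ x y, J (J x) = -x → J (J y) = -y →
        J (b x y - b (J x) (J y)) = b (J x) y + b x (J y)) ∧
      (∀ x y, J x = 0 → J (J y) = -y → J (J (b x y)) = J (b x (J y))) ∧
      (∀ x y, J (J x) = -x → J y = 0 → J (J (b x y)) = J (b (J x) y)) := by
  have hJ3 : ∀ x, J (J (J x)) = - J x := LinearMap.congr_fun hJ
  obtain ⟨K, _, _, F, s₀, s₁, s₂, -, -, -, hF, es₀, es₁, es₂, -, -, -⟩ :=
    exists_commRing_lift_bilinear (rfl : J * J = J * J)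
  have k₀ : s₀ ^ 3 = -s₀ := hF (by rw [map_pow, map_neg, es₀, ← post_pow_three, hJ, map_neg])
  have k₁ : s₁ ^ 3 = -s₁ := hF (by rw [map_pow, map_neg, es₁, ← pre₁_pow_three, hJ, map_neg])
  have k₂ : s₂ ^ 3 = -s₂ := hF (by rw [map_pow, map_neg, es₂, ← pre₂_pow_three, hJ, map_neg])
  have E0 := fstructure_eq (s₀ := s₀) k₁ k₂
  have E1 := integrable_eq k₀ k₁ k₂
  have E2 := mixed_integrable_eq (s₀ := s₀) (s₂ := s₂) k₁
  have E3 := mixed_integrable_eq (s₀ := s₀) (s₂ := s₁) k₂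
  rw [show (s₂ + s₁) * (s₀ - s₂) * (s₀ - s₁) = (s₁ + s₂) * (s₀ - s₁) * (s₀ - s₂) by ring] at E3
  have hS : F ((s₁ + s₂) * (s₀ - s₁) * (s₀ - s₂)) b = (pre₁ J + pre₂ J) (nij J b) := by
    simp only [map_sub, map_add, map_mul, es₀, es₁, es₂]
    rfl
  have h1 : F (s₁ ^ 2 * s₂ ^ 2 * (s₀ * (1 - s₁ * s₂) - (s₁ + s₂))) b = 0 ↔
      ∀ x y, J (J x) = -x → J (J y) = -y →
        J (b x y - b (J x) (J y)) = b (J x) y + b x (J y) := by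
    simp only [map_sub, map_add, map_mul, map_one, es₀, es₁, es₂, pow_two]
    constructor
    · intro h x y hx hy
      have := LinearMap.congr_fun₂ h x y
      change J (b (J (J x)) (J (J y)) - b (J (J (J x))) (J (J (J y)))) -
        (b (J (J (J x))) (J (J y)) + b (J (J x)) (J (J (J y)))) = 0 at this
      rw [hJ3, hJ3, hx, hy] at this
      simpa [sub_eq_zero] using this
    · intro h
      refine LinearMap.ext₂ fun x y => ?_
      change J (b (J (J x)) (J (J y)) - b (J (J (J x))) (J (J (J y)))) -
        (b (J (J (J x))) (J (J y)) + b (J (J x)) (J (J (J y)))) = 0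
      rw [sub_eq_zero]
      rw [map_sub]
      exact h (J (J x)) (J (J y)) (hJ3 (J x)) (hJ3 (J y))
  have h2 : F ((1 + s₁ ^ 2) * s₂ ^ 2 * (s₀ ^ 2 - s₀ * s₂)) b = 0 ↔
      ∀ x y, J x = 0 → J (J y) = -y → J (J (b x y)) = J (b x (J y)) := by
    simp only [map_sub, map_add, map_mul, map_one, es₀, es₁, es₂, pow_two]
    constructor
    · intro h x y hx hy
      have := LinearMap.congr_fun₂ h x y
      change (J (J (b x (J (J y)))) - J (b x (J (J (J y))))) +
        (J (J (b (J (J x)) (J (J y)))) - J (b (J (J x)) (J (J (J y))))) = 0 at this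
      rw [hJ3, hx, hy] at this
      simp only [map_neg, map_zero, LinearMap.zero_apply, sub_zero, add_zero, neg_zero,
        sub_neg_eq_add] at this
      rwa [neg_add_eq_zero] at this
    · intro h
      refine LinearMap.ext₂ fun x y => ?_
      change (J (J (b x (J (J y)))) - J (b x (J (J (J y))))) +
        (J (J (b (J (J x)) (J (J y)))) - J (b (J (J x)) (J (J (J y))))) = 0
      have := h (x + J (J x)) (J (J y)) (by rw [map_add, hJ3, add_neg_cancel])
        (hJ3 (J y))
      simp only [map_add, LinearMap.add_apply] at this
      rw [← sub_eq_zero] at this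
      rw [← this]
      abel
  have h3 : F ((1 + s₂ ^ 2) * s₁ ^ 2 * (s₀ ^ 2 - s₀ * s₁)) b = 0 ↔
      ∀ x y, J (J x) = -x → J y = 0 → J (J (b x y)) = J (b (J x) y) := by
    simp only [map_sub, map_add, map_mul, map_one, es₀, es₁, es₂, pow_two]
    constructor
    · intro h x y hx hy
      have := LinearMap.congr_fun₂ h x y
      change (J (J (b (J (J x)) y)) - J (b (J (J (J x))) y)) +
        (J (J (b (J (J x)) (J (J y)))) - J (b (J (J (J x))) (J (J y)))) = 0 at this
      rw [hJ3, hx, hy] at this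
      simp only [map_neg, map_zero, LinearMap.neg_apply, sub_zero, add_zero, sub_neg_eq_add] at this
      rwa [neg_add_eq_zero] at this
    · intro h
      refine LinearMap.ext₂ fun x y => ?_
      change (J (J (b (J (J x)) y)) - J (b (J (J (J x))) y)) +
        (J (J (b (J (J x)) (J (J y)))) - J (b (J (J (J x))) (J (J y)))) = 0
      have := h (J (J x)) (y + J (J y)) (hJ3 (J x))
        (by rw [map_add, hJ3, add_neg_cancel])
      simp only [map_add] at this
      rw [← sub_eq_zero] at this
      rw [← this]
      abel
  rw [← h1, ← h2, ← h3, ← hS]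
  constructor
  · intro h
    refine ⟨?_, ?_, ?_⟩
    · have h' := congrArg (fun k => F k b) E1
      rw [map_mul F _ ((s₁ + s₂) * (s₀ - s₁) * (s₀ - s₂)), Module.End.mul_apply, h, map_zero,
        two_mul, map_add, LinearMap.add_apply, ← two_smul ℝ] at h'
      exact (smul_eq_zero.1 h').resolve_left two_ne_zero
    · rw [E2, map_mul, Module.End.mul_apply, h, map_zero]
    · rw [E3, map_mul, Module.End.mul_apply, h, map_zero]
  · rintro ⟨h1, h2, h3⟩
    rw [E0, map_add, map_add, LinearMap.add_apply, LinearMap.add_apply, map_mul F,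
      Module.End.mul_apply, h1, map_mul F, Module.End.mul_apply, h2, map_mul F,
      Module.End.mul_apply, h3, map_zero, map_zero, map_zero, add_zero, add_zero]

end bilinear

/-! ### Minimality in terms of the Dorfman bracket -/

section sections

variable {n : ℕ} {M : Type u} [TopologicalSpace M] [ChartedSpace (Model n) M]
  [IsManifold (𝓡 n) ∞ M]

variable (n M) in
/-- The real vector space of smooth sections of `TM ⊕ T*M`. -/
def Sections : Type u := genSections n M

instance : AddCommGroup (Sections n M) := inferInstanceAs (AddCommGroup (genSections n M))

instance : Module ℝ (Sections n M) := inferInstanceAs (Module ℝ (genSections n M))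

/-- The endomorphism of the space of smooth sections induced by a smooth endomorphism of
`TM ⊕ T*M`. -/
def secEnd (φ : EndoField n M) (hφ : ∀ x ∈ genSections n M, φ.act x ∈ genSections n M) :
    Module.End ℝ (Sections n M) where
  toFun x := ⟨φ.act x.1, hφ x.1 x.2⟩
  map_add' _ _ := Subtype.ext (funext fun p => map_add (φ p) _ _)
  map_smul' _ _ := Subtype.ext (funext fun p => map_smul (φ p) _ _)

/-- The Clifford action of sections on forms, as a linear map. -/
def cliffL : Sections n M →ₗ[ℝ] FormOp n M where
  toFun x := cliff (show genSections n M from x)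
  map_add' x y := by
    refine LinearMap.ext fun η => forms_ext fun p => ?_
    change fib p (cliff (show genSections n M from x + y) η) =
      fib p (cliff (show genSections n M from x) η) + fib p (cliff (show genSections n M from y) η)
    erw [fib_cliff, fib_cliff, fib_cliff, ← LinearMap.add_apply, ← map_add]
    rfl
  map_smul' c x := by
    refine LinearMap.ext fun η => forms_ext fun p => ?_
    change fib p (cliff (show genSections n M from c • x) η) =
      c • fib p (cliff (show genSections n M from x) η)
    erw [fib_cliff, fib_cliff, ← LinearMap.smul_apply, ← map_smul]
    rfl

theorem derivedBracket_add_left (δ a a' b : FormOp n M) :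
    derivedBracket δ (a + a') b = derivedBracket δ a b + derivedBracket δ a' b := by
  unfold derivedBracket; noncomm_ring

theorem derivedBracket_add_right (δ a b b' : FormOp n M) :
    derivedBracket δ a (b + b') = derivedBracket δ a b + derivedBracket δ a b' := by
  unfold derivedBracket; noncomm_ring

theorem derivedBracket_add (δ δ' a b : FormOp n M) :
    derivedBracket (δ + δ') a b = derivedBracket δ a b + derivedBracket δ' a b := by
  unfold derivedBracket; noncomm_ring

theorem derivedBracket_smul_left (c : ℝ) (δ a b : FormOp n M) :
    derivedBracket δ (c • a) b = c • derivedBracket δ a b := by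
  simp only [derivedBracket, smul_mul_assoc, mul_smul_comm, ← smul_add, ← smul_sub]

theorem derivedBracket_smul_right (c : ℝ) (δ a b : FormOp n M) :
    derivedBracket δ a (c • b) = c • derivedBracket δ a b := by
  simp only [derivedBracket, smul_mul_assoc, mul_smul_comm, ← smul_sub]

theorem derivedBracket_smul (c : ℝ) (δ a b : FormOp n M) :
    derivedBracket (c • δ) a b = c • derivedBracket δ a b := by
  simp only [derivedBracket, smul_mul_assoc, mul_smul_comm, ← smul_add, ← smul_sub]

/-- The graded commutator with an even operator `ψ` is a derivation of the derived bracket. -/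
theorem derivedBracket_adOp (ψ δ a b : FormOp n M) :
    derivedBracket (adOp ψ δ) a b = ψ * derivedBracket δ a b - derivedBracket δ a b * ψ
      - derivedBracket δ (ψ * a - a * ψ) b - derivedBracket δ a (ψ * b - b * ψ) := by
  simp only [derivedBracket, adOp, LinearMap.sub_apply, LinearMap.mulLeft_apply,
    LinearMap.mulRight_apply]
  noncomm_ring

variable [T2Space M]

theorem cliffL_injective : Function.Injective (cliffL (n := n) (M := M)) := cliff_injective

/-- The Dorfman bracket of smooth sections. -/
def dorfmanSec (x y : Sections n M) : Sections n M := ⟨dorfman x.1 y.1, dorfman_mem x y⟩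

theorem cliffL_dorfmanSec (x y : Sections n M) :
    cliffL (dorfmanSec x y) = derivedBracket (deRham n M) (cliffL x) (cliffL y) :=
  (derivedBracket_deRham x y).symm

variable (n M) in
/-- The Dorfman bracket as a bilinear operation on smooth sections. -/
def bracket : Bil (Sections n M) :=
  LinearMap.mk₂ ℝ dorfmanSec
    (fun x x' y => cliffL_injective (by
      simp only [cliffL_dorfmanSec, map_add, derivedBracket_add_left]))
    (fun c x y => cliffL_injective (by
      simp only [cliffL_dorfmanSec, map_smul, derivedBracket_smul_left]))
    (fun x y y' => cliffL_injective (by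
      simp only [cliffL_dorfmanSec, map_add, derivedBracket_add_right]))
    (fun c x y => cliffL_injective (by
      simp only [cliffL_dorfmanSec, map_smul, derivedBracket_smul_right]))

/-- The derived bracket of the operator `δ` is the bilinear operation `b` on sections. -/
def Represents (δ : FormOp n M) (b : Bil (Sections n M)) : Prop :=
  ∀ x y : Sections n M, derivedBracket δ (cliffL x) (cliffL y) = cliffL (b x y)

theorem represents_deRham : Represents (deRham n M) (bracket n M) := derivedBracket_deRham

/-- A lift `ψ` of `φ` acts on operators by `ad_ψ`; on derived brackets this becomes the action of
`φ` on the output minus its actions on the two arguments. -/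
theorem Represents.adOp {φ : EndoField n M} {hφ : ∀ x ∈ genSections n M, φ.act x ∈ genSections n M}
    {ψ : FormOp n M} (hψ : IsLift φ ψ) {δ : FormOp n M} {b : Bil (Sections n M)}
    (h : Represents δ b) :
    Represents (adOp ψ δ)
      ((post (secEnd φ hφ) - pre₁ (secEnd φ hφ) - pre₂ (secEnd φ hφ)) b) := by
  intro x y
  have e (z : Sections n M) : ψ * cliffL z - cliffL z * ψ = cliffL (secEnd φ hφ z) :=
    hψ.comm_section z _ rfl
  rw [derivedBracket_adOp, h x y, e, e, e, h, h, ← map_sub, ← map_sub]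
  rfl

theorem Represents.add {δ δ' : FormOp n M} {b b' : Bil (Sections n M)} (h : Represents δ b)
    (h' : Represents δ' b') : Represents (δ + δ') (b + b') := fun x y => by
  rw [derivedBracket_add, h x y, h' x y, LinearMap.add_apply, LinearMap.add_apply, map_add]

theorem Represents.smul {δ : FormOp n M} {b : Bil (Sections n M)} (h : Represents δ b) (c : ℝ) :
    Represents (c • δ) (c • b) := fun x y => by
  rw [derivedBracket_smul, h x y, LinearMap.smul_apply, LinearMap.smul_apply, map_smul]

theorem Represents.aeval {A : Module.End ℝ (FormOp n M)} {D : Module.End ℝ (Bil (Sections n M))}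
    (hAD : ∀ δ b, Represents δ b → Represents (A δ) (D b)) {δ : FormOp n M}
    {b : Bil (Sections n M)} (h : Represents δ b) (P : Polynomial ℝ) :
    Represents (Polynomial.aeval A P δ) (Polynomial.aeval D P b) := by
  have hpow (k : ℕ) : Represents ((A ^ k) δ) ((D ^ k) b) := by
    induction k with
    | zero => exact h
    | succ k ih => rw [pow_succ', pow_succ']; exact hAD _ _ ih
  induction P using Polynomial.induction_on' with
  | add P Q hP hQ => rw [map_add, map_add]; exact hP.add hQ
  | monomial k c =>
    rw [Polynomial.aeval_monomial, Polynomial.aeval_monomial, ← Algebra.smul_def,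
      ← Algebra.smul_def]
    exact (hpow k).smul c

/-- Minimality of a generalized polynomial structure, expressed through the Dorfman bracket. -/
theorem isMinimal_iff {φ : EndoField n M} {P : Polynomial ℝ} (hP : IsGPS φ P) :
    IsMinimal φ ↔ Polynomial.aeval (post (secEnd φ hP.skewEndo.smooth) -
      pre₁ (secEnd φ hP.skewEndo.smooth) - pre₂ (secEnd φ hP.skewEndo.smooth)) P
        (bracket n M) = 0 := by
  constructor
  · rintro ⟨Q, ψ, hQ, hψ, h⟩
    rcases isEmpty_or_nonempty M with hM | ⟨⟨p⟩⟩
    · exact LinearMap.ext₂ fun x y => Subtype.ext (funext fun p => hM.elim p)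
    · obtain rfl : Q = P := (hQ.minpoly_eq p).symm.trans (hP.minpoly_eq p)
      refine LinearMap.ext₂ fun x y => cliffL_injective ?_
      exact ((represents_deRham.aeval (fun _ _ h => h.adOp hψ) Q) x y).symm.trans ((h x y).trans (map_zero cliffL).symm)
  · intro h
    refine ⟨P, lift hP.skewEndo, hP, isLift_lift _, fun x y => ?_⟩
    refine ((represents_deRham.aeval
      (fun _ _ h => h.adOp (hφ := hP.skewEndo.smooth) (isLift_lift hP.skewEndo)) P) x y).trans ?_
    rw [h]
    exact map_zero cliffL

theorem torsion_eq_nij (φ : EndoField n M) (hφ : ∀ x ∈ genSections n M, φ.act x ∈ genSections n M)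
    (x y : Sections n M) :
    torsion φ x.1 y.1 = (nij (secEnd φ hφ) (bracket n M) x y).1 := by
  rw [nij_apply]; rfl

theorem isGenNijenhuis_iff (φ : EndoField n M)
    (hφ : ∀ x ∈ genSections n M, φ.act x ∈ genSections n M) :
    IsGenNijenhuis φ ↔ nij (secEnd φ hφ) (bracket n M) = 0 := by
  constructor
  · intro h
    exact LinearMap.ext₂ fun x y => Subtype.ext
      ((torsion_eq_nij φ hφ x y).symm.trans (h x.1 x.2 y.1 y.2))
  · intro h x hx y hy
    rw [torsion_eq_nij φ hφ (⟨x, hx⟩ : genSections n M) (⟨y, hy⟩ : genSections n M), h]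
    rfl

theorem isWeakGenNijenhuis_iff (φ : EndoField n M)
    (hφ : ∀ x ∈ genSections n M, φ.act x ∈ genSections n M) :
    IsWeakGenNijenhuis φ ↔
      (pre₁ (secEnd φ hφ) + pre₂ (secEnd φ hφ)) (nij (secEnd φ hφ) (bracket n M)) = 0 := by
  have e (x y : Sections n M) : shiftedTorsion φ x.1 y.1 =
      ((pre₁ (secEnd φ hφ) + pre₂ (secEnd φ hφ)) (nij (secEnd φ hφ) (bracket n M)) x y).1 :=
    congrArg₂ (· + ·) (torsion_eq_nij φ hφ (secEnd φ hφ x) y)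
      (torsion_eq_nij φ hφ x (secEnd φ hφ y))
  constructor
  · intro h
    exact LinearMap.ext₂ fun x y => Subtype.ext ((e x y).symm.trans (h x.1 x.2 y.1 y.2))
  · intro h x hx y hy
    rw [e (⟨x, hx⟩ : genSections n M) (⟨y, hy⟩ : genSections n M), h]
    rfl

theorem act_add_mem {φ ψ : EndoField n M} (hφ : ∀ x ∈ genSections n M, φ.act x ∈ genSections n M)
    (hψ : ∀ x ∈ genSections n M, ψ.act x ∈ genSections n M) :
    ∀ x ∈ genSections n M, (φ + ψ).act x ∈ genSections n M :=
  fun x hx => add_mem (hφ x hx) (hψ x hx)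

theorem bivariateTorsionVanishes_iff (φ ψ : EndoField n M)
    (hφ : ∀ x ∈ genSections n M, φ.act x ∈ genSections n M)
    (hψ : ∀ x ∈ genSections n M, ψ.act x ∈ genSections n M) :
    BivariateTorsionVanishes φ ψ ↔ nij (secEnd φ hφ + secEnd ψ hψ) (bracket n M) -
      nij (secEnd φ hφ) (bracket n M) - nij (secEnd ψ hψ) (bracket n M) = 0 := by
  have e (x y : Sections n M) : bivariateTorsion φ ψ x.1 y.1 =
      ((nij (secEnd φ hφ + secEnd ψ hψ) (bracket n M) -
      nij (secEnd φ hφ) (bracket n M) - nij (secEnd ψ hψ) (bracket n M)) x y).1 := by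
    unfold bivariateTorsion
    rw [torsion_eq_nij (φ + ψ) (act_add_mem hφ hψ) x y, torsion_eq_nij φ hφ x y,
      torsion_eq_nij ψ hψ x y]
    rfl
  constructor
  · intro h
    exact LinearMap.ext₂ fun x y => Subtype.ext ((e x y).symm.trans (h x.1 x.2 y.1 y.2))
  · intro h x hx y hy
    rw [e (⟨x, hx⟩ : genSections n M) (⟨y, hy⟩ : genSections n M), h]
    rfl

open Polynomial in
/-- For the minimal polynomial `x⁴ - a x²` and a splitting `φ = s + t` with `s³ = a s`, `t² = 0`,
`s t = t s = 0`, minimality means that `s` is weakly Nijenhuis, `t` is Nijenhuis, and the mixed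
torsion of `s` and `t` vanishes. -/
theorem isMinimal_quartic_iff {a : ℝ} (ha : a ≠ 0) {φ s t : EndoField n M}
    (hφ : IsGPS φ (X ^ 4 - C a * X ^ 2)) (hsum : φ = t + s)
    (hs : ∀ x ∈ genSections n M, s.act x ∈ genSections n M)
    (ht : ∀ x ∈ genSections n M, t.act x ∈ genSections n M)
    (hs3 : ∀ p, s p ^ 3 = a • s p) (ht2 : ∀ p, t p ^ 2 = 0) (hst : ∀ p, s p * t p = 0)
    (hts : ∀ p, t p * s p = 0) :
    IsMinimal φ ↔ IsWeakGenNijenhuis s ∧ IsGenNijenhuis t ∧ BivariateTorsionVanishes s t := by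
  have e : secEnd φ hφ.skewEndo.smooth = secEnd s hs + secEnd t ht := by
    subst hsum
    refine LinearMap.ext fun x => Subtype.ext (funext fun p => ?_)
    exact add_comm (t p (x.1 p)) (s p (x.1 p))
  rw [isMinimal_iff hφ, e, isWeakGenNijenhuis_iff s hs, isGenNijenhuis_iff t ht,
    bivariateTorsionVanishes_iff s t hs ht]
  rw [← quartic_apply_eq_zero_iff ha]
  · rw [map_sub, map_mul, aeval_C, map_pow, map_pow, aeval_X, ← Algebra.smul_def]
  · exact LinearMap.ext fun x => Subtype.ext (funext fun p => LinearMap.congr_fun (hs3 p) (x.1 p))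
  · exact LinearMap.ext fun x => Subtype.ext (funext fun p => LinearMap.congr_fun (ht2 p) (x.1 p))
  · exact LinearMap.ext fun x => Subtype.ext (funext fun p => LinearMap.congr_fun (hst p) (x.1 p))
  · exact LinearMap.ext fun x => Subtype.ext (funext fun p => LinearMap.congr_fun (hts p) (x.1 p))

end sections

/-! ### Minimal polynomials of the Jordan parts -/

section minimalPolynomials
open Polynomial

variable {A : Type*} [Ring A] [Algebra ℝ A] {f s t : A}

/-- The powers `1, f, f², f³` are linearly independent when the minimal polynomial of `f` has
degree `4`. -/
theorem coeffs_eq_zero_of_cubic (hf : (minpoly ℝ f).natDegree = 4) {c₀ c₁ c₂ c₃ : ℝ}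
    (h : c₃ • f ^ 3 + c₂ • f ^ 2 + c₁ • f + c₀ • (1 : A) = 0) :
    c₀ = 0 ∧ c₁ = 0 ∧ c₂ = 0 ∧ c₃ = 0 := by
  have hQ : C c₃ * X ^ 3 + C c₂ * X ^ 2 + C c₁ * X + C c₀ = 0 := by
    by_contra hne
    have h1 := minpoly.degree_le_of_ne_zero ℝ f hne (by
      simpa [Algebra.smul_def] using h)
    have h2 : natDegree (C c₃ * X ^ 3 + C c₂ * X ^ 2 + C c₁ * X + C c₀) ≤ 3 := natDegree_cubic_le
    have h3 := natDegree_le_natDegree h1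
    omega
  have hc (k : ℕ) := congrArg (fun Q => coeff Q k) hQ
  have h0 := hc 0
  have h1 := hc 1
  have h2 := hc 2
  have h3 := hc 3
  simp [coeff_X, coeff_C] at h0 h1 h2 h3
  exact ⟨h0, h1, h2, h3⟩

theorem aeval_quartic (a : ℝ) :
    aeval f (X ^ 4 - C a * X ^ 2 : ℝ[X]) = f ^ 4 - a • f ^ 2 := by
  simp [Algebra.smul_def]

theorem inv_smul_cube_pow_three {a : ℝ} (ha : a ≠ 0) (hf : f ^ 4 = a • f ^ 2) :
    (a⁻¹ • f ^ 3) ^ 3 = a • a⁻¹ • f ^ 3 := by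
  have h5 : f ^ 5 = a • f ^ 3 := by rw [pow_succ, hf, smul_mul_assoc, ← pow_succ]
  have h7 : f ^ 7 = a ^ 2 • f ^ 3 := by
    rw [show f ^ 7 = f ^ 5 * f ^ 2 by rw [← pow_add], h5, smul_mul_assoc, ← pow_add, h5, smul_smul,
      pow_two]
  have h9 : f ^ 9 = a ^ 3 • f ^ 3 := by
    rw [show f ^ 9 = f ^ 7 * f ^ 2 by rw [← pow_add], h7, smul_mul_assoc, ← pow_add, h5, smul_smul,
      pow_succ a 2]
  rw [_root_.smul_pow, ← pow_mul, h9, smul_smul, smul_smul, inv_pow, inv_mul_cancel₀ (pow_ne_zero 3 ha),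
    mul_inv_cancel₀ ha]

theorem sub_inv_smul_cube_sq {a : ℝ} (ha : a ≠ 0) (hf : f ^ 4 = a • f ^ 2) :
    (f - a⁻¹ • f ^ 3) ^ 2 = 0 := by
  have h6 : f ^ 6 = a • a • f ^ 2 := by
    rw [show f ^ 6 = f ^ 4 * f ^ 2 by rw [← pow_add], hf, smul_mul_assoc, ← pow_add, hf]
  have : (f - a⁻¹ • f ^ 3) ^ 2 = f ^ 2 - (2 * a⁻¹) • f ^ 4 + (a⁻¹ * a⁻¹) • f ^ 6 := by
    rw [pow_two, sub_mul, mul_sub, mul_sub, smul_mul_assoc, mul_smul_comm, smul_mul_assoc,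
      mul_smul_comm, ← pow_two, ← pow_succ, ← pow_succ', ← pow_add, smul_smul, two_mul, add_smul]
    abel
  rw [this, h6, hf, smul_smul, smul_smul, smul_smul, mul_assoc, inv_mul_cancel₀ ha,
    show a⁻¹ * a⁻¹ * a * a = 1 by field_simp, mul_one, one_smul, two_smul]
  abel

theorem inv_smul_cube_mul_sub {a : ℝ} (ha : a ≠ 0) (hf : f ^ 4 = a • f ^ 2) :
    (a⁻¹ • f ^ 3) * (f - a⁻¹ • f ^ 3) = 0 := by
  have h6 : f ^ 6 = a • a • f ^ 2 := by
    rw [show f ^ 6 = f ^ 4 * f ^ 2 by rw [← pow_add], hf, smul_mul_assoc, ← pow_add, hf]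
  rw [mul_sub, smul_mul_assoc, smul_mul_assoc, mul_smul_comm, ← pow_succ, ← pow_add, hf, h6,
    smul_smul, smul_smul, smul_smul, smul_smul, inv_mul_cancel₀ ha, one_smul,
    show a⁻¹ * a⁻¹ * a * a = 1 by field_simp, one_smul, sub_self]

theorem sub_mul_inv_smul_cube {a : ℝ} (ha : a ≠ 0) (hf : f ^ 4 = a • f ^ 2) :
    (f - a⁻¹ • f ^ 3) * (a⁻¹ • f ^ 3) = 0 := by
  have h : Commute (f - a⁻¹ • f ^ 3) (a⁻¹ • f ^ 3) :=
    (((Commute.refl f).pow_right 3).smul_right a⁻¹).sub_left (Commute.refl _)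
  rw [h.eq, inv_smul_cube_mul_sub ha hf]

/-- The Bézout coefficients come from `-a = p' - (3x/2a)(x p' - 3p)` for `p = x³ - a x`. -/
theorem separable_cubic {K : Type*} [Field K] {a : K} (ha : a ≠ 0) (h2 : (2 : K) ≠ 0) :
    (X ^ 3 - C a * X : K[X]).Separable := by
  refine ⟨C (-9 * (2 * a ^ 2)⁻¹) * X, C (-a⁻¹) + C (3 * (2 * a ^ 2)⁻¹) * X ^ 2, ?_⟩
  have e1 : C (-9 * (2 * a ^ 2)⁻¹) = -9 * C ((2 * a ^ 2)⁻¹) := by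
    rw [C_mul, C_neg]; rfl
  have e2 : C (3 * (2 * a ^ 2)⁻¹) = 3 * C ((2 * a ^ 2)⁻¹) := by
    rw [C_mul]; rfl
  have e3 : C ((2 * a ^ 2)⁻¹) * (2 * C a ^ 2) = 1 := by
    rw [← C_pow, show (2 : K[X]) = C 2 from rfl, ← C_mul, ← C_mul,
      inv_mul_cancel₀ (mul_ne_zero h2 (pow_ne_zero 2 ha)), C_1]
  have e4 : C (a⁻¹) * C a = 1 := by rw [← C_mul, inv_mul_cancel₀ ha, C_1]
  have e5 : 2 * C ((2 * a ^ 2)⁻¹) * C a = C (a⁻¹) := by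
    linear_combination C a⁻¹ * e3 - 2 * C ((2 * a ^ 2)⁻¹) * C a * e4
  rw [e1, e2]
  simp only [derivative_sub, derivative_X_pow, derivative_C_mul, derivative_X, map_neg, mul_one,
    Nat.cast_ofNat]
  rw [show (C (3 : K)) = 3 from rfl]
  linear_combination (3 * X ^ 2) * e5 + e4

/-- For `P = x⁴ + x²` the semisimple part is `-f³`. -/
theorem minpoly_cube_of_quartic (hf : (minpoly ℝ f).natDegree = 4) (h : f ^ 4 = -f ^ 2) :
    minpoly ℝ (-f ^ 3) = X ^ 3 + X := by
  have h6 : f ^ 6 = f ^ 2 := by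
    rw [show f ^ 6 = f ^ 4 * f ^ 2 by rw [← pow_add], h, neg_mul, ← pow_add, h, neg_neg]
  have h9 : f ^ 9 = -f ^ 3 := by
    rw [show f ^ 9 = f ^ 6 * f ^ 3 by rw [← pow_add], h6, ← pow_add,
      show f ^ (2 + 3) = f ^ 4 * f by rw [← pow_succ], h, neg_mul, ← pow_succ]
  have hdeg : (X ^ 3 + X : ℝ[X]).natDegree = 3 := by compute_degree!
  have hm : (X ^ 3 + X : ℝ[X]).Monic := by monicity!
  refine (minpoly.unique' ℝ _ hm ?_ fun q hq => ?_).symm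
  · rw [map_add, map_pow, aeval_X, neg_pow, ← pow_mul, h9]
    noncomm_ring
  · rw [or_iff_not_imp_right, not_not]
    intro h0
    have hq2 : q.degree ≤ 2 := by
      rw [degree_eq_natDegree hm.ne_zero, hdeg] at hq
      exact Order.le_of_lt_succ hq
    rw [eq_quadratic_of_degree_le_two hq2] at h0 ⊢
    obtain ⟨e0, e2, e1⟩ : q.coeff 0 = 0 ∧ q.coeff 2 = 0 ∧ -q.coeff 1 = 0 := by
      have := coeffs_eq_zero_of_cubic hf (c₀ := q.coeff 0) (c₁ := 0) (c₂ := q.coeff 2)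
        (c₃ := -q.coeff 1) (by
          rw [map_add, map_add, map_mul, map_mul, aeval_C, aeval_C, aeval_C, map_pow, aeval_X,
            neg_sq, ← pow_mul, h6, ← Algebra.smul_def, ← Algebra.smul_def,
            Algebra.algebraMap_eq_smul_one] at h0
          rw [← h0, zero_smul, neg_smul, smul_neg]
          abel)
      exact ⟨this.1, this.2.2.1, this.2.2.2⟩
    rw [neg_eq_zero] at e1
    rw [e0, e1, e2, C_0, zero_mul, zero_mul, add_zero, add_zero]

/-- For `P = x⁴ + x²` the nilpotent part is `f + f³`. -/
theorem minpoly_nilpotent_of_quartic (hf : (minpoly ℝ f).natDegree = 4)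
    (h : f ^ 4 = -f ^ 2) : minpoly ℝ (f + f ^ 3) = X ^ 2 := by
  have hm : (X ^ 2 : ℝ[X]).Monic := monic_X_pow 2
  refine (minpoly.unique' ℝ _ hm ?_ fun q hq => ?_).symm
  · have := sub_inv_smul_cube_sq (f := f) (a := -1) (by norm_num) (by rw [h, neg_one_smul])
    rw [map_pow, aeval_X, ← this]
    norm_num
  · rw [or_iff_not_imp_right, not_not]
    intro h0
    have hq1 : q.degree ≤ 1 := by
      rw [degree_X_pow] at hq
      exact Order.le_of_lt_succ hq
    rw [eq_X_add_C_of_degree_le_one hq1] at h0 ⊢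
    obtain ⟨e0, e1, -, -⟩ := coeffs_eq_zero_of_cubic hf (c₀ := q.coeff 0) (c₁ := q.coeff 1)
      (c₂ := 0) (c₃ := q.coeff 1) (by
        rw [map_add, map_mul, aeval_C, aeval_C, aeval_X, ← Algebra.smul_def,
            Algebra.algebraMap_eq_smul_one] at h0
        rw [← h0, zero_smul, smul_add]
        abel)
    rw [e0, e1, C_0, zero_mul, add_zero]

theorem minpoly_add_of_cubic (hs : minpoly ℝ s = X ^ 3 + X) (ht : minpoly ℝ t = X ^ 2)
    (hst : s * t = 0) (hts : t * s = 0) : minpoly ℝ (t + s) = X ^ 2 * (X ^ 2 + 1) := by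
  have hs3 : s ^ 3 = -s := by
    have := minpoly.aeval ℝ s
    rw [hs, map_add, map_pow, aeval_X] at this
    exact eq_neg_of_add_eq_zero_left this
  have ht2 : t * t = 0 := by
    have := minpoly.aeval ℝ t
    rwa [ht, map_pow, aeval_X, pow_two] at this
  have hs4 : s ^ 4 = -s ^ 2 := by rw [pow_succ, hs3, neg_mul, ← pow_two]
  have f2 : (t + s) ^ 2 = s ^ 2 := by
    rw [pow_two, add_mul, mul_add, mul_add, hst, hts, ht2, zero_add, zero_add, zero_add, ← pow_two]
  have f3 : (t + s) ^ 3 = -s := by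
    rw [pow_succ, f2, mul_add, pow_two, mul_assoc, hst, mul_zero, zero_add, ← pow_two, ← pow_succ,
      hs3]
  have f4 : (t + s) ^ 4 = -s ^ 2 := by
    rw [show (t + s) ^ 4 = (t + s) ^ 2 * (t + s) ^ 2 by rw [← pow_add], f2, ← pow_add, hs4]
  have t0 : t ≠ 0 := by
    rintro rfl
    have h := minpoly.degree_le_of_ne_zero ℝ (0 : A) X_ne_zero (aeval_X 0)
    rw [ht, degree_X_pow, degree_X] at h
    exact absurd h (by decide)
  have sindep {c₂ c₁ : ℝ} (h : c₂ • s ^ 2 + c₁ • s = 0) : c₁ = 0 ∧ c₂ = 0 := by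
    have hQ : C c₂ * X ^ 2 + C c₁ * X + C 0 = 0 := by
      by_contra hne
      have h1 := minpoly.degree_le_of_ne_zero ℝ s hne (by
        simpa [Algebra.smul_def] using h)
      have h2 : natDegree (C c₂ * X ^ 2 + C c₁ * X + C 0) ≤ 2 := natDegree_quadratic_le
      have h3 := natDegree_le_natDegree h1
      rw [hs, show (X ^ 3 + X : ℝ[X]).natDegree = 3 by compute_degree!] at h3
      omega
    have h1 := congrArg (fun Q => coeff Q 1) hQ
    have h2 := congrArg (fun Q => coeff Q 2) hQ
    simp [coeff_C] at h1 h2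
    exact ⟨h1, h2⟩
  have hdeg : (X ^ 2 * (X ^ 2 + 1) : ℝ[X]).natDegree = 4 := by
    rw [show (X ^ 2 * (X ^ 2 + 1) : ℝ[X]) = X ^ 4 + X ^ 2 by ring]
    compute_degree!
  have hm : (X ^ 2 * (X ^ 2 + 1) : ℝ[X]).Monic := by
    rw [show (X ^ 2 * (X ^ 2 + 1) : ℝ[X]) = X ^ 4 + X ^ 2 by ring]
    monicity!
  refine (minpoly.unique' ℝ _ hm ?_ fun q hq => ?_).symm
  · rw [show (X ^ 2 * (X ^ 2 + 1) : ℝ[X]) = X ^ 4 + X ^ 2 by ring, map_add, map_pow, map_pow,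
      aeval_X, f4, f2, neg_add_cancel]
  · rw [or_iff_not_imp_right, not_not]
    intro h0
    have hq3 : q.natDegree < 4 := by
      rcases eq_or_ne q 0 with rfl | hq0
      · simp
      · rw [← hdeg]
        exact natDegree_lt_natDegree hq0 hq
    have hq' := q.as_sum_range_C_mul_X_pow' hq3
    simp only [Finset.sum_range_succ, Finset.sum_range_zero, zero_add, pow_zero, mul_one,
      pow_one] at hq'
    generalize q.coeff 0 = c₀ at hq'
    generalize q.coeff 1 = c₁ at hq'
    generalize q.coeff 2 = c₂ at hq'
    generalize q.coeff 3 = c₃ at hq'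
    rw [hq'] at h0 ⊢
    simp only [map_add, map_mul, map_pow, aeval_X, aeval_C, f2, f3,
      Algebra.algebraMap_eq_smul_one, smul_mul_assoc, one_mul] at h0
    -- multiplication by `t` isolates the constant coefficient
    have e0 : c₀ = 0 := by
      have h := congrArg (t * ·) h0
      simp only [mul_add, mul_smul_comm, mul_one, ht2, hts, smul_zero, add_zero, pow_two,
        ← mul_assoc, zero_mul, mul_neg, neg_zero, mul_zero] at h
      exact (smul_eq_zero.1 h).resolve_right t0
    subst e0
    -- multiplication by `s` removes `t`
    have h := congrArg (s * ·) h0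
    simp only [mul_add, mul_smul_comm, hst, mul_zero, zero_smul, zero_add, mul_neg,
      ← pow_succ', ← pow_two, Nat.reduceAdd, hs3] at h
    obtain ⟨e2, e13⟩ := sindep (c₂ := c₁ - c₃) (c₁ := -c₂) (by
      rw [← h, sub_smul, neg_smul, smul_neg, smul_neg]; abel)
    rw [neg_eq_zero] at e2
    rw [sub_eq_zero] at e13
    subst e2 e13
    have e1 : c₁ • t = 0 := by
      rw [← h0, zero_smul, zero_smul, smul_add, smul_neg]; abel
    rw [(smul_eq_zero.1 e1).resolve_right t0]
    simp

end minimalPolynomials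

/-! ### Complexification and eigenvalues -/

section complexification
open Polynomial

variable {V : Type*} [AddCommGroup V] [Module ℝ V]

/-- The real part of a vector in the complexification. -/
def rePart : ℂ ⊗[ℝ] V →ₗ[ℝ] V := (TensorProduct.lid ℝ V).toLinearMap ∘ₗ Complex.reLm.rTensor V

/-- The imaginary part of a vector in the complexification. -/
def imPart : ℂ ⊗[ℝ] V →ₗ[ℝ] V := (TensorProduct.lid ℝ V).toLinearMap ∘ₗ Complex.imLm.rTensor V

@[simp] theorem rePart_tmul (z : ℂ) (x : V) : rePart (z ⊗ₜ[ℝ] x) = z.re • x := by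
  simp [rePart]

@[simp] theorem imPart_tmul (z : ℂ) (x : V) : imPart (z ⊗ₜ[ℝ] x) = z.im • x := by
  simp [imPart]

theorem complexification_ext {x y x' y' : V} :
    (1 : ℂ) ⊗ₜ[ℝ] x + Complex.I ⊗ₜ[ℝ] y = (1 : ℂ) ⊗ₜ[ℝ] x' + Complex.I ⊗ₜ[ℝ] y' ↔
      x = x' ∧ y = y' := by
  constructor
  · intro h
    exact ⟨by simpa using congrArg rePart h, by simpa using congrArg imPart h⟩
  · rintro ⟨rfl, rfl⟩
    rfl

theorem baseChange_cplx (f : Module.End ℝ V) (x y : V) :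
    (f.baseChange ℂ) ((1 : ℂ) ⊗ₜ[ℝ] x + Complex.I ⊗ₜ[ℝ] y) =
      (1 : ℂ) ⊗ₜ[ℝ] f x + Complex.I ⊗ₜ[ℝ] f y := by
  rw [map_add, LinearMap.baseChange_tmul, LinearMap.baseChange_tmul]

theorem aeval_baseChange (f : Module.End ℝ V) (P : ℝ[X]) :
    aeval (f.baseChange ℂ : Module.End ℂ (ℂ ⊗[ℝ] V)) (P.map (algebraMap ℝ ℂ)) =
      (aeval f P).baseChange ℂ := by
  rw [aeval_map_algebraMap]
  exact aeval_algHom_apply (Module.End.baseChangeHom ℝ ℂ V) f P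

/-- The real part of a complex polynomial in the complexification of `f` is a real polynomial
in `f`. -/
theorem rePart_aeval_baseChange (f : Module.End ℝ V) (Q : ℂ[X]) (x : V) :
    rePart (aeval (f.baseChange ℂ : Module.End ℂ (ℂ ⊗[ℝ] V)) Q ((1 : ℂ) ⊗ₜ[ℝ] x)) =
      aeval f (∑ k ∈ Finset.range (Q.natDegree + 1), C (Q.coeff k).re * X ^ k) x := by
  have hpow (k : ℕ) : ((f.baseChange ℂ : Module.End ℂ (ℂ ⊗[ℝ] V)) ^ k) ((1 : ℂ) ⊗ₜ[ℝ] x) =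
      (1 : ℂ) ⊗ₜ[ℝ] (f ^ k) x := by
    induction k with
    | zero => rfl
    | succ k ih => rw [pow_succ', pow_succ', Module.End.mul_apply, ih]; rfl
  conv_lhs => rw [Q.as_sum_range_C_mul_X_pow]
  simp only [map_sum, LinearMap.sum_apply, map_mul, aeval_C, map_pow, aeval_X,
    ← Algebra.smul_def, LinearMap.smul_apply, hpow, TensorProduct.smul_tmul', smul_eq_mul, mul_one,
    rePart_tmul]

theorem minpoly_baseChange [FiniteDimensional ℝ V] (f : Module.End ℝ V) :
    minpoly ℂ (f.baseChange ℂ : Module.End ℂ (ℂ ⊗[ℝ] V)) =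
      (minpoly ℝ f).map (algebraMap ℝ ℂ) := by
  have hi : IsIntegral ℝ f := Algebra.IsIntegral.isIntegral f
  have h0 : aeval (f.baseChange ℂ : Module.End ℂ (ℂ ⊗[ℝ] V))
      ((minpoly ℝ f).map (algebraMap ℝ ℂ)) = 0 := by
    rw [aeval_baseChange, minpoly.aeval, LinearMap.baseChange_zero]
  refine (minpoly.unique ℂ _ ((minpoly.monic hi).map _) h0 fun Q hQ hQ0 => ?_).symm
  rw [degree_map]
  set R : ℝ[X] := ∑ k ∈ Finset.range (Q.natDegree + 1), C (Q.coeff k).re * X ^ k with hR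
  have hR0 : aeval f R = 0 := LinearMap.ext fun x => by
    rw [← rePart_aeval_baseChange, hQ0]
    simp
  have hc : R.coeff Q.natDegree = 1 := by
    simp [hR, coeff_C_mul, coeff_X_pow, hQ.coeff_natDegree]
  have hd : R.degree ≤ Q.natDegree := by
    refine (degree_sum_le _ _).trans (Finset.sup_le fun k hk => ?_)
    refine (degree_C_mul_X_pow_le k _).trans ?_
    exact_mod_cast Nat.lt_succ_iff.1 (Finset.mem_range.1 hk)
  have hne : R ≠ 0 := fun h => by simp [h] at hc
  rw [degree_eq_natDegree hQ.ne_zero]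
  exact (minpoly.degree_le_of_ne_zero ℝ f hne hR0).trans hd

/-- An even quartic with exactly three complex roots has the form `x⁴ - a x²` with `a ≠ 0`: its
set of roots is stable under `x ↦ -x`, so that `0` is a root. -/
theorem ne_zero_of_ncard_roots {b c : ℝ} (h : {z : ℂ | z ^ 4 + b * z ^ 2 + c = 0}.ncard = 3) :
    c = 0 ∧ b ≠ 0 := by
  obtain ⟨x, y, z, hxy, hxz, hyz, hS⟩ := Set.ncard_eq_three.1 h
  have hmem (w : ℂ) : w ^ 4 + b * w ^ 2 + c = 0 ↔ w = x ∨ w = y ∨ w = z := by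
    simpa using Set.ext_iff.1 hS w
  have hneg {w : ℂ} (hw : w = x ∨ w = y ∨ w = z) : -w = x ∨ -w = y ∨ -w = z := by
    rw [← hmem] at hw ⊢
    rw [← hw]
    ring
  have hself {w : ℂ} (hw : -w = w) : w = 0 := by
    linear_combination (-1 / 2 : ℂ) * hw
  have h0 : (0 : ℂ) = x ∨ 0 = y ∨ 0 = z := by
    have hx := hneg (Or.inl rfl : x = x ∨ x = y ∨ x = z)
    have hy := hneg (Or.inr (Or.inl rfl) : y = x ∨ y = y ∨ y = z)
    have hz := hneg (Or.inr (Or.inr rfl) : z = x ∨ z = y ∨ z = z)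
    by_contra! hne
    have nx : -x ≠ x := fun e => hne.1 (hself e).symm
    have ny : -y ≠ y := fun e => hne.2.1 (hself e).symm
    have nz : -z ≠ z := fun e => hne.2.2 (hself e).symm
    grind
  have hc : c = 0 := by
    have := (hmem 0).2 h0
    simpa using this
  refine ⟨hc, fun hb => hxy ?_⟩
  have hx := (hmem x).2 (Or.inl rfl)
  have hy := (hmem y).2 (Or.inr (Or.inl rfl))
  rw [hc, hb] at hx hy
  have ex : x = 0 := by simpa using hx
  have ey : y = 0 := by simpa using hy
  rw [ex, ey]

end complexification

section eigenvalues
open Polynomial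

variable {n : ℕ} {M : Type u} [TopologicalSpace M] [ChartedSpace (Model n) M]
  [IsManifold (𝓡 n) ∞ M] [T2Space M]

theorem eq_zero_of_pair (p : M) {x : GT n p} (h : ∀ y, pair y x = 0) : x = 0 := by
  obtain ⟨u, w, huw⟩ := exists_frame (n := n) p
  exact huw.self_of_nhds.eq_zero fun a => h _

theorem pair_skew_right {φ : EndoField n M} (hφ : IsSkewEndo φ) (p : M) (a b : GT n p) :
    pair (φ p a) b = -pair a (φ p b) := eq_neg_of_add_eq_zero_left (pair_skew hφ p a b)

/-- A skew-symmetric endomorphism whose minimal polynomial is a quartic with three distinct complex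
roots has minimal polynomial `x⁴ - a x²`. Skew-symmetry forces the polynomial to be even. -/
theorem eq_quartic_of_threeEigenvalues {φ : EndoField n M} {P : ℝ[X]} (hP : IsGPS φ P)
    (h4 : P.natDegree = 4) (h3 : HasThreeEigenvalues φ) (p : M) :
    ∃ a : ℝ, a ≠ 0 ∧ P = X ^ 4 - C a * X ^ 2 := by
  have hmin := hP.minpoly_eq p
  have hP0 : aeval (φ p) P = 0 := hmin ▸ minpoly.aeval ℝ (φ p)
  have hexp : P = C (P.coeff 0) + C (P.coeff 1) * X + C (P.coeff 2) * X ^ 2 +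
      C (P.coeff 3) * X ^ 3 + X ^ 4 := by
    have h := P.as_sum_range_C_mul_X_pow
    have h1 : P.coeff 4 = 1 := h4 ▸ hP.monic.coeff_natDegree
    rw [h4] at h
    simpa [Finset.sum_range_succ, h1] using h
  obtain ⟨c₀, c₁, c₂, c₃, hc⟩ : ∃ c₀ c₁ c₂ c₃ : ℝ, P = C c₀ + C c₁ * X + C c₂ * X ^ 2 +
      C c₃ * X ^ 3 + X ^ 4 := ⟨_, _, _, _, hexp⟩
  have hev (x : GT n p) : c₀ • x + c₁ • φ p x + c₂ • φ p (φ p x) + c₃ • φ p (φ p (φ p x)) +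
      φ p (φ p (φ p (φ p x))) = 0 := by
    have := LinearMap.congr_fun hP0 x
    rw [hc] at this
    simpa [pow_succ, Module.algebraMap_end_apply] using this
  have hodd (x : GT n p) : c₃ • φ p (φ p (φ p x)) + c₁ • φ p x = 0 := by
    have hsk := pair_skew_right hP.skewEndo p
    have hx := hev x
    have : c₀ • x - c₁ • φ p x + c₂ • φ p (φ p x) - c₃ • φ p (φ p (φ p x)) +
        φ p (φ p (φ p (φ p x))) = 0 := by
      refine eq_zero_of_pair p fun y => ?_
      have hy := congrArg (fun z => pair z x) (hev y)
      simp only [map_add, map_smul, LinearMap.add_apply, LinearMap.smul_apply, hsk, map_zero,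
        LinearMap.zero_apply, smul_eq_mul] at hy
      simp only [map_add, map_sub, map_smul, smul_eq_mul]
      linarith
    have h2 : (2 : ℝ) • (c₃ • φ p (φ p (φ p x)) + c₁ • φ p x) = 0 := by
      rw [two_smul]
      exact Eq.trans (by abel) (sub_eq_zero.2 (hx.trans this.symm))
    exact (smul_eq_zero.1 h2).resolve_left two_ne_zero
  obtain ⟨-, e1, -, e3⟩ := coeffs_eq_zero_of_cubic (f := φ p) (hmin ▸ h4) (c₀ := 0) (c₁ := c₁)
    (c₂ := 0) (c₃ := c₃) (by
      refine LinearMap.ext fun x => ?_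
      simpa [pow_succ] using hodd x)
  subst e1 e3
  have hS := h3 p
  have hroots : {μ : ℂ | Module.End.HasEigenvalue
      ((φ p).baseChange ℂ : Module.End ℂ (ℂ ⊗[ℝ] GT n p)) μ} =
      {z : ℂ | z ^ 4 + c₂ * z ^ 2 + c₀ = 0} := by
    ext μ
    rw [Set.mem_ofPred_eq, Set.mem_ofPred_eq, Module.End.hasEigenvalue_iff_isRoot,
      minpoly_baseChange, hmin, hc]
    simp only [IsRoot.def, Polynomial.map_add, Polynomial.map_mul, Polynomial.map_pow, map_C,
      map_X, eval_add, eval_mul, eval_pow, eval_C, eval_X, map_zero, zero_mul, add_zero,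
      Complex.coe_algebraMap]
    exact Eq.congr (by ring) rfl
  rw [hroots] at hS
  obtain ⟨rfl, h⟩ := ne_zero_of_ncard_roots hS
  refine ⟨-c₂, neg_ne_zero.2 h, ?_⟩
  rw [hc]
  simp only [C_0, C_neg]
  ring

end eigenvalues

/-! ### Strong integrability -/

section fstructure
open Polynomial

variable {V : Type*} [AddCommGroup V] [Module ℝ V]

theorem imaginary_smul_cplx {ε : ℝ} {μ : ℂ} (hμ : μ = ε * Complex.I) (x y : V) :
    μ • ((1 : ℂ) ⊗ₜ[ℝ] x + Complex.I ⊗ₜ[ℝ] y) =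
      (1 : ℂ) ⊗ₜ[ℝ] (-(ε • y)) + Complex.I ⊗ₜ[ℝ] (ε • x) := by
  rw [smul_add, TensorProduct.smul_tmul', TensorProduct.smul_tmul', ← neg_smul,
    ← TensorProduct.smul_tmul, ← TensorProduct.smul_tmul, add_comm]
  congr 2
  · rw [hμ, smul_eq_mul, mul_assoc, Complex.I_mul_I]
    simp
  · rw [hμ]
    simp

/-- The generalized eigenspaces of an endomorphism with `f³ = -f` are eigenspaces. -/
theorem mem_maxGenEigenspace_iff [FiniteDimensional ℝ V] {f : Module.End ℝ V} (hf : f ^ 3 = -f)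
    (μ : ℂ) (v : ℂ ⊗[ℝ] V) :
    v ∈ Module.End.maxGenEigenspace (f.baseChange ℂ : Module.End ℂ (ℂ ⊗[ℝ] V)) μ ↔
      f.baseChange ℂ v = μ • v := by
  have hs : Module.End.IsSemisimple (f.baseChange ℂ : Module.End ℂ (ℂ ⊗[ℝ] V)) := by
    refine Module.End.isSemisimple_of_squarefree_aeval_eq_zero
      (separable_cubic (a := (-1 : ℂ)) (by norm_num) two_ne_zero).squarefree ?_
    have h := aeval_baseChange f (X ^ 3 - C (-1) * X)
    have h0 : aeval f (X ^ 3 - C (-1) * X : ℝ[X]) = 0 := by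
      simp [hf]
    rw [h0, LinearMap.baseChange_zero] at h
    simpa using h
  rw [hs.isFinitelySemisimple.maxGenEigenspace_eq_eigenspace, Module.End.mem_eigenspace_iff]

theorem cplx_mem_maxGenEigenspace_iff [FiniteDimensional ℝ V] {f : Module.End ℝ V}
    (hf : f ^ 3 = -f) {ε : ℝ} {μ : ℂ} (hμ : μ = ε * Complex.I) (x y : V) :
    (1 : ℂ) ⊗ₜ[ℝ] x + Complex.I ⊗ₜ[ℝ] y ∈
        Module.End.maxGenEigenspace (f.baseChange ℂ : Module.End ℂ (ℂ ⊗[ℝ] V)) μ ↔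
      f x = -(ε • y) ∧ f y = ε • x := by
  rw [mem_maxGenEigenspace_iff hf, baseChange_cplx, imaginary_smul_cplx hμ, complexification_ext]

/-- Membership in the sum of the kernel and the `±i`-eigenspace amounts to `f² v = ± i f v`. -/
theorem cplx_mem_sup_maxGenEigenspace_iff [FiniteDimensional ℝ V] {f : Module.End ℝ V}
    (hf : f ^ 3 = -f) {ε : ℝ} (hε : ε * ε = 1) {μ : ℂ} (hμ : μ = ε * Complex.I) (x y : V) :
    (1 : ℂ) ⊗ₜ[ℝ] x + Complex.I ⊗ₜ[ℝ] y ∈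
        Module.End.maxGenEigenspace (f.baseChange ℂ : Module.End ℂ (ℂ ⊗[ℝ] V)) 0 ⊔
        Module.End.maxGenEigenspace (f.baseChange ℂ : Module.End ℂ (ℂ ⊗[ℝ] V)) μ ↔
      f (f x) = -(ε • f y) := by
  have hf3 (v : V) : f (f (f v)) = -f v := LinearMap.congr_fun hf v
  set g : Module.End ℂ (ℂ ⊗[ℝ] V) := f.baseChange ℂ with hg
  set v : ℂ ⊗[ℝ] V := (1 : ℂ) ⊗ₜ[ℝ] x + Complex.I ⊗ₜ[ℝ] y with hv
  have hgv : g v = (1 : ℂ) ⊗ₜ[ℝ] f x + Complex.I ⊗ₜ[ℝ] f y := baseChange_cplx f x y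
  have hggv : g (g v) = (1 : ℂ) ⊗ₜ[ℝ] f (f x) + Complex.I ⊗ₜ[ℝ] f (f y) := by
    rw [hgv]; exact baseChange_cplx f _ _
  have hgggv : g (g (g v)) = -g v := by
    rw [hggv, hgv, hg, baseChange_cplx, hf3, hf3, TensorProduct.tmul_neg, TensorProduct.tmul_neg]
    abel
  constructor
  · intro h
    obtain ⟨v₀, h₀, v₁, h₁, h01⟩ := Submodule.mem_sup.1 h
    rw [mem_maxGenEigenspace_iff hf, ← hg] at h₀ h₁
    rw [zero_smul] at h₀
    have e : g v = μ • v₁ := by rw [← h01, map_add, h₀, h₁, zero_add]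
    have e2 : g (g v) = μ • g v := by rw [e, map_smul, h₁]
    rw [hggv, hgv, imaginary_smul_cplx hμ, complexification_ext] at e2
    exact e2.1
  · intro h
    have h' : f (f y) = ε • f x := by
      have := congrArg f h
      rw [hf3, map_neg, map_smul, neg_inj] at this
      rw [this, smul_smul, hε, one_smul]
    have e2 : g (g v) = μ • g v := by
      rw [hggv, hgv, imaginary_smul_cplx hμ, h, h']
    refine Submodule.mem_sup.2 ⟨v + g (g v), ?_, -g (g v), ?_, by abel⟩
    · rw [mem_maxGenEigenspace_iff hf, ← hg, zero_smul, map_add, hgggv, add_neg_cancel]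
    · rw [mem_maxGenEigenspace_iff hf, ← hg, map_neg, hgggv, neg_neg, smul_neg, e2, smul_smul,
        hμ, show (ε : ℂ) * Complex.I * (ε * Complex.I) = -((ε * ε : ℝ) : ℂ) by
          push_cast; linear_combination (ε : ℂ) ^ 2 * Complex.I_mul_I, hε]
      simp

end fstructure

section bilinearF
variable {W : Type*} [AddCommGroup W] [Module ℝ W] (b : Bil W) {J : Module.End ℝ W} {ε : ℝ}

/-- Involutivity of the `±i`-eigenspaces of `J`, expressed on the real image of `J`. -/
theorem involutive_iff (hε : ε = 1 ∨ ε = -1) :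
    (∀ x₁ x₂ y₁ y₂, J x₁ = -(ε • x₂) ∧ J x₂ = ε • x₁ → J y₁ = -(ε • y₂) ∧ J y₂ = ε • y₁ →
      J (b x₁ y₁ - b x₂ y₂) = -(ε • (b x₁ y₂ + b x₂ y₁)) ∧
      J (b x₁ y₂ + b x₂ y₁) = ε • (b x₁ y₁ - b x₂ y₂)) ↔
    ∀ x y, J (J x) = -x → J (J y) = -y → J (b x y - b (J x) (J y)) = b (J x) y + b x (J y) := by
  have hεε : ε * ε = 1 := by rcases hε with rfl | rfl <;> norm_num
  constructor
  · intro h x y hx hy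
    have := (h x (-(ε • J x)) y (-(ε • J y)) (by simp [hx, smul_smul, hεε])
      (by simp [hy, smul_smul, hεε])).1
    simp only [map_neg, map_smul, LinearMap.neg_apply, LinearMap.smul_apply, smul_neg, neg_neg,
      smul_add, smul_smul, hεε, one_smul, neg_add] at this
    rw [this, add_comm]
  · rintro h x₁ x₂ y₁ y₂ ⟨hx, hx'⟩ ⟨hy, hy'⟩
    have ex : x₂ = -(ε • J x₁) := by rw [hx, smul_neg, neg_neg, smul_smul, hεε, one_smul]
    have ey : y₂ = -(ε • J y₁) := by rw [hy, smul_neg, neg_neg, smul_smul, hεε, one_smul]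
    have jx : J (J x₁) = -x₁ := by rw [hx, map_neg, map_smul, hx', smul_smul, hεε, one_smul]
    have jy : J (J y₁) = -y₁ := by rw [hy, map_neg, map_smul, hy', smul_smul, hεε, one_smul]
    have h1 := h x₁ y₁ jx jy
    -- the second equation is the first one for the sections `J x₁` and `y₁`
    have h2 := h (J x₁) y₁ (by rw [jx, map_neg]) jy
    rw [jx, map_neg, LinearMap.neg_apply, LinearMap.neg_apply, sub_neg_eq_add] at h2
    subst ex ey
    simp only [map_neg, map_smul, LinearMap.neg_apply, LinearMap.smul_apply, smul_neg, neg_neg,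
      smul_smul, hεε, one_smul]
    constructor
    · rw [h1]
      simp only [smul_add, smul_neg, smul_smul, hεε, one_smul]
      abel
    · rw [← neg_add, ← smul_add, map_neg, map_smul, add_comm (b x₁ (J y₁)), h2, ← smul_neg]
      congr 1
      abel

/-- The bracket condition between the kernel of `J` and its `±i`-eigenspaces, expressed on the
kernel and the real image of `J`. -/
theorem kernel_bracket_iff (hε : ε = 1 ∨ ε = -1) :
    (∀ x₁ x₂ y₁ y₂, J x₁ = 0 ∧ J x₂ = 0 → J y₁ = -(ε • y₂) ∧ J y₂ = ε • y₁ →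
      J (J (b x₁ y₁ - b x₂ y₂)) = -(ε • J (b x₁ y₂ + b x₂ y₁))) ↔
    ∀ x y, J x = 0 → J (J y) = -y → J (J (b x y)) = J (b x (J y)) := by
  have hεε : ε * ε = 1 := by rcases hε with rfl | rfl <;> norm_num
  constructor
  · intro h x y hx hy
    have := h x 0 y (-(ε • J y)) ⟨hx, map_zero J⟩ (by simp [hy, smul_smul, hεε])
    simpa [smul_smul, hεε] using this
  · rintro h x₁ x₂ y₁ y₂ ⟨hx, hx'⟩ ⟨hy, hy'⟩
    have ey : y₂ = -(ε • J y₁) := by rw [hy, smul_neg, neg_neg, smul_smul, hεε, one_smul]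
    have jy : J (J y₁) = -y₁ := by rw [hy, map_neg, map_smul, hy', smul_smul, hεε, one_smul]
    have h1 := h x₁ y₁ hx jy
    have h2 := h x₂ (J y₁) hx' (by rw [jy, map_neg])
    rw [jy, map_neg, map_neg] at h2
    subst ey
    simp only [map_sub, map_add, map_neg, map_smul, smul_neg, h1, h2, neg_neg,
      smul_smul, hεε, one_smul, smul_add, neg_add]
    abel

end bilinearF

section integrability

variable {n : ℕ} {M : Type u} [TopologicalSpace M] [ChartedSpace (Model n) M]
  [IsManifold (𝓡 n) ∞ M] [T2Space M]

/-- The Dorfman bracket of orthogonal sections is skew-symmetric. -/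
theorem bracket_skew {x y : Sections n M} (h : ∀ p, pair (x.1 p) (y.1 p) = 0) :
    bracket n M x y = -bracket n M y x := by
  have hxy : cliffL x * cliffL y + cliffL y * cliffL x = 0 := by
    refine LinearMap.ext fun η => forms_ext fun p => ?_
    refine (cliff_anticomm x y η p).trans ?_
    rw [h, zero_smul, LinearMap.zero_apply, map_zero]
  rw [← add_eq_zero_iff_eq_neg]
  refine cliffL_injective ?_
  rw [map_add, map_zero]
  change cliffL (dorfmanSec x y) + cliffL (dorfmanSec y x) = 0
  rw [cliffL_dorfmanSec, cliffL_dorfmanSec]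
  have : derivedBracket (deRham n M) (cliffL x) (cliffL y) +
      derivedBracket (deRham n M) (cliffL y) (cliffL x) =
      deRham n M * (cliffL x * cliffL y + cliffL y * cliffL x) -
        (cliffL x * cliffL y + cliffL y * cliffL x) * deRham n M := by
    unfold derivedBracket
    noncomm_ring
  rw [this, hxy, mul_zero, zero_mul, sub_zero]

theorem sections_ext {x y : Sections n M} : x = y ↔ ∀ p, x.1 p = y.1 p :=
  ⟨fun h _ => h ▸ rfl, fun h => Subtype.ext (funext h)⟩

theorem cplx_mem_eigenbundle_iff {J : EndoField n M}
    (hJ : ∀ x ∈ genSections n M, J.act x ∈ genSections n M) (hJ3 : ∀ p, J p ^ 3 = -J p) {ε : ℝ}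
    {μ : ℂ} (hμ : μ = ε * Complex.I) (x y : Sections n M) :
    (∀ p, cplx x.1 y.1 p ∈ eigenbundle J μ p) ↔
      secEnd J hJ x = -(ε • y) ∧ secEnd J hJ y = ε • x := by
  rw [sections_ext, sections_ext, ← forall_and]
  exact forall_congr' fun p => cplx_mem_maxGenEigenspace_iff (hJ3 p) hμ (x.1 p) (y.1 p)

theorem cplx_mem_sup_eigenbundle_iff {J : EndoField n M}
    (hJ : ∀ x ∈ genSections n M, J.act x ∈ genSections n M) (hJ3 : ∀ p, J p ^ 3 = -J p) {ε : ℝ}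
    (hε : ε * ε = 1) {μ : ℂ} (hμ : μ = ε * Complex.I) (x y : Sections n M) :
    (∀ p, cplx x.1 y.1 p ∈ eigenbundle J 0 p ⊔ eigenbundle J μ p) ↔
      secEnd J hJ (secEnd J hJ x) = -(ε • secEnd J hJ y) := by
  rw [sections_ext]
  exact forall_congr' fun p => cplx_mem_sup_maxGenEigenspace_iff (hJ3 p) hε hμ (x.1 p) (y.1 p)

theorem dorfmanMapsInto_iff (L L' K : ∀ p : M, Submodule ℂ (ℂ ⊗[ℝ] GT n p)) :
    DorfmanMapsInto L L' K ↔ ∀ x₁ x₂ y₁ y₂ : Sections n M,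
      (∀ p, cplx x₁.1 x₂.1 p ∈ L p) → (∀ p, cplx y₁.1 y₂.1 p ∈ L' p) →
        ∀ p, cplx (bracket n M x₁ y₁ - bracket n M x₂ y₂).1
          (bracket n M x₁ y₂ + bracket n M x₂ y₁).1 p ∈ K p :=
  ⟨fun h x₁ x₂ y₁ y₂ => h x₁.1 x₁.2 x₂.1 x₂.2 y₁.1 y₁.2 y₂.1 y₂.2,
    fun h x₁ h₁ x₂ h₂ y₁ k₁ y₂ k₂ => h ⟨x₁, h₁⟩ ⟨x₂, h₂⟩ ⟨y₁, k₁⟩ ⟨y₂, k₂⟩⟩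

/-- Strong integrability of a generalized F-structure is the weak generalized Nijenhuis
condition. -/
theorem isStronglyIntegrable_iff {J : EndoField n M} (hJ : IsSkewEndo J)
    (hJ3 : ∀ p, J p ^ 3 = -J p) : IsStronglyIntegrable J ↔ IsWeakGenNijenhuis J := by
  set j := secEnd J hJ.smooth with hj
  have hj3 : j ^ 3 = -j := LinearMap.ext fun x => sections_ext.2 fun p =>
    LinearMap.congr_fun (hJ3 p) (x.1 p)
  -- the kernel and the image of `J` are orthogonal
  have horth {x y : Sections n M} (hx : j x = 0) (hy : j (j y) = -y) (p : M) :
      pair (y.1 p) (x.1 p) = 0 := by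
    have h1 : J p (x.1 p) = 0 := sections_ext.1 hx p
    have h2 : J p (J p (y.1 p)) = -y.1 p := sections_ext.1 hy p
    rw [← neg_neg (y.1 p), ← h2, map_neg, LinearMap.neg_apply, pair_skew_right hJ, h1, map_zero,
      neg_zero, neg_zero]
  have hσ {ε : ℝ} (hε : ε = 1 ∨ ε = -1) {μ : ℂ} (hμ : μ = ε * Complex.I) :
      (DorfmanMapsInto (eigenbundle J μ) (eigenbundle J μ) (eigenbundle J μ) ∧
        DorfmanMapsInto (eigenbundle J 0) (eigenbundle J μ)
          (fun p => eigenbundle J 0 p ⊔ eigenbundle J μ p)) ↔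
      (∀ x y, j (j x) = -x → j (j y) = -y → j (bracket n M x y - bracket n M (j x) (j y)) =
        bracket n M (j x) y + bracket n M x (j y)) ∧
      (∀ x y, j x = 0 → j (j y) = -y → j (j (bracket n M x y)) = j (bracket n M x (j y))) := by
    have hεε : ε * ε = 1 := by rcases hε with rfl | rfl <;> norm_num
    have h0 (x y : Sections n M) : (∀ p, cplx x.1 y.1 p ∈ eigenbundle J 0 p) ↔
        j x = 0 ∧ j y = 0 := by
      rw [cplx_mem_eigenbundle_iff hJ.smooth hJ3 (ε := 0) (by simp), zero_smul, zero_smul, neg_zero]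
    rw [dorfmanMapsInto_iff, dorfmanMapsInto_iff, ← involutive_iff _ hε, ← kernel_bracket_iff _ hε]
    simp only [cplx_mem_eigenbundle_iff hJ.smooth hJ3 hμ,
      cplx_mem_sup_eigenbundle_iff hJ.smooth hJ3 hεε hμ, h0, ← hj]
  have h1 : (1 : ℝ) = 1 ∨ (1 : ℝ) = -1 := Or.inl rfl
  have h2 : (-1 : ℝ) = 1 ∨ (-1 : ℝ) = -1 := Or.inr rfl
  rw [isWeakGenNijenhuis_iff J hJ.smooth, ← hj, shifted_nij_eq_zero_iff hj3]
  unfold IsStronglyIntegrable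
  constructor
  · intro h
    obtain ⟨hi, hk⟩ := (hσ h1 (by simp)).1 (h Complex.I (Or.inl rfl))
    refine ⟨hi, hk, fun x y hx hy => ?_⟩
    have hjx : j (j (j x)) = -j x := by rw [hx, map_neg]
    rw [bracket_skew (horth hy hx), bracket_skew (horth hy hjx), map_neg, map_neg, map_neg,
      hk y x hy hx]
  · rintro ⟨hi, hk, -⟩ σ (rfl | rfl)
    · exact (hσ h1 (by simp)).2 ⟨hi, hk⟩
    · exact (hσ h2 (by simp)).2 ⟨hi, hk⟩

end integrability

/-! ### Jordan parts of generalized polynomial structures -/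

section quarticParts
open Polynomial

variable {V : Type*} [AddCommGroup V] [Module ℝ V] {a : ℝ} {f : Module.End ℝ V}

/-- The semisimple part of an endomorphism with `f⁴ = a f²`. -/
def quarticSemisimple (a : ℝ) (f : Module.End ℝ V) : Module.End ℝ V := a⁻¹ • f ^ 3

/-- The nilpotent part of an endomorphism with `f⁴ = a f²`. -/
def quarticNilpotent (a : ℝ) (f : Module.End ℝ V) : Module.End ℝ V := f - a⁻¹ • f ^ 3

theorem quarticSemisimple_apply (x : V) : quarticSemisimple a f x = a⁻¹ • f (f (f x)) := rfl

theorem quarticNilpotent_apply (x : V) : quarticNilpotent a f x = f x - a⁻¹ • f (f (f x)) := rfl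

theorem quarticNilpotent_add_quarticSemisimple (a : ℝ) (f : Module.End ℝ V) :
    f = quarticNilpotent a f + quarticSemisimple a f :=
  (sub_add_cancel f (a⁻¹ • f ^ 3)).symm

theorem quarticSemisimple_neg_one : quarticSemisimple (-1) f = -f ^ 3 := by
  rw [quarticSemisimple, inv_neg, inv_one, neg_one_smul]

theorem quarticNilpotent_neg_one : quarticNilpotent (-1) f = f + f ^ 3 := by
  rw [quarticNilpotent, inv_neg, inv_one, neg_one_smul, sub_neg_eq_add]

theorem isSemisimple_of_cube [FiniteDimensional ℝ V] (ha : a ≠ 0) {s : Module.End ℝ V}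
    (hs : s ^ 3 = a • s) : s.IsSemisimple := by
  refine Module.End.isSemisimple_of_squarefree_aeval_eq_zero
    (separable_cubic ha two_ne_zero).squarefree ?_
  rw [map_sub, map_pow, map_mul, aeval_X, aeval_C, hs, ← Algebra.smul_def, sub_self]

theorem pow_four_of_minpoly (h : minpoly ℝ f = X ^ 4 - C a * X ^ 2) : f ^ 4 = a • f ^ 2 := by
  rw [← sub_eq_zero, ← aeval_quartic, ← h, minpoly.aeval]

theorem quarticSemisimple_cube (ha : a ≠ 0) (h : minpoly ℝ f = X ^ 4 - C a * X ^ 2) :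
    quarticSemisimple a f ^ 3 = a • quarticSemisimple a f := inv_smul_cube_pow_three ha (pow_four_of_minpoly h)

theorem quarticNilpotent_sq (ha : a ≠ 0) (h : minpoly ℝ f = X ^ 4 - C a * X ^ 2) :
    quarticNilpotent a f ^ 2 = 0 := sub_inv_smul_cube_sq ha (pow_four_of_minpoly h)

theorem quarticSemisimple_mul_quarticNilpotent (ha : a ≠ 0)
    (h : minpoly ℝ f = X ^ 4 - C a * X ^ 2) : quarticSemisimple a f * quarticNilpotent a f = 0 :=
  inv_smul_cube_mul_sub ha (pow_four_of_minpoly h)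

theorem quarticNilpotent_mul_quarticSemisimple (ha : a ≠ 0)
    (h : minpoly ℝ f = X ^ 4 - C a * X ^ 2) : quarticNilpotent a f * quarticSemisimple a f = 0 :=
  sub_mul_inv_smul_cube ha (pow_four_of_minpoly h)

theorem natDegree_quartic (a : ℝ) : (X ^ 4 - C a * X ^ 2 : ℝ[X]).natDegree = 4 := by
  compute_degree!

theorem quartic_neg_one : (X ^ 2 * (X ^ 2 + 1) : ℝ[X]) = X ^ 4 - C (-1) * X ^ 2 := by
  rw [C_neg, C_1]
  ring

theorem minpoly_quarticSemisimple (h : minpoly ℝ f = X ^ 4 - C (-1) * X ^ 2) :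
    minpoly ℝ (quarticSemisimple (-1) f) = X ^ 3 + X := by
  rw [quarticSemisimple_neg_one]
  exact minpoly_cube_of_quartic (h ▸ natDegree_quartic _)
    (by rw [pow_four_of_minpoly h, neg_one_smul])

theorem minpoly_quarticNilpotent (h : minpoly ℝ f = X ^ 4 - C (-1) * X ^ 2) :
    minpoly ℝ (quarticNilpotent (-1) f) = X ^ 2 := by
  rw [quarticNilpotent_neg_one]
  exact minpoly_nilpotent_of_quartic (h ▸ natDegree_quartic _)
    (by rw [pow_four_of_minpoly h, neg_one_smul])

theorem cube_of_minpoly (h : minpoly ℝ f = X ^ 3 + X) : f ^ 3 = -f := by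
  have h0 := minpoly.aeval ℝ f
  rw [h, map_add, map_pow, aeval_X] at h0
  exact eq_neg_of_add_eq_zero_left h0

theorem cube_eq_smul_of_minpoly (h : minpoly ℝ f = X ^ 3 + X) : f ^ 3 = (-1 : ℝ) • f := by
  rw [cube_of_minpoly h, neg_one_smul]

theorem sq_of_minpoly (h : minpoly ℝ f = X ^ 2) : f ^ 2 = 0 := by
  have h0 := minpoly.aeval ℝ f
  rwa [h, map_pow, aeval_X] at h0

end quarticParts

section skew
variable {V : Type*} [AddCommGroup V] [Module ℝ V] [TopologicalSpace V]
  {f g : Module.End ℝ (V × (V →L[ℝ] ℝ))}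

theorem pair_skew_quarticSemisimple (a : ℝ) (h : ∀ x y, pair (f x) y + pair x (f y) = 0)
    (x y : V × (V →L[ℝ] ℝ)) :
    pair (quarticSemisimple a f x) y + pair x (quarticSemisimple a f y) = 0 := by
  have h1 := h (f (f x)) y
  have h2 := h (f x) (f y)
  have h3 := h x (f (f y))
  rw [quarticSemisimple_apply, quarticSemisimple_apply, map_smul, map_smul, LinearMap.smul_apply,
    ← smul_add, show pair (f (f (f x))) y + pair x (f (f (f y))) = 0 by linarith, smul_zero]

theorem pair_skew_add (hf : ∀ x y, pair (f x) y + pair x (f y) = 0)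
    (hg : ∀ x y, pair (g x) y + pair x (g y) = 0) (x y : V × (V →L[ℝ] ℝ)) :
    pair ((f + g) x) y + pair x ((f + g) y) = 0 := by
  rw [LinearMap.add_apply, LinearMap.add_apply, map_add, map_add, LinearMap.add_apply,
    add_add_add_comm, hf, hg, add_zero]

theorem pair_skew_quarticNilpotent (a : ℝ) (h : ∀ x y, pair (f x) y + pair x (f y) = 0)
    (x y : V × (V →L[ℝ] ℝ)) :
    pair (quarticNilpotent a f x) y + pair x (quarticNilpotent a f y) = 0 := by
  have h1 := h x y
  have h2 := pair_skew_quarticSemisimple a h x y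
  rw [quarticSemisimple_apply, quarticSemisimple_apply] at h2
  rw [quarticNilpotent_apply, quarticNilpotent_apply, map_sub, map_sub, LinearMap.sub_apply]
  linarith

end skew

section jordanParts
open Polynomial

variable {n : ℕ} {M : Type u} [TopologicalSpace M] [ChartedSpace (Model n) M]
  [IsManifold (𝓡 n) ∞ M] [T2Space M] {a : ℝ} {φ : EndoField n M}

/-- Uniqueness of the fibrewise Jordan-Chevalley decomposition. -/
theorem jordanParts_unique (φ : EndoField n M) {s t : EndoField n M} (h : φ = t + s)
    (hts : ∀ p, Commute (t p) (s p)) (ht : ∀ p, IsNilpotent (t p))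
    (hs : ∀ p, (s p).IsSemisimple) : nilpotentPart φ = t ∧ semisimplePart φ = s := by
  have key (p : M) := Module.End.isNilpotent_isSemisimple_unique (isNilpotent_nilpotentPart φ p)
    (isSemisimple_semisimplePart φ p) (ht p) (hs p) (commute_nilpotentPart_semisimplePart φ p)
    (hts p) (congrFun ((eq_nilpotentPart_add_semisimplePart φ).symm.trans h) p)
  exact ⟨funext fun p => (key p).1, funext fun p => (key p).2⟩

theorem isSkewEndo_of_pair (hφ : ∀ x ∈ genSections n M, φ.act x ∈ genSections n M)
    (h : ∀ p x y, pair (φ p x) y + pair x (φ p y) = 0) : IsSkewEndo φ := by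
  refine ⟨hφ, fun p x y => ?_⟩
  have := h p x y
  rw [pair_apply, pair_apply] at this
  unfold pairing
  linarith

theorem IsSkewEndo.add {ψ : EndoField n M} (hφ : IsSkewEndo φ) (hψ : IsSkewEndo ψ) :
    IsSkewEndo (φ + ψ) :=
  isSkewEndo_of_pair (act_add_mem hφ.smooth hψ.smooth)
    fun p => pair_skew_add (pair_skew hφ p) (pair_skew hψ p)

theorem IsSkewEndo.quarticSemisimple (hφ : IsSkewEndo φ) (a : ℝ) :
    IsSkewEndo (fun p => quarticSemisimple a (φ p) : EndoField n M) :=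
  isSkewEndo_of_pair
    (fun x hx => (genSections n M).smul_mem a⁻¹ (hφ.smooth _ (hφ.smooth _ (hφ.smooth x hx))))
    fun p => pair_skew_quarticSemisimple a (pair_skew hφ p)

theorem IsSkewEndo.quarticNilpotent (hφ : IsSkewEndo φ) (a : ℝ) :
    IsSkewEndo (fun p => quarticNilpotent a (φ p) : EndoField n M) :=
  isSkewEndo_of_pair
    (fun x hx => (genSections n M).sub_mem (hφ.smooth x hx)
      ((genSections n M).smul_mem a⁻¹ (hφ.smooth _ (hφ.smooth _ (hφ.smooth x hx)))))
    fun p => pair_skew_quarticNilpotent a (pair_skew hφ p)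

/-- For the minimal polynomial `x⁴ - a x²` the Jordan parts are polynomials in `φ` with constant
coefficients. -/
theorem jordanParts_quartic (ha : a ≠ 0) (hφ : IsGPS φ (X ^ 4 - C a * X ^ 2)) :
    nilpotentPart φ = (fun p => quarticNilpotent a (φ p)) ∧
      semisimplePart φ = fun p => quarticSemisimple a (φ p) :=
  jordanParts_unique φ (funext fun p => quarticNilpotent_add_quarticSemisimple a (φ p))
    (fun p => (quarticNilpotent_mul_quarticSemisimple ha (hφ.minpoly_eq p)).trans
      (quarticSemisimple_mul_quarticNilpotent ha (hφ.minpoly_eq p)).symm)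
    (fun p => ⟨2, quarticNilpotent_sq ha (hφ.minpoly_eq p)⟩)
    (fun p => isSemisimple_of_cube ha (quarticSemisimple_cube ha (hφ.minpoly_eq p)))

/-- Minimality in terms of the Jordan parts, for the minimal polynomial `x⁴ - a x²`. -/
theorem isMinimal_iff_jordanParts (ha : a ≠ 0) (hφ : IsGPS φ (X ^ 4 - C a * X ^ 2)) :
    IsMinimal φ ↔ IsWeakGenNijenhuis (semisimplePart φ) ∧ IsGenNijenhuis (nilpotentPart φ) ∧
      BivariateTorsionVanishes (semisimplePart φ) (nilpotentPart φ) := by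
  obtain ⟨ht, hs⟩ := jordanParts_quartic ha hφ
  rw [ht, hs]
  exact isMinimal_quartic_iff ha hφ
    (funext fun p => quarticNilpotent_add_quarticSemisimple a (φ p))
    (hφ.skewEndo.quarticSemisimple a).smooth (hφ.skewEndo.quarticNilpotent a).smooth
    (fun p => quarticSemisimple_cube ha (hφ.minpoly_eq p)) (fun p => quarticNilpotent_sq ha (hφ.minpoly_eq p))
    (fun p => quarticSemisimple_mul_quarticNilpotent ha (hφ.minpoly_eq p))
    (fun p => quarticNilpotent_mul_quarticSemisimple ha (hφ.minpoly_eq p))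

theorem IsGenFStructure.cube {J : EndoField n M} (hJ : IsGenFStructure J) (p : M) :
    J p ^ 3 = -J p := cube_of_minpoly (hJ.minpoly_eq p)

theorem isGenFStructure_and_isWeakGenTangent_of_isMinimal
    (hφ : IsGPS φ (X ^ 2 * (X ^ 2 + 1))) (hmin : IsMinimal φ) :
    (IsGenFStructure (semisimplePart φ) ∧ IsStronglyIntegrable (semisimplePart φ)) ∧
      IsWeakGenTangent (nilpotentPart φ) ∧
      (∀ p, semisimplePart φ p * nilpotentPart φ p = 0 ∧
        nilpotentPart φ p * semisimplePart φ p = 0) ∧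
      BivariateTorsionVanishes (semisimplePart φ) (nilpotentPart φ) := by
  have h1 : (-1 : ℝ) ≠ 0 := by norm_num
  rw [quartic_neg_one] at hφ
  obtain ⟨hw, hn, hbi⟩ := (isMinimal_iff_jordanParts h1 hφ).1 hmin
  obtain ⟨ht, hs⟩ := jordanParts_quartic h1 hφ
  rw [hs] at hw hbi ⊢
  rw [ht] at hn hbi ⊢
  have hF : IsGenFStructure fun p => quarticSemisimple (-1) (φ p) :=
    ⟨hφ.skewEndo.quarticSemisimple _, by monicity!,
      by rw [show (X ^ 3 + X : ℝ[X]).natDegree = 3 by compute_degree!]; norm_num,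
      fun p => minpoly_quarticSemisimple (hφ.minpoly_eq p)⟩
  exact ⟨⟨hF, (isStronglyIntegrable_iff hF.skewEndo hF.cube).2 hw⟩,
    ⟨⟨hφ.skewEndo.quarticNilpotent _, monic_X_pow 2, by rw [natDegree_X_pow]; norm_num,
      fun p => minpoly_quarticNilpotent (hφ.minpoly_eq p)⟩, hn⟩,
    fun p => ⟨quarticSemisimple_mul_quarticNilpotent h1 (hφ.minpoly_eq p),
      quarticNilpotent_mul_quarticSemisimple h1 (hφ.minpoly_eq p)⟩, hbi⟩

theorem isMinimal_add_of_isGenFStructure_of_isWeakGenTangent {J₁ J₂ : EndoField n M}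
    (hF : IsGenFStructure J₁) (hint : IsStronglyIntegrable J₁) (hT : IsWeakGenTangent J₂)
    (hmul : ∀ p, J₁ p * J₂ p = 0 ∧ J₂ p * J₁ p = 0) (hbi : BivariateTorsionVanishes J₁ J₂) :
    IsGPS (J₂ + J₁) (X ^ 2 * (X ^ 2 + 1)) ∧ IsMinimal (J₂ + J₁) ∧
      semisimplePart (J₂ + J₁) = J₁ ∧ nilpotentPart (J₂ + J₁) = J₂ := by
  have h1 : (-1 : ℝ) ≠ 0 := by norm_num
  obtain ⟨et, es⟩ := jordanParts_unique (J₂ + J₁) rfl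
    (fun p => (hmul p).2.trans (hmul p).1.symm) (fun p => ⟨2, sq_of_minpoly (hT.1.minpoly_eq p)⟩)
    (fun p => isSemisimple_of_cube h1 (cube_eq_smul_of_minpoly (hF.minpoly_eq p)))
  have hG : IsGPS (J₂ + J₁) (X ^ 2 * (X ^ 2 + 1)) := by
    refine ⟨hT.1.skewEndo.add hF.skewEndo, ?_, ?_, fun p =>
      minpoly_add_of_cubic (hF.minpoly_eq p) (hT.1.minpoly_eq p) (hmul p).1 (hmul p).2⟩
    · rw [quartic_neg_one]
      monicity!
    · rw [quartic_neg_one, natDegree_quartic]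
      norm_num
  refine ⟨hG, ?_, es, et⟩
  rw [quartic_neg_one] at hG
  rw [isMinimal_iff_jordanParts h1 hG, es, et]
  exact ⟨(isStronglyIntegrable_iff hF.skewEndo hF.cube).1 hint, hT.2, hbi⟩

end jordanParts
end GenPoly
end

theorem mainTheorem9 (n : ℕ) (M : Type*) [TopologicalSpace M]
    [ChartedSpace (EuclideanSpace ℝ (Fin n)) M] [IsManifold (𝓡 n) ∞ M] [T2Space M]
    [SecondCountableTopology M] :
    (∀ (φ : GenPoly.EndoField n M) (P : Polynomial ℝ), GenPoly.IsGPS φ P → P.natDegree = 4 →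
      GenPoly.HasThreeEigenvalues φ →
      (GenPoly.IsMinimal φ ↔
        GenPoly.IsWeakGenNijenhuis (GenPoly.semisimplePart φ) ∧
        GenPoly.IsGenNijenhuis (GenPoly.nilpotentPart φ) ∧
        GenPoly.BivariateTorsionVanishes (GenPoly.semisimplePart φ) (GenPoly.nilpotentPart φ))) ∧
    Set.BijOn (fun φ => (GenPoly.semisimplePart φ, GenPoly.nilpotentPart φ))
      {φ : GenPoly.EndoField n M |
        GenPoly.IsGPS φ (Polynomial.X ^ 2 * (Polynomial.X ^ 2 + 1)) ∧ GenPoly.IsMinimal φ}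
      {J : GenPoly.EndoField n M × GenPoly.EndoField n M |
        (GenPoly.IsGenFStructure J.1 ∧ GenPoly.IsStronglyIntegrable J.1) ∧
        GenPoly.IsWeakGenTangent J.2 ∧
        (∀ p : M, J.1 p * J.2 p = 0 ∧ J.2 p * J.1 p = 0) ∧
        GenPoly.BivariateTorsionVanishes J.1 J.2} := by
  refine ⟨fun φ P hP h4 h3 => ?_, fun φ hφ => ?_, fun φ _ ψ _ h => ?_, ?_⟩
  · rcases isEmpty_or_nonempty M with hM | ⟨⟨p⟩⟩
    · refine iff_of_true ?_ ⟨fun _ _ _ _ => funext fun p => hM.elim p,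
        fun _ _ _ _ => funext fun p => hM.elim p, fun _ _ _ _ => funext fun p => hM.elim p⟩
      exact (GenPoly.isMinimal_iff hP).2
        (LinearMap.ext₂ fun x y => Subtype.ext (funext fun p => hM.elim p))
    · obtain ⟨a, ha, rfl⟩ := GenPoly.eq_quartic_of_threeEigenvalues hP h4 h3 p
      exact GenPoly.isMinimal_iff_jordanParts ha hP
  · exact GenPoly.isGenFStructure_and_isWeakGenTangent_of_isMinimal hφ.1 hφ.2
  · rw [GenPoly.eq_nilpotentPart_add_semisimplePart φ,
      GenPoly.eq_nilpotentPart_add_semisimplePart ψ]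
    exact congrArg₂ (· + ·) (congrArg Prod.snd h) (congrArg Prod.fst h)
  · rintro ⟨J₁, J₂⟩ ⟨⟨hF, hint⟩, hT, hmul, hbi⟩
    obtain ⟨hG, hmin, es, et⟩ :=
      GenPoly.isMinimal_add_of_isGenFStructure_of_isWeakGenTangent hF hint hT hmul hbi
    exact ⟨J₂ + J₁, ⟨hG, hmin⟩, Prod.ext es et⟩
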